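/- **Setting.** Let $X$ be a Hausdorff, $\sigma$-compact real analytic manifold of dimension $n$ and $\chi^M=\{M_1,\dots,M_\ell\}$ a family of closed real analytic submanifolds of $X$ such that * (H1) each $M_j$ is connected (and non-empty) and $M_j\ne M_k$ for $j\neq k$; * (H2) for all $j$ and $p\in M_j$, if $NR_p(M_j):=\{M_k : p\in M_k,\ M_j\not\subseteq M_k,\ M_k\not\subseteq M_j\}$ is not empty, then $\bigl(\bigcap_{M_k\in NR_p(M_j)}T_pM_k\bigr)+T_pM_j=T_pX$; * (H3) $M_j\ne\iota(M_j)$ for all $j$, where $\iota(M_j)$ is the intersection of the $M_k$ with $M_j\subsetneq M_k$ ($\iota(M_j)=X$ if there are none). An *adapted chart* is an analytic chart $x=(x_1,\dots,x_n)$ of $X$ with sets $I_j=I_j^M\subseteq\{1,\dots,n\}$, pairwise nested or disjoint, such that each $M_j$ which meets the domain is $\{x_i=0,\ i\in I_j\}$ there ($I_j=\emptyset$ for the other $j$). Put $J_i=J_i^M=\{j : i\in I_j\}$, $t_{J_i}=\prod_{j\in J_i}t_j$ and $\hat I_j=\hat I_j^M=I_j\setminus\bigcup_{I_k\subsetneq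 I_j}I_k$. The multi-normal deformation $\tilde X$ is obtained by gluing the local models $\{(x,t)\in\mathbb R^n\times\mathbb R^\ell : (t_{J_i}x_i)_i \text{ are the coordinates of a point of the domain},\ t_j\ne0\text{ if }M_j\text{ does not meet the domain}\}$ along the continuous extensions of the coordinate changes $\hat t_{J_k}\hat x_k=\varphi_k(t_{J_1}x_1,\dots,t_{J_n}x_n)$, $\hat t=t$ (where $\varphi$ is the coordinate change of $X$, and $\hat t_{J_k}$ is formed with the index sets of the new chart). It carries the map $p:\tilde X\to X$, locally $(x,t)\mapsto(t_{J_i}x_i)_i$, and the functions $t=(t_1,\dots,t_\ell):\tilde X\to\mathbb R^\ell$. Let $S^M=\{t=0\}\subset\tilde X$ be its zero section. Let $(Y;\chi^N)$, $\chi^N=\{N_1,\dots,N_\ell\}$, be a second such pair, $\dim Y=m$, with $\tilde Y$, $S^N$, $I_j^N$, $J_k^N$, $\hat I_j^N$ defined in the same way, and let $f:X\to Y$ be real analytic with $f(M_j)\subseteq N_j$ for all $j$. Put $M=\bigcap_jM_j$, $N=\bigcap_jN_j$ and $J(j)=\{\beta : N_\beta\subseteq N_j\}$; let $\overline{\mathcal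 J}(j)$ (resp. $\underline{\mathcal J}(j)$) be the set of $\beta\in J(j)$ with $M_\beta$ maximal (resp. minimal) for inclusion among the $M_\gamma$, $\gamma\in J(j)$. We say that $j$ satisfies $(\dagger)$ if $\#\underline{\mathcal J}(j)=\#\overline{\mathcal J}(j)$ and, for all $i\in J(j)$ and all $\beta$, $M_\beta\subseteq M_i$ implies $\beta\in J(j)$. **Statement.** 0. In every adapted chart of $Y$ whose domain meets $N$, $J_k^N=J(j)$ for all $j$ and all $k\in\hat I_j^N$; so $(\dagger)$ is the condition expressed through $J_k^N$, for any such $k$. 1. There are bijections $S^M\simeq\times_{X,1\le\beta\le\ell}T_{M_\beta}\iota(M_\beta)$ and $S^N\simeq\times_{Y,1\le\beta\le\ell}T_{N_\beta}\iota(N_\beta)$ which, in every adapted chart, send $(x,0)$ to the point $q=p(x,0)$ of $M$ (resp. $N$) together with the classes of the tangent vectors $\sum_{i\in\hat I_\beta}x_i\,\partial/\partial x_i$ at $q$ ($1\le\beta\le\ell$). 2. There is a unique morphism of real analytic manifolds $\tilde f:\tilde X\to\tilde Y$ (a map locally given by analytic maps between local models) such that $p(\tilde f(z))=f(p(z))$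 and $t(\tilde f(z))=t(z)$ whenever $t_1(z)\cdots t_\ell(z)\ne0$. 3. If $j$ satisfies $(\dagger)$ and $\overline{\mathcal J}(j)=\{j_1,\dots,j_p\}$, there is for every $q\in M$ a multi-linear map $\hat\varphi_{j,q}:\prod_{\beta\in\overline{\mathcal J}(j)}(T_{M_\beta}\iota(M_\beta))_q\to(T_{N_j}\iota(N_j))_{f(q)}$ which, in all adapted charts $x$ at $q$ and $y$ at $f(q)$, is given by $$y_k=\sum_{i_1\in\hat I_{j_1}^M,\dots,i_p\in\hat I_{j_p}^M}\frac{\partial^pf_k}{\partial x_{i_1}\cdots\partial x_{i_p}}(q)\,x_{i_1}\cdots x_{i_p}\qquad(k\in\hat I_j^N),$$ where $(x_i)_{i\in\hat I_\beta^M}$ and $(y_k)_{k\in\hat I_j^N}$ are the fibre coordinates of $T_{M_\beta}\iota(M_\beta)$ and $T_{N_j}\iota(N_j)$. 4. For $v=(q;(v_\beta)_\beta)\in S^M$, let $\varphi_j(v)=\hat\varphi_{j,q}\bigl((v_\beta)_{\beta\in\overline{\mathcal J}(j)}\bigr)$ if $j$ satisfies $(\dagger)$, and let $\varphi_j(v)=0\in(T_{N_j}\iota(N_j))_{f(q)}$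 otherwise. Under the identifications in 1, the restriction of $\tilde f$ to $S^M$ is the map $\varphi_1\times_Y\cdots\times_Y\varphi_\ell:S^M\to S^N$, $v\mapsto(f(q);\varphi_1(v),\dots,\varphi_\ell(v))$. 5. This map $\Phi=\varphi_1\times_Y\cdots\times_Y\varphi_\ell$ is multi-conic: for $c\in(\mathbb R^+)^\ell$ let $\tau(c)$ multiply the $j$-th component of a point of $S^M$ or $S^N$ by $c_j$, and let $\mu(c)$ multiply it by $\prod_{M_k\subseteq M_j}c_k$ on $S^M$, by $\prod_{N_k\subseteq N_j}c_k$ on $S^N$. Then $$\Phi(\tau(c)v)=\tau\Bigl(\bigl(\textstyle\prod_{\beta\in\overline{\mathcal J}(j)}c_\beta\bigr)_{1\le j\le\ell}\Bigr)\Phi(v),\qquad\Phi(\mu(c)v)=\mu(c)\Phi(v)\qquad(v\in S^M).$$ -/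

import Mathlib

open scoped Manifold ContDiff Topology
open Set Filter

noncomputable section

namespace MultiNormal

/-! ### Families of submanifolds of a real analytic manifold -/

section Families

variable {n l : ℕ} {X : Type*} [TopologicalSpace X] [ChartedSpace (Fin n → ℝ) X]

/-- A closed real analytic submanifold of the `n`-dimensional real analytic manifold `X`: a closed
set which near each of its points is a coordinate subspace in some analytic chart. -/
def IsClosedSubmanifold (A : Set X) : Prop :=
  IsClosed A ∧ ∀ p ∈ A, ∃ e ∈ IsManifold.maximalAtlas 𝓘(ℝ, Fin n → ℝ) ω X,
    p ∈ e.source ∧ ∃ I : Finset (Fin n), ∀ x ∈ e.source, x ∈ A ↔ ∀ i ∈ I, e x i = 0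

/-- The tangent space `T_q A ⊆ T_q X` of a submanifold `A` at a point `q ∈ A`: the common kernel of
the differentials of the analytic functions near `q` which vanish on `A` near `q`. -/
def tangentTo (A : Set X) (q : X) : Submodule ℝ (TangentSpace 𝓘(ℝ, Fin n → ℝ) q) where
  carrier := {v | ∀ g : X → ℝ, ContMDiffAt 𝓘(ℝ, Fin n → ℝ) 𝓘(ℝ, ℝ) ω g q →
    (∀ᶠ x in 𝓝[A] q, g x = 0) → mfderiv 𝓘(ℝ, Fin n → ℝ) 𝓘(ℝ, ℝ) g q v = 0}
  zero_mem' := fun _ _ _ => map_zero _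
  add_mem' := fun hv hw g hg h => by rw [map_add, hv g hg h, hw g hg h, add_zero]
  smul_mem' := fun c v hv g hg h => by rw [map_smul, hv g hg h, smul_zero]

/-- `ι(M_j)`: the intersection of the members of the family which strictly contain `M_j`
(the whole space `X` when there is none). -/
def iota (M : Fin l → Set X) (j : Fin l) : Set X := ⋂ k ∈ {k | M j ⊂ M k}, M k

/-- The indices of the family `NR_p(M_j)`. -/
def NR (M : Fin l → Set X) (p : X) (j : Fin l) : Set (Fin l) :=
  {k | p ∈ M k ∧ ¬ M j ⊆ M k ∧ ¬ M k ⊆ M j}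

/-- Families of closed submanifolds satisfying the conditions H1, H2 and H3. -/
structure IsAdmissible (M : Fin l → Set X) : Prop where
  submanifold : ∀ j, IsClosedSubmanifold (n := n) (M j)
  /-- H1 -/
  connected : ∀ j, IsConnected (M j)
  distinct : ∀ j k, j ≠ k → M j ≠ M k
  /-- H2 -/
  transversal : ∀ j, ∀ p ∈ M j, (NR M p j).Nonempty →
    (⨅ k ∈ NR M p j, tangentTo (n := n) (M k) p) ⊔ tangentTo (n := n) (M j) p = ⊤
  /-- H3 -/
  ne_iota : ∀ j, M j ≠ iota M j

/-- The fibre at `q` of the normal bundle `T_{M_j} ι(M_j)`, that is `T_q ι(M_j) / T_q M_j`. -/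
abbrev NormalSpace (M : Fin l → Set X) (q : X) (j : Fin l) : Type :=
  (tangentTo (n := n) (iota M j) q) ⧸
    (tangentTo (n := n) (M j) q).comap (tangentTo (n := n) (iota M j) q).subtype

/-- The class in the fibre of `T_{M_j} ι(M_j)` of a vector tangent to `ι(M_j)`. -/
def normalClass (M : Fin l → Set X) {q : X} {j : Fin l}
    (w : tangentTo (n := n) (iota M j) q) : NormalSpace (n := n) M q j :=
  Submodule.Quotient.mk w

/-- The fibre product over `X` of the bundles `T_{M_j} ι(M_j)`: a point `q` of the intersection of
all the `M_j` together with a normal vector in each fibre. -/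
abbrev NormalProduct (n : ℕ) {l : ℕ} {X : Type*} [TopologicalSpace X] [ChartedSpace (Fin n → ℝ) X]
    (M : Fin l → Set X) : Type _ :=
  Σ q : (⋂ j, M j : Set X), ∀ j, NormalSpace (n := n) M (q : X) j

/-- The action `τ` : the `j`-th factor of `(ℝ⁺)^l` dilates the fibres of `T_{M_j} ι(M_j)` and
fixes the other components. -/
def tau (M : Fin l → Set X) (c : Fin l → ℝ) (v : NormalProduct n M) : NormalProduct n M :=
  ⟨v.1, fun j => c j • v.2 j⟩

open Classical in
/-- The action `μ` on the zero section: its `k`-th factor is the product of the `τ_j` over the `j`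
with `M_k ⊆ M_j`. -/
def mu (M : Fin l → Set X) (c : Fin l → ℝ) (v : NormalProduct n M) : NormalProduct n M :=
  tau M (fun j => ∏ k with M k ⊆ M j, c k) v

/-! ### Adapted charts and the multi-normal deformation -/

/-- An analytic chart in which each `M_j` that meets its domain is the coordinate subspace
`{x_i = 0, i ∈ I_j}`, the `I_j` being pairwise nested or disjoint. -/
structure AdaptedChart (n : ℕ) {l : ℕ} {X : Type*} [TopologicalSpace X]
    [ChartedSpace (Fin n → ℝ) X] (M : Fin l → Set X) where
  chart : OpenPartialHomeomorph X (Fin n → ℝ)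
  mem_atlas : chart ∈ IsManifold.maximalAtlas 𝓘(ℝ, Fin n → ℝ) ω X
  I : Fin l → Finset (Fin n)
  mem_iff : ∀ j, (M j ∩ chart.source).Nonempty →
    ∀ x ∈ chart.source, x ∈ M j ↔ ∀ i ∈ I j, chart x i = 0
  I_eq_empty : ∀ j, ¬ (M j ∩ chart.source).Nonempty → I j = ∅
  nested : ∀ j k, I j ⊆ I k ∨ I k ⊆ I j ∨ Disjoint (I j) (I k)

namespace AdaptedChart

variable {M : Fin l → Set X} (φ : AdaptedChart n M)

/-- `J_i = {j | i ∈ I_j}` -/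
def J (i : Fin n) : Finset (Fin l) := {j | i ∈ φ.I j}

/-- `Î_j`: the elements of `I_j` which lie in no `I_k` strictly contained in `I_j`. -/
def Ihat (j : Fin l) : Finset (Fin n) := {i ∈ φ.I j | ∀ k, φ.I k ⊂ φ.I j → i ∉ φ.I k}

/-- `t_{J_i} = ∏_{j ∈ J_i} t_j` -/
def weight (t : Fin l → ℝ) (i : Fin n) : ℝ := ∏ j ∈ φ.J i, t j

/-- `(x, t) ↦ (t_{J_1} x_1, …, t_{J_n} x_n)` -/
def scale (z : (Fin n → ℝ) × (Fin l → ℝ)) : Fin n → ℝ := fun i => φ.weight z.2 i * z.1 i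

/-- The local model of the multi-normal deformation over the domain of the chart: the `(x, t)` such
that `(t_{J_i} x_i)_i` are the coordinates of a point of the domain (where `t_j ≠ 0` when `M_j` does
not meet the domain, the deformation along the empty set being `X × {t ≠ 0}`). -/
def model : Set ((Fin n → ℝ) × (Fin l → ℝ)) :=
  {z | φ.scale z ∈ φ.chart.target ∧ ∀ j, ¬ (M j ∩ φ.chart.source).Nonempty → z.2 j ≠ 0}

/-- The projection `p` to `X` in the local model. -/
def toBase (z : (Fin n → ℝ) × (Fin l → ℝ)) : X := φ.chart.symm (φ.scale z)

end AdaptedChart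

/-- The gluing of the local models: `(x, t)` in the model of `φ` and `(y, t)` in the model of `ψ` are
identified when they lie over the same point of `X` and `y` is the value at `(x, t)` of the
extension by continuity of the coordinate change, which on `{t_1 ⋯ t_l ≠ 0}` is given by
`t_{J_k} y_k = (ψ ∘ φ⁻¹)_k (t_{J_1} x_1, …, t_{J_n} x_n)`. -/
def Glue (M : Fin l → Set X) (a b : Σ φ : AdaptedChart n M, φ.model) : Prop :=
  a.2.1.2 = b.2.1.2 ∧ a.1.toBase a.2.1 = b.1.toBase b.2.1 ∧
    Tendsto (fun (z : (Fin n → ℝ) × (Fin l → ℝ)) (k : Fin n) =>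
        b.1.chart (a.1.toBase z) k / b.1.weight z.2 k)
      (𝓝[{z | ∀ j, z.2 j ≠ 0}] a.2.1) (𝓝 b.2.1.1)

/-- The multi-normal deformation `X̃` of `X` along `M_1, …, M_l`, with the quotient topology. -/
def Deformation (n : ℕ) {l : ℕ} {X : Type*} [TopologicalSpace X] [ChartedSpace (Fin n → ℝ) X]
    (M : Fin l → Set X) : Type _ :=
  Quot (Glue (n := n) M)

instance (M : Fin l → Set X) : TopologicalSpace (Deformation n M) :=
  inferInstanceAs (TopologicalSpace (Quot (Glue (n := n) M)))

namespace Deformation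

variable {M : Fin l → Set X}

/-- The point of `X̃` with coordinates `z = (x, t)` in the local model of `φ`. -/
def mk (φ : AdaptedChart n M) (z : φ.model) : Deformation n M := Quot.mk _ ⟨φ, z⟩

/-- The projection `p : X̃ → X`. -/
def proj : Deformation n M → X := Quot.lift (fun a => a.1.toBase a.2.1) fun _ _ h => h.2.1

/-- The deformation parameters `t : X̃ → ℝ^l`. -/
def param : Deformation n M → (Fin l → ℝ) := Quot.lift (fun a => a.2.1.2) fun _ _ h => h.1

end Deformation

/-- The zero section `S = {t_1 = ⋯ = t_l = 0} ⊆ X̃`. -/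
def ZeroSection (n : ℕ) {l : ℕ} {X : Type*} [TopologicalSpace X] [ChartedSpace (Fin n → ℝ) X]
    (M : Fin l → Set X) : Set (Deformation n M) :=
  {z | z.param = 0}

/-- The canonical identification of the zero section with the fibre product of the bundles
`T_{M_j} ι(M_j)`: in every adapted chart, the point `(x, 0)` corresponds to the point `q` with
coordinates `(0 · x_i if i ∈ ⋃ I_j, x_i otherwise)` and to the classes of the tangent vectors
`∑_{i ∈ Î_j} x_i ∂/∂x_i`. -/
def IsCanonical (M : Fin l → Set X) (σ : ZeroSection n M ≃ NormalProduct n M) : Prop :=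
  ∀ (φ : AdaptedChart n M) (z : φ.model) (hz : Deformation.mk φ z ∈ ZeroSection n M),
    ((σ ⟨Deformation.mk φ z, hz⟩).1 : X) = φ.toBase z.1 ∧
    ∀ j, ∃ w : tangentTo (n := n) (iota M j) ((σ ⟨Deformation.mk φ z, hz⟩).1 : X),
      normalClass M w = (σ ⟨Deformation.mk φ z, hz⟩).2 j ∧
      mfderiv 𝓘(ℝ, Fin n → ℝ) 𝓘(ℝ, Fin n → ℝ) φ.chart
          ((σ ⟨Deformation.mk φ z, hz⟩).1 : X) (w : TangentSpace 𝓘(ℝ, Fin n → ℝ) _) =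
        fun i => if i ∈ φ.Ihat j then z.1.1 i else 0

end Families

/-! ### Morphisms -/

section Morphisms

variable {n m l : ℕ} {X Y : Type*} [TopologicalSpace X] [ChartedSpace (Fin n → ℝ) X]
  [TopologicalSpace Y] [ChartedSpace (Fin m → ℝ) Y] {M : Fin l → Set X} {N : Fin l → Set Y}

/-- Morphisms of real analytic manifolds between multi-normal deformations: maps which are locally
given by analytic maps between local models. -/
def IsAnalyticMap (F : Deformation n M → Deformation m N) : Prop :=
  ∀ (φ : AdaptedChart n M) (z : φ.model), ∃ (ψ : AdaptedChart m N)
    (G : (Fin n → ℝ) × (Fin l → ℝ) → (Fin m → ℝ) × (Fin l → ℝ)), AnalyticAt ℝ G z ∧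
      ∀ᶠ w : φ.model in 𝓝 z, ∃ h : G w ∈ ψ.model,
        F (Deformation.mk φ w) = Deformation.mk ψ ⟨G w, h⟩

/-- `F` extends `f`: it is a morphism `X̃ → Ỹ` which over `{t_1 ⋯ t_l ≠ 0}` (where `X̃` is
`X × {t_1 ⋯ t_l ≠ 0}` through `(p, t)`) is `(x, t) ↦ (f x, t)`. -/
def IsExtension (f : X → Y) (F : Deformation n M → Deformation m N) : Prop :=
  IsAnalyticMap F ∧ ∀ z : Deformation n M, (∀ j, z.param j ≠ 0) →
    (F z).proj = f z.proj ∧ (F z).param = z.param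

open Classical in
/-- The indices of the maximal submanifolds among the `M_β`, `β ∈ J`. -/
def supIdx (M : Fin l → Set X) (J : Finset (Fin l)) : Finset (Fin l) :=
  {j ∈ J | ∀ β ∈ J, M j ⊆ M β → M β = M j}

open Classical in
/-- The indices of the minimal submanifolds among the `M_β`, `β ∈ J`. -/
def infIdx (M : Fin l → Set X) (J : Finset (Fin l)) : Finset (Fin l) :=
  {j ∈ J | ∀ β ∈ J, M β ⊆ M j → M β = M j}

open Classical in
/-- `J(j) = {β | N_β ⊆ N_j}`. -/
def lowerIdx (N : Fin l → Set Y) (j : Fin l) : Finset (Fin l) := {β | N β ⊆ N j}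

/-- The maximal indices `J̄(j)` of `J(j)` with respect to the family `M`. -/
def Jbar (M : Fin l → Set X) (N : Fin l → Set Y) (j : Fin l) : Finset (Fin l) :=
  supIdx M (lowerIdx N j)

/-- The condition (†) for the index `j`. -/
def Dagger (M : Fin l → Set X) (N : Fin l → Set Y) (j : Fin l) : Prop :=
  (infIdx M (lowerIdx N j)).card = (supIdx M (lowerIdx N j)).card ∧
    ∀ i ∈ lowerIdx N j, ∀ β, M β ⊆ M i → β ∈ lowerIdx N j

/-- The mixed partial derivative `∂^p g / ∂x_{i_1} ⋯ ∂x_{i_p}` at `x`. -/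
def mixedPartial {p : ℕ} (g : (Fin n → ℝ) → ℝ) (i : Fin p → Fin n) (x : Fin n → ℝ) : ℝ :=
  iteratedFDeriv ℝ p g x fun a => Pi.single (i a) 1

/-- The families of multi-linear maps from the fibres at `q` of the `T_{M_β} ι(M_β)`, `β ∈ J̄(j)`, to
the fibre at `f q` of `T_{N_j} ι(N_j)`, for the `j` that satisfy (†) and `q ∈ ⋂ M_β`. -/
abbrev FibreMaps (n m : ℕ) {l : ℕ} {X Y : Type*} [TopologicalSpace X]
    [ChartedSpace (Fin n → ℝ) X] [TopologicalSpace Y] [ChartedSpace (Fin m → ℝ) Y]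
    (f : X → Y) (M : Fin l → Set X) (N : Fin l → Set Y) : Type _ :=
  ∀ j, Dagger M N j → ∀ q : (⋂ β, M β : Set X),
    MultilinearMap ℝ (fun β : Jbar M N j => NormalSpace (n := n) M (q : X) β)
      (NormalSpace (n := m) N (f q) j)

/-- `A` is the family of the maps `φ̂_j`: in all adapted charts `φ` at `q` and `ψ` at `f q`, if `w_β`
is a representative of the `β`-th argument, with coordinates `x_i`, and `u` is a representative of
the value, with coordinates `y_k`, then for `k ∈ Î_j^N`
`y_k = ∑ ∂^p f_k / ∂x_{i_1} ⋯ ∂x_{i_p} (q) x_{i_1} ⋯ x_{i_p}`,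
the sum being over `i_1 ∈ Î_{j_1}^M, …, i_p ∈ Î_{j_p}^M`, where `J̄(j) = {j_1 < ⋯ < j_p}`. -/
def IsPhiHat (f : X → Y) (A : FibreMaps n m f M N) : Prop :=
  ∀ (j : Fin l) (hj : Dagger M N j) (q : (⋂ β, M β : Set X))
    (φ : AdaptedChart n M) (ψ : AdaptedChart m N),
    (q : X) ∈ φ.chart.source → f q ∈ ψ.chart.source →
    ∀ (w : ∀ β : Jbar M N j, tangentTo (n := n) (iota M (β : Fin l)) (q : X))
      (u : tangentTo (n := m) (iota N j) (f q)),
      normalClass N u = A j hj q (fun β => normalClass M (w β)) →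
      ∀ k ∈ ψ.Ihat j,
        (mfderiv 𝓘(ℝ, Fin m → ℝ) 𝓘(ℝ, Fin m → ℝ) ψ.chart (f q)
          (u : TangentSpace 𝓘(ℝ, Fin m → ℝ) (f q)) : Fin m → ℝ) k =
        ∑ i ∈ Fintype.piFinset
            (fun a : Fin (Jbar M N j).card => φ.Ihat ((Jbar M N j).orderIsoOfFin rfl a)),
          mixedPartial (fun x => ψ.chart (f (φ.chart.symm x)) k) i (φ.chart q) *
            ∏ a, (mfderiv 𝓘(ℝ, Fin n → ℝ) 𝓘(ℝ, Fin n → ℝ) φ.chart (q : X)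
              (w ((Jbar M N j).orderIsoOfFin rfl a) : TangentSpace 𝓘(ℝ, Fin n → ℝ) (q : X)) :
                Fin n → ℝ) (i a)

open Classical in
/-- The map `φ_j`: the composition of the projection to the components in `J̄(j)` and of `φ̂_j` if `j`
satisfies (†), and zero otherwise. -/
def phi (f : X → Y) (A : FibreMaps n m f M N) (j : Fin l) (v : NormalProduct n M) :
    NormalSpace (n := m) N (f v.1) j :=
  if h : Dagger M N j then A j h v.1 (fun β => v.2 β) else 0

/-- The map `φ_1 ×_Y ⋯ ×_Y φ_l` between the fibre products. -/
def phiProd (f : X → Y) (hf : ∀ j, MapsTo f (M j) (N j)) (A : FibreMaps n m f M N)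
    (v : NormalProduct n M) : NormalProduct m N :=
  ⟨⟨f v.1, mem_iInter.2 fun j => hf j (mem_iInter.1 v.1.2 j)⟩, fun j => phi f A j v⟩

end Morphisms

end MultiNormal

end

open MultiNormal

/-! Where no `t_j` vanishes, the extension can only be `(x, t) ↦ (f_k(t_{J_i} x_i) / t_{J_k}, t)`.
The content is that these quotients are analytic up to `t = 0` and that their values there are
Taylor coefficients of `f_k`.

If `j ∈ J_k` and `t_j = 0`, the base point lies in `M_j`, its image lies in `N_j`, and so `f_k`
vanishes there. An analytic function vanishing on the hyperplanes `t_j = 0` is divisible by the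
product of the `t_j` (`exists_analyticAt_prod_mul`), which gives `exists_analytic_lift`. Since `{t_1
⋯ t_l ≠ 0}` is dense, lifts are unique. The gluing relation is the relation "is a lift of the
identity", so that it is an equivalence relation, and that local lifts of `f` glue, both follow from
composition and uniqueness of lifts.

At `t = 0` the quotient is the coefficient of `∏_{j ∈ J_k} t_j` in `f_k(t_{J_i} x_i)`
(`value_eq_sum_taylor`). A Taylor monomial `x_{i_1} ⋯ x_{i_m}` contributes exactly when the nonempty
sets `J_{i_1}, …, J_{i_m}` partition `J_k`. In a chart at a common point of the submanifolds, `J_i`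
for `i ∈ Î_β` is the down-set `{k | M_k ⊆ M_β}`, and this down-set is a chain because the `I_j` are
nested or disjoint. A partition of `J(j)` by such sets can exist only under (†). Its blocks are then
the down-sets of the maximal elements, one for each `β ∈ J̄(j)`. The contributions are therefore
those with one index in each `Î_β`; summed over their orderings they give the mixed partial
derivatives. Without (†) nothing contributes and the value is zero.

For the identity map there is a single block, and the formula says that the coordinates in `Î_j`
change by the Jacobian (`coordinate_change_zeroSection`), as the fibre coordinates of `T_{M_j}
ι(M_j)` do; this identifies the zero section. Hence the multi-linear maps, defined in one pair of
charts, satisfy the formula in all charts. Multi-conicity is their homogeneity together with the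
partition of `J(j)` into down-sets.

Two geometric facts support this. Inclusions among the `M_j` are equivalent to reversed inclusions
among the `I_j` (`reflectsOrder`), by connectedness and the identity theorem. Adapted charts exist
at every point (`exists_adaptedChart`): H2 dualises to an independence condition on conormal spaces,
which yields an adapted basis of covectors, realised by analytic equations. -/

namespace MultiNormal

/-! ### Division of analytic functions by coordinates -/

section Division

variable {E : Type*} [NormedAddCommGroup E] [NormedSpace ℝ E]

/-- The power series of the difference quotient of `p` in the direction `e`: its `n`-th term is
`∑ k, p (n + 1) (w, …, w, e, P w, …, P w)`. -/
noncomputable def quotientSeries (p : FormalMultilinearSeries ℝ E ℝ) (e : E) (P : E →L[ℝ] E) :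
    FormalMultilinearSeries ℝ E ℝ := fun n =>
  ∑ k : Fin (n + 1), ((p (n + 1)).curryMid k e).compContinuousLinearMap
    (fun i : Fin n => if i.castSucc < k then ContinuousLinearMap.id ℝ E else P)

/-- Telescoping: the arguments `v` are replaced by `w` one slot at a time, from left to right. -/
theorem map_sub_map_eq_sum {n : ℕ} (q : ContinuousMultilinearMap ℝ (fun _ : Fin (n + 1) => E) ℝ)
    (w v : E) :
    q (fun _ => w) - q (fun _ => v) = ∑ k : Fin (n + 1),
      q (k.insertNth (w - v) (fun i : Fin n => if i.castSucc < k then w else v)) := by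
  -- `T k` has `w` in the first `k` slots; the `k`-th summand is the increment `T (k + 1) - T k`.
  set T : ℕ → ℝ := fun k => q (fun i : Fin (n + 1) => if (i : ℕ) < k then w else v) with hT
  have key : ∀ k : Fin (n + 1),
      q (k.insertNth (w - v) (fun i : Fin n => if i.castSucc < k then w else v)) =
        T (k + 1) - T k := by
    intro k
    have h1 : ∀ u : E, q (k.insertNth u (fun i : Fin n => if i.castSucc < k then w else v)) =
        q (Function.update (fun i : Fin (n + 1) => if (i : ℕ) < k then w else v) k u) := by
      intro u
      congr 1
      ext i
      refine Fin.succAboveCases k ?_ (fun j => ?_) i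
      · simp
      · rw [Fin.insertNth_apply_succAbove, Function.update_of_ne (Fin.succAbove_ne k j)]
        by_cases h : j.castSucc < k
        · rw [Fin.succAbove_of_castSucc_lt _ _ h]
          have : (j : ℕ) < k := by simpa [Fin.lt_def] using h
          simp [h, this]
        · rw [Fin.succAbove_of_le_castSucc _ _ (not_lt.1 h)]
          have : ¬ (j : ℕ) + 1 < k := by
            have : ¬ (j : ℕ) < k := by simpa [Fin.lt_def] using h
            omega
          simp [h, this]
    rw [h1, q.map_update_sub]
    congr 1
    · simp only [hT]
      congr 1
      ext i
      by_cases h : i = k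
      · subst h; simp
      · rw [Function.update_of_ne h]
        have : (i : ℕ) < k + 1 ↔ (i : ℕ) < k := by
          have : (i : ℕ) ≠ k := fun h' => h (Fin.ext h')
          omega
        simp [this]
    · simp only [hT]
      congr 1
      ext i
      by_cases h : i = k
      · subst h; simp
      · rw [Function.update_of_ne h]
  rw [Finset.sum_congr rfl fun k _ => key k, Fin.sum_univ_eq_sum_range (fun k => T (k + 1) - T k),
    Finset.sum_range_sub]
  have hT1 : T (n + 1) = q fun _ => w := by
    simp only [hT]; congr 1; ext i; simp [i.isLt]
  rw [hT1]
  simp [hT]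

/-- In each telescoping term the slot `k` holds `w - P w = ℓ w • e`, so the scalar `ℓ w` comes out.
-/
theorem quotientSeries_apply (p : FormalMultilinearSeries ℝ E ℝ) (e : E) (ℓ : E →L[ℝ] ℝ)
    (P : E →L[ℝ] E) (hP : ∀ w, w - P w = ℓ w • e) (n : ℕ) (w : E) :
    ℓ w * quotientSeries p e P n (fun _ => w) =
      p (n + 1) (fun _ => w) - p (n + 1) (fun _ => P w) := by
  rw [map_sub_map_eq_sum, hP]
  simp only [quotientSeries, sum_apply, Finset.mul_sum,
    ContinuousMultilinearMap.compContinuousLinearMap_apply, ContinuousMultilinearMap.curryMid_apply]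
  refine Finset.sum_congr rfl fun k _ => ?_
  have h : ∀ (u : E) (m : Fin n → E), (k.insertNth u m : Fin (n + 1) → E) =
      Function.update (k.insertNth (0 : E) m : Fin (n + 1) → E) k u := by
    intro u m; simp
  rw [h, h (ℓ w • e), (p (n + 1)).map_update_smul, smul_eq_mul]
  congr 4
  ext i
  split_ifs <;> simp

theorem quotientSeries_radius_pos (p : FormalMultilinearSeries ℝ E ℝ) (e : E) (P : E →L[ℝ] E)
    (hp : 0 < p.radius) : 0 < (quotientSeries p e P).radius := by
  obtain ⟨r, hr0, hr⟩ := ENNReal.lt_iff_exists_nnreal_btwn.1 hp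
  have hr0 : (0 : ℝ) < r := by exact_mod_cast hr0
  obtain ⟨C, hC, hCb⟩ := p.norm_mul_pow_le_of_lt_radius hr
  set K : ℝ := 1 + ‖P‖ with hK
  have hK1 : 1 ≤ K := by simp [hK]
  have hK0 : 0 < K := by linarith
  -- The radius shrinks by `2 * K`: the powers of `2` absorb the `n + 1` summands, and those of `K`
  -- absorb the norms of the identity and of `P`.
  obtain ⟨r', hr'⟩ : ∃ r' : NNReal, (r' : ℝ) = r / (2 * K) := ⟨⟨r / (2 * K), by positivity⟩, rfl⟩
  have hbound : ∀ n, ‖quotientSeries p e P n‖ * (r' : ℝ) ^ n ≤ C / r * ‖e‖ := by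
    intro n
    have h1 : ‖quotientSeries p e P n‖ ≤ (n + 1) * (‖p (n + 1)‖ * ‖e‖ * K ^ n) := by
      refine (norm_sum_le _ _).trans ?_
      have : ∀ k : Fin (n + 1), ‖((p (n + 1)).curryMid k e).compContinuousLinearMap
          (fun i : Fin n => if i.castSucc < k then ContinuousLinearMap.id ℝ E else P)‖ ≤
          ‖p (n + 1)‖ * ‖e‖ * K ^ n := by
        intro k
        refine (ContinuousMultilinearMap.norm_compContinuousLinearMap_le _ _).trans ?_
        gcongr
        · refine (ContinuousLinearMap.le_opNorm _ _).trans ?_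
          rw [ContinuousMultilinearMap.norm_curryMid]
        · have : K ^ n = ∏ _i : Fin n, K := by simp
          rw [this]
          refine Finset.prod_le_prod (fun _ _ => norm_nonneg _) fun i _ => ?_
          split_ifs
          · exact ContinuousLinearMap.norm_id_le.trans hK1
          · simp [hK]
      refine (Finset.sum_le_sum fun k _ => this k).trans ?_
      simp
    have h2 : ((n : ℝ) + 1) ≤ 2 ^ n := by
      have : n + 1 ≤ 2 ^ n := Nat.lt_two_pow_self
      exact_mod_cast this
    have h3 : (r' : ℝ) ^ n = r ^ n / (2 ^ n * K ^ n) := by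
      simp [hr', div_pow, mul_pow]
    have h4 : ‖p (n + 1)‖ * r ^ n ≤ C / r := by
      rw [le_div_iff₀ hr0]
      have := hCb (n + 1)
      rw [pow_succ] at this
      linarith [this]
    calc ‖quotientSeries p e P n‖ * (r' : ℝ) ^ n
        ≤ (2 ^ n * (‖p (n + 1)‖ * ‖e‖ * K ^ n)) * (r ^ n / (2 ^ n * K ^ n)) := by
          rw [h3]
          gcongr
          exact h1.trans (by gcongr)
      _ = ‖p (n + 1)‖ * r ^ n * ‖e‖ := by
          field_simp
      _ ≤ C / r * ‖e‖ := by gcongr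
  have := (quotientSeries p e P).le_radius_of_bound _ hbound
  refine lt_of_lt_of_le ?_ this
  have : 0 < r' := by
    rw [← NNReal.coe_pos]; rw [hr']; positivity
  exact_mod_cast this

/-- An analytic function which vanishes on a hyperplane is divisible by its equation. -/
theorem exists_analyticAt_mul_of_vanishing {h : E → ℝ} {z : E} (hh : AnalyticAt ℝ h z)
    (ℓ : E →L[ℝ] ℝ) (e : E) (he : ℓ e = 1) (hz : ℓ z = 0)
    (hv : ∀ᶠ w in 𝓝 z, ℓ w = 0 → h w = 0) :
    ∃ g : E → ℝ, AnalyticAt ℝ g z ∧ ∀ᶠ w in 𝓝 z, h w = ℓ w * g w := by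
  obtain ⟨p, r, hp⟩ := hh
  set P : E →L[ℝ] E := ContinuousLinearMap.id ℝ E - ℓ.smulRight e with hPdef
  have hP : ∀ w, w - P w = ℓ w • e := by intro w; simp [hPdef]
  have hlP : ∀ w, ℓ (P w) = 0 := by intro w; simp [hPdef, he]
  set q := quotientSeries p e P with hq
  have hq0 : 0 < q.radius :=
    quotientSeries_radius_pos p e P (hp.r_pos.trans_le hp.r_le)
  have hqs := q.hasFPowerSeriesOnBall hq0
  refine ⟨fun w => q.sum (w - z), ?_, ?_⟩
  · have : AnalyticAt ℝ q.sum (z - z) := by rw [sub_self]; exact hqs.analyticAt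
    exact AnalyticAt.comp (f := fun w => w - z) this (analyticAt_id.sub analyticAt_const)
  · have t0 : Tendsto (fun w => w - z) (𝓝 z) (𝓝 0) := by
      have : Continuous fun w : E => w - z := by fun_prop
      simpa using this.tendsto z
    have t1 : Tendsto (fun w => P (w - z)) (𝓝 z) (𝓝 0) := by
      have := (P.continuous.tendsto 0).comp t0
      rwa [map_zero] at this
    have t2 : Tendsto (fun w => z + P (w - z)) (𝓝 z) (𝓝 z) := by
      simpa using tendsto_const_nhds.add t1
    have b1 := t0.eventually (Metric.eball_mem_nhds (0 : E) hp.r_pos)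
    have b2 := t1.eventually (Metric.eball_mem_nhds (0 : E) hp.r_pos)
    have b3 := t0.eventually (Metric.eball_mem_nhds (0 : E) hq0)
    filter_upwards [b1, b2, b3, t2.eventually hv] with w h1 h2 h3 h4
    have s1 := hp.hasSum h1
    have s2 := hp.hasSum h2
    have s3 := (hqs.hasSum h3).mul_left (ℓ (w - z))
    simp only [hq, quotientSeries_apply p e ℓ P hP, zero_add] at s3
    have s4 := s1.sub s2
    -- `P` projects onto the kernel of `ℓ` and `ℓ z = 0`, so this point lies on the hyperplane where
    -- `h` vanishes.
    have e0 : h (z + P (w - z)) = 0 := h4 (by simp [hz, hlP])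
    rw [e0, sub_zero, add_sub_cancel] at s4
    -- The term of degree zero cancels in the difference; the shift by one matches the use of `p (n
    -- + 1)` in `quotientSeries`.
    have s5 := (hasSum_nat_add_iff' 1).2 s4
    have e1 : p 0 (fun _ => w - z) = p 0 (fun _ => P (w - z)) := by
      congr 1; ext i; exact i.elim0
    simp only [Finset.range_one, Finset.sum_singleton, e1, sub_self, sub_zero] at s5
    have := s5.unique s3
    simpa [hz] using this

end Division

/-! ### Division by products of deformation parameters -/

section Parameters

variable {F : Type*} [NormedAddCommGroup F] {l : ℕ}

theorem mem_closure_param_ne_zero (z : F × (Fin l → ℝ)) :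
    z ∈ closure {w : F × (Fin l → ℝ) | ∀ j, w.2 j ≠ 0} := by
  have : Dense {w : F × (Fin l → ℝ) | ∀ j, w.2 j ≠ 0} := by
    have h : {w : F × (Fin l → ℝ) | ∀ j, w.2 j ≠ 0} =
        univ ×ˢ (univ.pi fun _ : Fin l => ({0}ᶜ : Set ℝ)) := by
      ext w; simp
    rw [h]
    exact dense_univ.prod (dense_pi _ fun _ _ => dense_compl_singleton 0)
  exact this z

/-- Makes limits along `{t_1 ⋯ t_l ≠ 0}` unique; uniqueness of lifts and of the extension rests on
it. -/
instance neBot_param_ne_zero (z : F × (Fin l → ℝ)) :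
    (𝓝[{w : F × (Fin l → ℝ) | ∀ j, w.2 j ≠ 0}] z).NeBot :=
  mem_closure_iff_nhdsWithin_neBot.1 (mem_closure_param_ne_zero z)

variable [NormedSpace ℝ F]

/-- An analytic function which vanishes on the hyperplanes `t_j = 0`, `j ∈ K`, is divisible by
`∏ j ∈ K, t_j`. -/
theorem exists_analyticAt_prod_mul (K : Finset (Fin l)) {h : F × (Fin l → ℝ) → ℝ}
    {z : F × (Fin l → ℝ)} (hh : AnalyticAt ℝ h z)
    (hv : ∀ j ∈ K, ∀ᶠ w in 𝓝 z, w.2 j = 0 → h w = 0) :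
    ∃ g : F × (Fin l → ℝ) → ℝ, AnalyticAt ℝ g z ∧
      ∀ᶠ w in 𝓝 z, h w = (∏ j ∈ K, w.2 j) * g w := by
  classical
  induction K using Finset.induction_on generalizing h with
  | empty => exact ⟨h, hh, by simp⟩
  | insert j K hj ih =>
    set ℓ : F × (Fin l → ℝ) →L[ℝ] ℝ :=
      (ContinuousLinearMap.proj j).comp (ContinuousLinearMap.snd ℝ F (Fin l → ℝ)) with hℓ
    have hℓ' : ∀ w, ℓ w = w.2 j := fun w => rfl
    -- One factor `t_j` is removed at a time: by the division lemma if `t_j` vanishes at `z`, by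
    -- inverting `t_j` otherwise.
    obtain ⟨g, hg, hgh⟩ : ∃ g : F × (Fin l → ℝ) → ℝ, AnalyticAt ℝ g z ∧
        ∀ᶠ w in 𝓝 z, h w = w.2 j * g w := by
      by_cases hz : z.2 j = 0
      · exact exists_analyticAt_mul_of_vanishing hh ℓ (0, Pi.single j 1) (by simp [hℓ']) hz
          (hv j (Finset.mem_insert_self _ _))
      · have hl : AnalyticAt ℝ (fun w : F × (Fin l → ℝ) => w.2 j) z := ℓ.analyticAt z
        refine ⟨fun w => h w / w.2 j, hh.div hl hz, ?_⟩
        filter_upwards [hl.continuousAt.eventually_ne hz] with w hw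
        field_simp
    -- The quotient `g` must still vanish on the other hyperplanes `t_k = 0`. Off `t_j = 0` this is
    -- clear from `h = t_j g`, and it extends to `t_j = 0` by continuity of `g`.
    obtain ⟨g', hg', hgg'⟩ := ih hg (by
      intro k hk
      have hkj : k ≠ j := fun h => hj (h ▸ hk)
      have h1 := hv k (Finset.mem_insert_of_mem hk)
      have h2 := hg.eventually_continuousAt
      filter_upwards [eventually_eventually_nhds.2 h1, eventually_eventually_nhds.2 hgh, h2]
        with w h1 h2 h3 hw
      -- move off the hyperplane `t_j = 0`
      have t : Tendsto (fun s : ℝ => ((w.1, w.2 + s • Pi.single j (1 : ℝ)) : F × (Fin l → ℝ)))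
          (𝓝[≠] 0) (𝓝 w) := by
        have c : Continuous fun s : ℝ =>
          ((w.1, w.2 + s • Pi.single j (1 : ℝ)) : F × (Fin l → ℝ)) := by fun_prop
        have := c.tendsto 0
        simp only [zero_smul, add_zero] at this
        exact this.mono_left nhdsWithin_le_nhds
      have e1 : ∀ᶠ s : ℝ in 𝓝[≠] 0, w.2 j + s ≠ 0 := by
        by_cases hw0 : w.2 j = 0
        · filter_upwards [self_mem_nhdsWithin] with s hs
          simpa [hw0] using hs
        · have : ContinuousAt (fun s : ℝ => w.2 j + s) 0 := by fun_prop
          exact (this.eventually_ne (by simpa using hw0)).filter_mono nhdsWithin_le_nhds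
      have : ∀ᶠ s : ℝ in 𝓝[≠] 0, g (w.1, w.2 + s • Pi.single j (1 : ℝ)) = 0 := by
        filter_upwards [t.eventually h1, t.eventually h2, e1] with s a b c
        have a' := a (by simp [hw, Pi.single_eq_of_ne hkj])
        rw [a'] at b
        simpa [c] using b.symm
      have lim := h3.tendsto.comp t
      exact tendsto_nhds_unique lim (tendsto_const_nhds.congr' (this.mono fun s hs => hs.symm)))
    refine ⟨g', hg', ?_⟩
    filter_upwards [hgh, hgg'] with w a b
    rw [a, b, Finset.prod_insert hj, mul_assoc]

end Parameters

/-! ### Coefficients of quasi-homogeneous expansions -/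

section Coefficients

open Asymptotics

/-- Once the coefficients below `e` vanish, `s ^ e` factors out. The remaining sum tends to `c e`,
and it is `o(s ^ (r - e))` with `r - e ≥ 0`, so it tends to zero. -/
theorem coeff_eq_zero_of_isLittleO {N r : ℕ} {c : ℕ → ℝ}
    (h : (fun s : ℝ => ∑ e ∈ Finset.range N, c e * s ^ e) =o[𝓝 0] fun s => s ^ r) :
    ∀ e < N, e ≤ r → c e = 0 := by
  intro e
  induction e using Nat.strong_induction_on with
  | _ e ih =>
  intro heN her
  -- The truncated subtraction `k - e` is harmless: for `k < e` the coefficient is already known to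
  -- vanish.
  set Q : ℝ → ℝ := fun s => ∑ k ∈ Finset.range N, c k * s ^ (k - e) with hQ
  have hsum : ∀ s : ℝ, ∑ k ∈ Finset.range N, c k * s ^ k = s ^ e * Q s := by
    intro s
    rw [hQ, Finset.mul_sum]
    refine Finset.sum_congr rfl fun k hk => ?_
    by_cases hke : k < e
    · rw [ih k hke (Finset.mem_range.1 hk) (hke.le.trans her)]; simp
    · obtain ⟨d, rfl⟩ := Nat.exists_eq_add_of_le (not_lt.1 hke)
      rw [Nat.add_sub_cancel_left, pow_add]; ring
  have hQ0 : Q 0 = c e := by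
    rw [hQ]
    dsimp only
    rw [Finset.sum_eq_single e]
    · simp
    · intro k hk hke
      by_cases h' : k < e
      · rw [ih k h' (Finset.mem_range.1 hk) (h'.le.trans her)]; simp
      · rw [zero_pow (by omega), mul_zero]
    · intro h'; exact absurd (Finset.mem_range.2 heN) h'
  have hQc : Tendsto Q (𝓝[≠] 0) (𝓝 (c e)) := by
    have : Continuous Q := by fun_prop
    rw [← hQ0]
    exact (this.tendsto 0).mono_left nhdsWithin_le_nhds
  have hQ' : Q =o[𝓝[≠] 0] fun s : ℝ => s ^ (r - e) := by
    have h' := h.mono (nhdsWithin_le_nhds (s := {0}ᶜ))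
    rw [isLittleO_iff] at h' ⊢
    intro ε hε
    filter_upwards [h' hε, self_mem_nhdsWithin] with s hs hs0
    have hp : s ^ r = s ^ e * s ^ (r - e) := by rw [← pow_add, Nat.add_sub_cancel' her]
    rw [hsum, norm_mul, hp, norm_mul] at hs
    have : 0 < ‖s ^ e‖ := norm_pos_iff.2 (pow_ne_zero _ hs0)
    have h2 : ‖s ^ e‖ * ‖Q s‖ ≤ ‖s ^ e‖ * (ε * ‖s ^ (r - e)‖) := by
      calc _ ≤ _ := hs
        _ = _ := by ring
    exact le_of_mul_le_mul_left h2 this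
  have hO : (fun s : ℝ => s ^ (r - e)) =O[𝓝[≠] 0] fun _ => (1 : ℝ) := by
    have : Continuous fun s : ℝ => s ^ (r - e) := by fun_prop
    exact ((this.tendsto 0).mono_left nhdsWithin_le_nhds).isBigO_one ℝ
  have := (isLittleO_one_iff ℝ).1 (hQ'.trans_isBigO hO)
  exact tendsto_nhds_unique hQc this

theorem eval_smul_eq_sum {l : ℕ} (D : MvPolynomial (Fin l) ℝ) (u : Fin l → ℝ) (s : ℝ) :
    MvPolynomial.eval (s • u) D = ∑ e ∈ Finset.range (D.totalDegree + 1),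
      MvPolynomial.eval u (MvPolynomial.homogeneousComponent e D) * s ^ e := by
  conv_lhs => rw [← MvPolynomial.sum_homogeneousComponent D]
  rw [map_sum]
  refine Finset.sum_congr rfl fun e _ => ?_
  have hh := MvPolynomial.homogeneousComponent_isHomogeneous e D
  rw [MvPolynomial.eval_eq, MvPolynomial.eval_eq, Finset.sum_mul]
  refine Finset.sum_congr rfl fun d hd => ?_
  have hdeg : ∑ i ∈ d.support, d i = e := by
    have := hh (MvPolynomial.mem_support_iff.1 hd)
    rw [← this, Finsupp.weight_apply]
    simp [Finsupp.sum]
  simp only [Pi.smul_apply, smul_eq_mul, mul_pow, Finset.prod_mul_distrib]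
  rw [Finset.prod_pow_eq_pow_sum, hdeg]
  ring

/-- On each ray `s ↦ s • u` the homogeneous components become the coefficients of a polynomial in
`s`, so the one-variable case annihilates the component of degree `r`. -/
theorem mvPolynomial_coeff_eq_zero {l r : ℕ} {D : MvPolynomial (Fin l) ℝ}
    (h : (fun t : Fin l → ℝ => MvPolynomial.eval t D) =o[𝓝 0] fun t => ‖t‖ ^ r)
    (d : Fin l →₀ ℕ) (hd : d.degree = r) : D.coeff d = 0 := by
  have key : MvPolynomial.homogeneousComponent r D = 0 := by
    by_cases hr : r < D.totalDegree + 1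
    swap
    · exact MvPolynomial.homogeneousComponent_eq_zero _ _ (by omega)
    apply MvPolynomial.funext
    intro u
    rw [map_zero]
    refine coeff_eq_zero_of_isLittleO (N := D.totalDegree + 1) (r := r)
      (c := fun e => MvPolynomial.eval u (MvPolynomial.homogeneousComponent e D)) ?_ r hr le_rfl
    have t : Tendsto (fun s : ℝ => s • u) (𝓝 0) (𝓝 0) := by
      have : Continuous fun s : ℝ => s • u := by fun_prop
      simpa using this.tendsto 0
    have h' := h.comp_tendsto t
    have e1 : ((fun t : Fin l → ℝ => MvPolynomial.eval t D) ∘ fun s : ℝ => s • u) =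
        fun s => ∑ e ∈ Finset.range (D.totalDegree + 1),
          MvPolynomial.eval u (MvPolynomial.homogeneousComponent e D) * s ^ e := by
      ext s; exact eval_smul_eq_sum D u s
    rw [e1] at h'
    refine h'.trans_isBigO (IsBigO.of_bound (‖u‖ ^ r) (Eventually.of_forall fun s => ?_))
    simp [norm_smul, mul_pow, mul_comm]
  have := MvPolynomial.coeff_homogeneousComponent r D d
  rw [key, if_pos hd] at this
  simpa using this.symm

/-- The exponent of the monomial `∏ j ∈ K, t j`. -/
noncomputable def indicatorExponent {l : ℕ} (K : Finset (Fin l)) : Fin l →₀ ℕ := ∑ j ∈ K, Finsupp.single j 1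

theorem indicatorExponent_apply {l : ℕ} (K : Finset (Fin l)) (j : Fin l) :
    indicatorExponent K j = if j ∈ K then 1 else 0 := by
  simp [indicatorExponent, Finsupp.finsetSum_apply, Finsupp.single_apply]

theorem degree_indicatorExponent {l : ℕ} (K : Finset (Fin l)) :
    (indicatorExponent K).degree = K.card := by
  simp [indicatorExponent, map_sum]

theorem eval_monomial_indicatorExponent {l : ℕ} (K : Finset (Fin l)) (t : Fin l → ℝ) (c : ℝ) :
    MvPolynomial.eval t (MvPolynomial.monomial (indicatorExponent K) c) = c * ∏ j ∈ K, t j := by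
  rw [MvPolynomial.eval_monomial]
  congr 1
  rw [Finsupp.prod_fintype _ _ (by simp)]
  simp only [indicatorExponent_apply, pow_ite, pow_one, pow_zero, Finset.prod_ite_mem,
    Finset.univ_inter]

/-- The nonempty sets `J (i a)` form a partition of `K`. -/
def IsPartition {n l m : ℕ} (J : Fin n → Finset (Fin l)) (K : Finset (Fin l)) (i : Fin m → Fin n) :
    Prop :=
  (∀ a, J (i a) ≠ ∅) ∧ ∑ a, indicatorExponent (J (i a)) = indicatorExponent K

open Classical in
theorem multilinear_diag_eq_sum {n m : ℕ}
    (q : ContinuousMultilinearMap ℝ (fun _ : Fin m => (Fin n → ℝ)) ℝ) (w : Fin n → ℝ) :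
    q (fun _ => w) = ∑ i : Fin m → Fin n, q (fun a => Pi.single (i a) 1) * ∏ a, w (i a) := by
  have hw : (fun _ : Fin m => w) = fun _ => ∑ i : Fin n, w i • Pi.single i (1 : ℝ) := by
    ext a k; simp [Finset.sum_apply, Pi.single_apply]
  rw [hw, q.map_sum]
  refine Finset.sum_congr rfl fun i _ => ?_
  rw [q.map_smul_univ (fun a => w (i a)) (fun a => Pi.single (i a) (1 : ℝ)), smul_eq_mul, mul_comm]

open Classical in
/-- If `g (t_{J_1} x_1, …, t_{J_n} x_n) = (∏ j ∈ K, t_j) G(t)` near `t = 0`, the value `G 0` is the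
sum of the terms of degree `∏ j ∈ K, t_j` in the Taylor expansion of the left hand side. -/
theorem value_eq_sum_taylor {n l : ℕ} {g : (Fin n → ℝ) → ℝ} {a : Fin n → ℝ}
    {p : FormalMultilinearSeries ℝ (Fin n → ℝ) ℝ} (hg : HasFPowerSeriesAt g p a)
    (J : Fin n → Finset (Fin l)) (K : Finset (Fin l)) (x : Fin n → ℝ)
    (ha : ∀ i, a i = if J i = ∅ then x i else 0) {G : (Fin l → ℝ) → ℝ} (hG : ContinuousAt G 0)
    (h : ∀ᶠ t in 𝓝 (0 : Fin l → ℝ),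
      g (fun i => (∏ j ∈ J i, t j) * x i) = (∏ j ∈ K, t j) * G t) :
    G 0 = ∑ m ∈ Finset.range (K.card + 1), ∑ i : Fin m → Fin n with IsPartition J K i,
      p m (fun a => Pi.single (i a) 1) * ∏ a, x (i a) := by
  set r := K.card with hr
  set w : (Fin l → ℝ) → (Fin n → ℝ) :=
    -- The displacement from `a`: a coordinate with `J i = ∅` is not scaled and stays at its value
    -- `x i = a i`.
    fun t i => if J i = ∅ then 0 else (∏ j ∈ J i, t j) * x i with hw
  set T : ∀ m, (Fin m → Fin n) → MvPolynomial (Fin l) ℝ := fun m i =>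
    if ∀ a, J (i a) ≠ ∅ then MvPolynomial.monomial (∑ a, indicatorExponent (J (i a)))
      (p m (fun a => Pi.single (i a) 1) * ∏ a, x (i a)) else 0 with hT
  -- The Taylor polynomial of the left hand side, as a polynomial in `t`, minus the leading part of
  -- the right hand side. Degree `r = K.card` suffices: since `w = O(‖t‖)`, the remainder is `O(‖t‖
  -- ^ (r + 1))`.
  set D : MvPolynomial (Fin l) ℝ := ∑ m ∈ Finset.range (r + 1), ∑ i : Fin m → Fin n, T m i -
    MvPolynomial.monomial (indicatorExponent K) (G 0) with hD
  have hTe : ∀ m i t, MvPolynomial.eval t (T m i) =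
      p m (fun a => Pi.single (i a) 1) * ∏ a, w t (i a) := by
    intro m i t
    simp only [hT]
    split_ifs with hi
    · have : MvPolynomial.monomial (∑ a, indicatorExponent (J (i a)))
          (p m (fun a => Pi.single (i a) 1) * ∏ a, x (i a)) =
          MvPolynomial.C (p m (fun a => Pi.single (i a) 1)) *
            ∏ a, MvPolynomial.monomial (indicatorExponent (J (i a))) (x (i a)) := by
        rw [← MvPolynomial.monomial_sum_prod, MvPolynomial.C_mul_monomial]
      rw [this, map_mul, MvPolynomial.eval_C, map_prod]
      congr 1
      refine Finset.prod_congr rfl fun b _ => ?_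
      rw [eval_monomial_indicatorExponent, hw]
      simp [hi b, mul_comm]
    · push Not at hi
      obtain ⟨b, hb⟩ := hi
      rw [map_zero, Finset.prod_eq_zero (Finset.mem_univ b), mul_zero]
      simp [hw, hb]
  have hDe : ∀ t, MvPolynomial.eval t D = p.partialSum (r + 1) (w t) - (∏ j ∈ K, t j) * G 0 := by
    intro t
    rw [hD, map_sub, map_sum, eval_monomial_indicatorExponent, mul_comm (G 0)]
    congr 1
    rw [FormalMultilinearSeries.partialSum]
    refine Finset.sum_congr rfl fun m _ => ?_
    rw [map_sum, multilinear_diag_eq_sum]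
    exact Finset.sum_congr rfl fun i _ => hTe m i t
  -- estimate of `w`
  have hw0 : w 0 = 0 := by
    ext i
    simp only [hw]
    split_ifs with hi
    · rfl
    · obtain ⟨j, hj⟩ := Finset.nonempty_iff_ne_empty.2 hi
      simp [Finset.prod_eq_zero hj]
  have hwd : DifferentiableAt ℝ w 0 := by
    rw [differentiableAt_pi]
    intro i
    by_cases hi : J i = ∅
    · simp [hw, hi]
    · simp only [hw, hi, if_false]
      fun_prop
  have hwO : w =O[𝓝 0] fun t => ‖t‖ := by
    have := hwd.hasFDerivAt.isBigO_sub
    simpa [hw0] using this.norm_right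
  have hwt : Tendsto w (𝓝 0) (𝓝 0) := by simpa [hw0] using hwd.continuousAt.tendsto
  have hKO : (fun t : Fin l → ℝ => ∏ j ∈ K, t j) =O[𝓝 0] fun t => ‖t‖ ^ r := by
    refine IsBigO.of_bound 1 (Eventually.of_forall fun t => ?_)
    rw [norm_prod, one_mul, norm_pow, norm_norm, hr, ← Finset.prod_const]
    exact Finset.prod_le_prod (fun _ _ => norm_nonneg _) fun j _ => norm_le_pi_norm t j
  have hlit : (fun t : Fin l → ℝ => MvPolynomial.eval t D) =o[𝓝 0] fun t => ‖t‖ ^ r := by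
    have o1 : (fun t => (∏ j ∈ K, t j) * (G t - G 0)) =o[𝓝 0] fun t => ‖t‖ ^ r := by
      have : (fun t => G t - G 0) =o[𝓝 0] fun _ => (1 : ℝ) := by
        rw [isLittleO_one_iff]
        simpa using hG.tendsto.sub_const (G 0)
      simpa using hKO.mul_isLittleO this
    have o2 : (fun t => g (a + w t) - p.partialSum (r + 1) (w t)) =o[𝓝 0] fun t => ‖t‖ ^ r := by
      have h1 := (hg.isBigO_sub_partialSum_pow (r + 1)).comp_tendsto hwt
      have h2 : ((fun y : Fin n → ℝ => ‖y‖ ^ (r + 1)) ∘ w) =O[𝓝 0] fun t => ‖t‖ ^ (r + 1) :=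
        (hwO.norm_left.pow (r + 1))
      refine (h1.trans h2).trans_isLittleO ?_
      have : (fun t : Fin l → ℝ => ‖t‖ ^ (r + 1)) = fun t => ‖t‖ ^ r * ‖t‖ := by
        ext t; rw [pow_succ]
      rw [this]
      have h3 : (fun t : Fin l → ℝ => ‖t‖) =o[𝓝 0] fun _ => (1 : ℝ) := by
        rw [isLittleO_one_iff]; exact tendsto_norm_zero
      simpa using (isBigO_refl (fun t : Fin l → ℝ => ‖t‖ ^ r) (𝓝 0)).mul_isLittleO h3
    refine (o1.sub o2).congr' ?_ EventuallyEq.rfl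
    filter_upwards [h] with t ht
    have haw : a + w t = fun i => (∏ j ∈ J i, t j) * x i := by
      ext i
      simp only [Pi.add_apply, ha, hw]
      split_ifs with hi
      · simp [hi]
      · simp
    rw [haw, ht, hDe]
    ring
  -- `D` is `o(‖t‖ ^ r)`, so its coefficient at `∏ j ∈ K, t_j`, a monomial of degree `r`, is zero;
  -- this is the claimed equality.
  have hc := mvPolynomial_coeff_eq_zero hlit (indicatorExponent K) (degree_indicatorExponent K)
  rw [hD, MvPolynomial.coeff_sub, MvPolynomial.coeff_monomial, if_pos rfl, sub_eq_zero] at hc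
  rw [← hc, MvPolynomial.coeff_sum]
  refine Finset.sum_congr rfl fun m _ => ?_
  rw [MvPolynomial.coeff_sum, Finset.sum_filter]
  refine Finset.sum_congr rfl fun i _ => ?_
  simp only [hT, IsPartition]
  by_cases hi : ∀ a, J (i a) ≠ ∅
  · simp [hi, MvPolynomial.coeff_monomial]
  · simp [hi]

end Coefficients

/-! ### Combinatorics of the index sets -/

section Partitions

variable {n l m : ℕ} {J : Fin n → Finset (Fin l)} {K : Finset (Fin l)}

theorem IsPartition.comp_equiv {m' : ℕ} {i : Fin m → Fin n} (h : IsPartition J K i)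
    (e : Fin m' ≃ Fin m) : IsPartition J K (i ∘ e) :=
  ⟨fun a => h.1 (e a), by rw [← h.2]; exact e.sum_comp fun a => indicatorExponent (J (i a))⟩

theorem IsPartition.sum_ite {i : Fin m → Fin n} (h : IsPartition J K i) (j : Fin l) :
    (∑ a, if j ∈ J (i a) then 1 else 0) = if j ∈ K then 1 else 0 := by
  have := DFunLike.congr_fun h.2 j
  simpa [Finsupp.finsetSum_apply, indicatorExponent_apply] using this

theorem IsPartition.mem_iff {i : Fin m → Fin n} (h : IsPartition J K i) (j : Fin l) :
    j ∈ K ↔ ∃ a, j ∈ J (i a) := by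
  have h1 := h.sum_ite j
  constructor
  · intro hj
    by_contra! hc
    simp [hj, hc] at h1
  · rintro ⟨a, ha⟩
    by_contra hj
    rw [if_neg hj, Finset.sum_eq_zero_iff] at h1
    simpa [ha] using h1 a (Finset.mem_univ a)

theorem IsPartition.eq_of_mem {i : Fin m → Fin n} (h : IsPartition J K i) {j : Fin l} {a b : Fin m}
    (ha : j ∈ J (i a)) (hb : j ∈ J (i b)) : a = b := by
  by_contra hab
  have h1 := h.sum_ite j
  rw [if_pos ((h.mem_iff j).2 ⟨a, ha⟩)] at h1
  have : ∑ c ∈ ({a, b} : Finset (Fin m)), (if j ∈ J (i c) then 1 else 0) ≤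
      ∑ c, if j ∈ J (i c) then 1 else 0 :=
    Finset.sum_le_sum_of_subset (Finset.subset_univ _)
  rw [Finset.sum_pair hab, if_pos ha, if_pos hb] at this
  omega

theorem IsPartition.of_mem {i : Fin m → Fin n} (h0 : ∀ a, J (i a) ≠ ∅)
    (h1 : ∀ j, j ∈ K ↔ ∃ a, j ∈ J (i a)) (h2 : ∀ j a b, j ∈ J (i a) → j ∈ J (i b) → a = b) :
    IsPartition J K i := by
  refine ⟨h0, ?_⟩
  ext j
  rw [Finsupp.finsetSum_apply]
  simp only [indicatorExponent_apply]
  split_ifs with hj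
  · obtain ⟨a, ha⟩ := (h1 j).1 hj
    rw [Finset.sum_eq_single a (fun b _ hb => if_neg fun hb' => hb (h2 j b a hb' ha)) (by simp),
      if_pos ha]
  · exact Finset.sum_eq_zero fun a _ => if_neg fun ha => hj ((h1 j).2 ⟨a, ha⟩)

/-- Distinct blocks contain distinct elements of `K`. Hence truncating the Taylor series at order
`K.card` loses no partition. -/
theorem IsPartition.le_card {i : Fin m → Fin n} (h : IsPartition J K i) : m ≤ K.card := by
  choose f hf using fun a => Finset.nonempty_iff_ne_empty.2 (h.1 a)
  have := Finset.card_le_card_of_injOn (s := Finset.univ) (t := K) f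
    (fun a _ => (h.mem_iff _).2 ⟨a, hf a⟩)
    (fun a _ b _ hab => h.eq_of_mem (hf a) (by simpa [hab] using hf b))
  simpa using this

open Classical in
/-- The terms of the Taylor expansion indexed by the partitions of `K`, grouped by the orbits of the
permutations of the factors, give mixed partial derivatives. -/
theorem sum_partition_eq_sum_mixedPartial {g : (Fin n → ℝ) → ℝ} {a : Fin n → ℝ}
    {p : FormalMultilinearSeries ℝ (Fin n → ℝ) ℝ} (hg : HasFPowerSeriesAt g p a)
    (x : Fin n → ℝ) {P : ℕ} (S : Fin P → Finset (Fin n))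
    (h1 : ∀ m (i : Fin m → Fin n), IsPartition J K i → ∃ e : Fin P ≃ Fin m, ∀ b, i (e b) ∈ S b)
    (h2 : ∀ i ∈ Fintype.piFinset S, IsPartition J K i)
    (h3 : ∀ b c, b ≠ c → Disjoint (S b) (S c)) :
    ∑ m ∈ Finset.range (K.card + 1), ∑ i : Fin m → Fin n with IsPartition J K i,
      p m (fun b => Pi.single (i b) 1) * ∏ b, x (i b) =
    ∑ i ∈ Fintype.piFinset S, mixedPartial g i a * ∏ b, x (i b) := by
  obtain ⟨r, hr⟩ := hg
  rw [Finset.sum_eq_single P]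
  -- The iterated derivative of an analytic function is the sum of the permuted values of the (not
  -- necessarily symmetric) coefficient `p P`, without a factorial.
  · have h4 : ∀ i : Fin P → Fin n, mixedPartial g i a =
        ∑ σ : Equiv.Perm (Fin P), p P (fun b => Pi.single (i (σ b)) 1) := by
      intro i
      rw [mixedPartial, hr.iteratedFDeriv_eq_sum_of_completeSpace]
    simp only [h4, Finset.sum_mul]
    rw [← Finset.sum_product']
    symm
    -- A partition is a choice of one index in each `S b` followed by an ordering. Disjointness of
    -- the `S b` recovers the ordering, hence injectivity; `h1` gives surjectivity.
    refine Finset.sum_bij (fun s _ => s.1 ∘ s.2) ?_ ?_ ?_ ?_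
    · rintro ⟨i, σ⟩ hi
      simp only [Finset.mem_product, Finset.mem_univ, and_true] at hi
      simpa using (h2 i hi).comp_equiv σ
    · rintro ⟨i, σ⟩ hi ⟨i', σ'⟩ hi' heq
      simp only [Finset.mem_product, Finset.mem_univ, and_true, Fintype.mem_piFinset] at hi hi'
      have hσ : σ = σ' := by
        ext b
        by_contra hb
        have e1 : i (σ b) = i' (σ' b) := congrFun heq b
        have := h3 (σ b) (σ' b) (fun h => hb (by rw [h]))
        exact Finset.disjoint_left.1 this (hi _) (e1 ▸ hi' _)
      subst hσ
      have : i = i' := by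
        ext b
        have := congrFun heq (σ.symm b)
        simp only [Function.comp_apply, Equiv.apply_symm_apply] at this
        rw [this]
      rw [this]
    · intro i hi
      obtain ⟨e, he⟩ := h1 P i (Finset.mem_filter.1 hi).2
      refine ⟨(i ∘ e, e.symm), ?_, ?_⟩
      · simp only [Finset.mem_product, Finset.mem_univ, and_true, Fintype.mem_piFinset]
        exact he
      · ext b; simp
    · rintro ⟨i, σ⟩ -
      simp only [Function.comp_apply]
      congr 1
      exact (Equiv.prod_comp σ fun b => x (i b)).symm
  · intro m _ hm
    refine Finset.sum_eq_zero fun i hi => ?_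
    obtain ⟨e, -⟩ := h1 m i (Finset.mem_filter.1 hi).2
    exact absurd (by simpa using Fintype.card_congr e) hm.symm
  · intro hP
    refine Finset.sum_eq_zero fun i hi => ?_
    have := (Finset.mem_filter.1 hi).2.le_card
    exact absurd (Finset.mem_range.2 (by omega)) hP

end Partitions

/-! ### Order relations and partitions in an adapted chart -/

section Forest

variable {n l : ℕ} {X : Type*} [TopologicalSpace X] [ChartedSpace (Fin n → ℝ) X]
  {M : Fin l → Set X}

section Indices

variable {Z : Type*} {M : Fin l → Set Z}

theorem mem_lowerIdx {j k : Fin l} : k ∈ lowerIdx M j ↔ M k ⊆ M j := by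
  simp [lowerIdx]

theorem mem_supIdx {K : Finset (Fin l)} {j : Fin l} :
    j ∈ supIdx M K ↔ j ∈ K ∧ ∀ β ∈ K, M j ⊆ M β → M β = M j := by
  simp [supIdx]

theorem mem_infIdx {K : Finset (Fin l)} {j : Fin l} :
    j ∈ infIdx M K ↔ j ∈ K ∧ ∀ β ∈ K, M β ⊆ M j → M β = M j := by
  simp [infIdx]

theorem exists_supIdx {K : Finset (Fin l)} {j : Fin l} (hj : j ∈ K) :
    ∃ k ∈ supIdx M K, M j ⊆ M k := by
  classical
  obtain ⟨k, hk, hk'⟩ := Finset.exists_maximalFor M ({k ∈ K | M j ⊆ M k} : Finset (Fin l))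
    ⟨j, by simp [hj]⟩
  simp only [Finset.mem_filter] at hk hk'
  exact ⟨k, mem_supIdx.2 ⟨hk.1, fun β hβ h => (hk' ⟨hβ, hk.2.trans h⟩ h).antisymm h⟩, hk.2⟩

theorem exists_infIdx {K : Finset (Fin l)} {j : Fin l} (hj : j ∈ K) :
    ∃ k ∈ infIdx M K, M k ⊆ M j := by
  classical
  obtain ⟨k, hk, hk'⟩ := Finset.exists_minimalFor M ({k ∈ K | M k ⊆ M j} : Finset (Fin l))
    ⟨j, by simp [hj]⟩
  simp only [Finset.mem_filter] at hk hk'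
  exact ⟨k, mem_infIdx.2 ⟨hk.1, fun β hβ h => h.antisymm (hk' ⟨hβ, h.trans hk.2⟩ h)⟩, hk.2⟩

end Indices

/-- The condition (†) for an arbitrary set of indices. -/
def IsDisjointlyGenerated (M : Fin l → Set X) (K : Finset (Fin l)) : Prop :=
  (infIdx M K).card = (supIdx M K).card ∧ ∀ i ∈ K, ∀ β, M β ⊆ M i → β ∈ K

namespace AdaptedChart

variable (φ : AdaptedChart n M)

theorem mem_J {i : Fin n} {j : Fin l} : j ∈ φ.J i ↔ i ∈ φ.I j := by simp [J]

theorem mem_Ihat {i : Fin n} {j : Fin l} :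
    i ∈ φ.Ihat j ↔ i ∈ φ.I j ∧ ∀ k, φ.I k ⊂ φ.I j → i ∉ φ.I k := by simp [Ihat]

/-- `i ∈ Î_j` means that `I_j` is the smallest index set containing `i`: two index sets sharing `i`
are comparable. -/
theorem I_subset_of_mem_Ihat {i : Fin n} {j k : Fin l} (hj : i ∈ φ.Ihat j) (hk : i ∈ φ.I k) :
    φ.I j ⊆ φ.I k := by
  rw [mem_Ihat] at hj
  rcases φ.nested j k with h | h | h
  · exact h
  · by_contra hc
    exact hj.2 k ⟨h, hc⟩ hk
  · exact absurd hk (Finset.disjoint_left.1 h hj.1)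

theorem exists_mem_Ihat {i : Fin n} (hi : φ.J i ≠ ∅) : ∃ j, i ∈ φ.Ihat j := by
  obtain ⟨j, hj, hj'⟩ := Finset.exists_minimalFor φ.I (φ.J i) (Finset.nonempty_iff_ne_empty.2 hi)
  refine ⟨j, φ.mem_Ihat.2 ⟨φ.mem_J.1 hj, fun k hk hik => hk.2 (hj' (φ.mem_J.2 hik) hk.1)⟩⟩

/-- The order relations between the `M j` are those between the `I j`. -/
def ReflectsOrder : Prop := ∀ j k, M j ⊆ M k ↔ φ.I k ⊆ φ.I j

variable {φ} (hφ : φ.ReflectsOrder) (hM : Function.Injective M)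

include hφ in
-- This removes the coordinates from the combinatorics: the weight of a coordinate in `Î_j` depends
-- only on the submanifolds contained in `M j`.
theorem J_eq_lowerIdx {i : Fin n} {j : Fin l} (hi : i ∈ φ.Ihat j) : φ.J i = lowerIdx M j := by
  ext k
  rw [mem_J, mem_lowerIdx, hφ]
  exact ⟨φ.I_subset_of_mem_Ihat hi, fun h => h (φ.mem_Ihat.1 hi).1⟩

include hφ hM in
theorem eq_of_mem_Ihat {i : Fin n} {j k : Fin l} (hj : i ∈ φ.Ihat j) (hk : i ∈ φ.Ihat k) :
    j = k := by
  have h := φ.I_subset_of_mem_Ihat hj (φ.mem_Ihat.1 hk).1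
  have h' := φ.I_subset_of_mem_Ihat hk (φ.mem_Ihat.1 hj).1
  exact hM (((hφ _ _).2 h').antisymm ((hφ _ _).2 h))

include hφ in
-- `I_j` and `I_k` both contain the nonempty set `I_b`, so they are not disjoint and must be nested:
-- the down-set of `M b` is a chain.
theorem subset_or_subset {j k b : Fin l} (hb : φ.I b ≠ ∅) (hj : M j ⊆ M b) (hk : M k ⊆ M b) :
    M j ⊆ M k ∨ M k ⊆ M j := by
  obtain ⟨i, hi⟩ := Finset.nonempty_iff_ne_empty.2 hb
  rcases φ.nested j k with h | h | h
  · exact Or.inr ((hφ _ _).2 h)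
  · exact Or.inl ((hφ _ _).2 h)
  · exact absurd ((hφ _ _).1 hk hi) (Finset.disjoint_left.1 h ((hφ _ _).1 hj hi))

include hφ hM in
theorem eq_of_mem_infIdx {K : Finset (Fin l)} {j k b : Fin l} (hb : φ.I b ≠ ∅)
    (hj : j ∈ infIdx M K) (hk : k ∈ infIdx M K) (hjb : M j ⊆ M b) (hkb : M k ⊆ M b) : j = k := by
  rw [mem_infIdx] at hj hk
  rcases subset_or_subset hφ hb hjb hkb with h | h
  · exact hM (hk.2 j hj.1 h)
  · exact (hM (hj.2 k hk.1 h)).symm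

include hφ hM in
/-- Under (†) the sets of indices below the maximal ones are disjoint. -/
theorem eq_of_mem_supIdx {K : Finset (Fin l)} (hK : IsDisjointlyGenerated M K) {b c k : Fin l}
    (hb : b ∈ supIdx M K) (hc : c ∈ supIdx M K) (hkb : M k ⊆ M b) (hkc : M k ⊆ M c) : b = c := by
  -- If `I_d` is empty, `M d` contains every other submanifold and is the only maximal element. This
  -- case is separate because the chain property needs `I_d ≠ ∅`.
  by_cases hI : ∃ d ∈ supIdx M K, φ.I d = ∅
  · obtain ⟨d, hd, hI⟩ := hI
    have : ∀ e ∈ supIdx M K, e = d := fun e he =>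
      (hM ((mem_supIdx.1 he).2 d (mem_supIdx.1 hd).1 ((hφ _ _).2 (by simp [hI])))).symm
    rw [this b hb, this c hc]
  · replace hI : ∀ d ∈ supIdx M K, φ.I d ≠ ∅ := fun d hd h => hI ⟨d, hd, h⟩
    have hmin : ∀ d : supIdx M K, ∃ e : infIdx M K, M e ⊆ M d := fun d =>
      let ⟨e, he, h⟩ := exists_infIdx (M := M) (mem_supIdx.1 d.2).1
      ⟨⟨e, he⟩, h⟩
    choose f hf using hmin
    -- Below a maximal element there is exactly one minimal element, since the down-set is a chain;
    -- and every minimal element lies below some maximal one.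
    have hsurj : Function.Surjective f := by
      intro e
      obtain ⟨d, hd, hed⟩ := exists_supIdx (M := M) (mem_infIdx.1 e.2).1
      exact ⟨⟨d, hd⟩, Subtype.ext
        (eq_of_mem_infIdx hφ hM (hI d hd) (f ⟨d, hd⟩).2 e.2 (hf ⟨d, hd⟩) hed)⟩
    -- The equality of cardinals in (†) turns surjectivity into injectivity: distinct maximal
    -- elements have distinct minimal elements below them. Two maximal elements above `k` share the
    -- minimal element below `k`, so they coincide.
    have hinj : Function.Injective f :=
      ((Fintype.bijective_iff_surjective_and_card f).2
        ⟨hsurj, by simpa using hK.1.symm⟩).1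
    have hkK : k ∈ K := hK.2 b (mem_supIdx.1 hb).1 k hkb
    obtain ⟨e, he, hek⟩ := exists_infIdx (M := M) hkK
    have h1 : f ⟨b, hb⟩ = ⟨e, he⟩ := Subtype.ext
      (eq_of_mem_infIdx hφ hM (hI b hb) (f ⟨b, hb⟩).2 he (hf ⟨b, hb⟩) (hek.trans hkb))
    have h2 : f ⟨c, hc⟩ = ⟨e, he⟩ := Subtype.ext
      (eq_of_mem_infIdx hφ hM (hI c hc) (f ⟨c, hc⟩).2 he (hf ⟨c, hc⟩) (hek.trans hkc))
    have := hinj (h1.trans h2.symm)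
    exact congrArg Subtype.val this

variable {K : Finset (Fin l)} {m : ℕ} {i : Fin m → Fin n}

include hφ hM in
-- Each block is the down-set of some `M (b a)`, and the blocks are disjoint, so the `b a` are
-- exactly the maximal elements of `K`.
theorem mem_supIdx_iff_of_isPartition (h : IsPartition φ.J K i) {b : Fin m → Fin l}
    (hb : ∀ a, i a ∈ φ.Ihat (b a)) (j : Fin l) : j ∈ supIdx M K ↔ ∃ a, b a = j := by
  have hJ : ∀ a k, k ∈ φ.J (i a) ↔ M k ⊆ M (b a) := fun a k => by
    rw [J_eq_lowerIdx hφ (hb a), mem_lowerIdx]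
  have hbK : ∀ a, b a ∈ K := fun a => (h.mem_iff _).2 ⟨a, (hJ _ _).2 subset_rfl⟩
  rw [mem_supIdx]
  constructor
  · rintro ⟨hj, hj'⟩
    obtain ⟨a, ha⟩ := (h.mem_iff j).1 hj
    exact ⟨a, hM (hj' _ (hbK a) ((hJ _ _).1 ha))⟩
  · rintro ⟨a, rfl⟩
    refine ⟨hbK a, fun β hβ hab => ?_⟩
    obtain ⟨c, hc⟩ := (h.mem_iff β).1 hβ
    have : a = c := h.eq_of_mem ((hJ a (b a)).2 subset_rfl) ((hJ _ _).2 (hab.trans ((hJ _ _).1 hc)))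
    subst this
    exact ((hJ _ _).1 hc).antisymm hab

include hφ hM in
-- A union of down-sets is a down-set. Disjoint chains pair each maximal element with one minimal
-- element. Contrapositively, without (†) no Taylor term survives at `t = 0`.
theorem isDisjointlyGenerated_of_isPartition (h : IsPartition φ.J K i) :
    IsDisjointlyGenerated M K := by
  choose b hb using fun a => φ.exists_mem_Ihat (h.1 a)
  have hJ : ∀ a k, k ∈ φ.J (i a) ↔ M k ⊆ M (b a) := fun a k => by
    rw [J_eq_lowerIdx hφ (hb a), mem_lowerIdx]
  have hsup := mem_supIdx_iff_of_isPartition hφ hM h hb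
  have hI : ∀ d ∈ supIdx M K, φ.I d ≠ ∅ := by
    intro d hd
    obtain ⟨a, rfl⟩ := (hsup d).1 hd
    exact Finset.ne_empty_of_mem (φ.mem_Ihat.1 (hb a)).1
  refine ⟨?_, fun k hk β hβ => ?_⟩
  · have hmin : ∀ d ∈ infIdx M K, ∃ e ∈ supIdx M K, M d ⊆ M e := fun d hd =>
      exists_supIdx (M := M) (mem_infIdx.1 hd).1
    choose f hf hf' using hmin
    refine Finset.card_bij f hf ?_ ?_
    · intro d hd e he hde
      exact eq_of_mem_infIdx hφ hM (hI _ (hf d hd)) hd he (hf' d hd) (hde ▸ hf' e he)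
    · intro c hc
      obtain ⟨e, he, hec⟩ := exists_infIdx (M := M) (mem_supIdx.1 hc).1
      refine ⟨e, he, ?_⟩
      obtain ⟨a, ha⟩ := (hsup c).1 hc
      obtain ⟨a', ha'⟩ := (hsup _).1 (hf e he)
      have : a = a' := h.eq_of_mem (j := e) ((hJ _ _).2 (ha ▸ hec)) ((hJ _ _).2 (ha' ▸ hf' e he))
      rw [← ha, ← ha', this]
  · obtain ⟨a, ha⟩ := (h.mem_iff k).1 hk
    exact (h.mem_iff β).2 ⟨a, (hJ _ _).2 (hβ.trans ((hJ _ _).1 ha))⟩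

include hφ hM in
theorem exists_equiv_of_isPartition (h : IsPartition φ.J K i) {P : ℕ}
    (o : Fin P ≃ supIdx M K) : ∃ e : Fin P ≃ Fin m, ∀ a, i (e a) ∈ φ.Ihat (o a) := by
  choose b hb using fun a => φ.exists_mem_Ihat (h.1 a)
  have hsup := mem_supIdx_iff_of_isPartition hφ hM h hb
  have hbinj : Function.Injective b := fun a a' haa => h.eq_of_mem (j := b a)
    (by rw [J_eq_lowerIdx hφ (hb a), mem_lowerIdx])
    (by rw [J_eq_lowerIdx hφ (hb a'), mem_lowerIdx, haa])
  let f : Fin m → supIdx M K := fun a => ⟨b a, (hsup _).2 ⟨a, rfl⟩⟩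
  have hf : Function.Bijective f :=
    ⟨fun a a' h => hbinj (congrArg Subtype.val h), fun d =>
      let ⟨a, ha⟩ := (hsup d).1 d.2
      ⟨a, Subtype.ext ha⟩⟩
  refine ⟨o.trans (Equiv.ofBijective f hf).symm, fun a => ?_⟩
  have : f ((Equiv.ofBijective f hf).symm (o a)) = o a :=
    (Equiv.ofBijective f hf).apply_symm_apply (o a)
  have h2 := hb ((Equiv.ofBijective f hf).symm (o a))
  have h3 : b ((Equiv.ofBijective f hf).symm (o a)) = o a := congrArg Subtype.val this
  rw [h3] at h2
  exact h2

include hφ hM in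
-- Under (†) the down-sets of the maximal elements cover `K`, stay inside it and are disjoint
-- (`eq_of_mem_supIdx`).
theorem isPartition_of_mem_Ihat (hK : IsDisjointlyGenerated M K) {P : ℕ} (o : Fin P ≃ supIdx M K)
    {i : Fin P → Fin n} (hi : ∀ a, i a ∈ φ.Ihat (o a)) : IsPartition φ.J K i := by
  have hJ : ∀ a k, k ∈ φ.J (i a) ↔ M k ⊆ M (o a) := fun a k => by
    rw [J_eq_lowerIdx hφ (hi a), mem_lowerIdx]
  refine IsPartition.of_mem (fun a => ?_) (fun j => ⟨fun hj => ?_, ?_⟩) fun j a b ha hb => ?_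
  · exact Finset.ne_empty_of_mem (φ.mem_J.2 (φ.mem_Ihat.1 (hi a)).1)
  · obtain ⟨k, hk, hjk⟩ := exists_supIdx (M := M) hj
    exact ⟨o.symm ⟨k, hk⟩, (hJ _ _).2 (by simpa using hjk)⟩
  · rintro ⟨a, ha⟩
    exact hK.2 _ (mem_supIdx.1 (o a).2).1 j ((hJ _ _).1 ha)
  · exact o.injective (Subtype.ext
      (eq_of_mem_supIdx hφ hM hK (o a).2 (o b).2 ((hJ _ _).1 ha) ((hJ _ _).1 hb)))

include hφ hM in
/-- `∏_{β ∈ J̄} ∏_{M_k ⊆ M_β} c_k = ∏_{k ∈ K} c_k` under (†). -/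
theorem prod_supIdx_prod_lowerIdx (hK : IsDisjointlyGenerated M K) (c : Fin l → ℝ) :
    ∏ β ∈ supIdx M K, ∏ k ∈ lowerIdx M β, c k = ∏ k ∈ K, c k := by
  rw [← Finset.prod_biUnion]
  · refine Finset.prod_congr ?_ fun _ _ => rfl
    ext k
    simp only [Finset.mem_biUnion, mem_lowerIdx]
    exact ⟨fun ⟨β, hβ, h⟩ => hK.2 β (mem_supIdx.1 hβ).1 k h, fun hk => exists_supIdx hk⟩
  · intro b hb c hc hbc
    refine Finset.disjoint_left.2 fun k hkb hkc => hbc ?_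
    exact eq_of_mem_supIdx hφ hM hK hb hc (mem_lowerIdx.1 hkb) (mem_lowerIdx.1 hkc)

include hφ hM in
-- `M j` is the only maximal element of its own down-set, so there is a single block. This is the
-- linear case, used for changes of coordinates.
theorem eq_one_of_isPartition_lowerIdx {j : Fin l} (h : IsPartition φ.J (lowerIdx M j) i) :
    ∃ e : Fin 1 ≃ Fin m, ∀ a, i (e a) ∈ φ.Ihat j := by
  have hs : supIdx M (lowerIdx M j) = {j} := by
    ext k
    rw [mem_supIdx, mem_lowerIdx, Finset.mem_singleton]
    constructor
    · rintro ⟨h1, h2⟩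
      exact (hM (h2 j (mem_lowerIdx.2 subset_rfl) h1)).symm
    · rintro rfl
      exact ⟨subset_rfl, fun β hβ h => (mem_lowerIdx.1 hβ).antisymm h⟩
  let o : Fin 1 ≃ supIdx M (lowerIdx M j) :=
    (Equiv.ofUnique (Fin 1) (({j} : Finset (Fin l)) : Type)).trans (Equiv.subtypeEquivRight (by simp [hs]))
  obtain ⟨e, he⟩ := exists_equiv_of_isPartition hφ hM h o
  refine ⟨e, fun a => ?_⟩
  have : (o a : Fin l) = j := by
    simpa only [hs, Finset.mem_singleton] using (o a).2
  rw [← this]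
  exact he a

include hφ in
theorem isPartition_lowerIdx {j : Fin l} {i : Fin 1 → Fin n} (hi : ∀ a, i a ∈ φ.Ihat j) :
    IsPartition φ.J (lowerIdx M j) i := by
  refine IsPartition.of_mem (fun a => ?_) (fun k => ?_) fun _ _ _ _ _ => Subsingleton.elim _ _
  · exact Finset.ne_empty_of_mem (φ.mem_J.2 (φ.mem_Ihat.1 (hi a)).1)
  · simp only [J_eq_lowerIdx hφ (hi _)]
    exact ⟨fun h => ⟨0, h⟩, fun ⟨_, h⟩ => h⟩

end AdaptedChart

end Forest

/-! ### Charts and tangent spaces -/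

section Charts

variable {n m : ℕ} {X Y : Type*} [TopologicalSpace X] [ChartedSpace (Fin n → ℝ) X]
  [TopologicalSpace Y] [ChartedSpace (Fin m → ℝ) Y]
  {e : OpenPartialHomeomorph X (Fin n → ℝ)}

section
variable (he : e ∈ IsManifold.maximalAtlas 𝓘(ℝ, Fin n → ℝ) ω X)
include he

variable {q : X} (hq : q ∈ e.source)
include hq

theorem analyticAt_comp_chart_symm {F : Type*} [NormedAddCommGroup F] [NormedSpace ℝ F] {g : X → F}
    (hg : ContMDiffAt 𝓘(ℝ, Fin n → ℝ) 𝓘(ℝ, F) ω g q) :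
    AnalyticAt ℝ (fun x => g (e.symm x)) (e q) := by
  have h1 := contMDiffAt_symm_of_mem_maximalAtlas he (e.map_source hq)
  have h2 : ContMDiffAt 𝓘(ℝ, Fin n → ℝ) 𝓘(ℝ, F) ω g (e.symm (e q)) := by rwa [e.left_inv hq]
  have h3 := h2.comp (e q) h1
  rw [contMDiffAt_iff_contDiffAt] at h3
  exact h3.analyticAt

theorem analyticAt_coordinate_change {e' : OpenPartialHomeomorph Y (Fin m → ℝ)}
    (he' : e' ∈ IsManifold.maximalAtlas 𝓘(ℝ, Fin m → ℝ) ω Y) {f : X → Y}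
    (hf : ContMDiffAt 𝓘(ℝ, Fin n → ℝ) 𝓘(ℝ, Fin m → ℝ) ω f q) (hq' : f q ∈ e'.source) :
    AnalyticAt ℝ (fun x => e' (f (e.symm x))) (e q) :=
  analyticAt_comp_chart_symm he hq ((contMDiffAt_of_mem_maximalAtlas he' hq').comp q hf)

theorem mfderiv_eq_fderiv_comp {F : Type*} [NormedAddCommGroup F] [NormedSpace ℝ F] {g : X → F}
    (hg : ContMDiffAt 𝓘(ℝ, Fin n → ℝ) 𝓘(ℝ, F) ω g q) (v : TangentSpace 𝓘(ℝ, Fin n → ℝ) q) :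
    mfderiv 𝓘(ℝ, Fin n → ℝ) 𝓘(ℝ, F) g q v =
      fderiv ℝ (fun x => g (e.symm x)) (e q)
        (mfderiv 𝓘(ℝ, Fin n → ℝ) 𝓘(ℝ, Fin n → ℝ) e q v) := by
  have h1 : MDifferentiableAt 𝓘(ℝ, Fin n → ℝ) 𝓘(ℝ, F) (fun x => g (e.symm x)) (e q) :=
    (analyticAt_comp_chart_symm he hq hg).differentiableAt.mdifferentiableAt
  have h2 : MDifferentiableAt 𝓘(ℝ, Fin n → ℝ) 𝓘(ℝ, Fin n → ℝ) e q :=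
    (contMDiffAt_of_mem_maximalAtlas he hq).mdifferentiableAt (by simp)
  have h3 := mfderiv_comp q h1 h2
  have h4 : g =ᶠ[𝓝 q] (fun x => g (e.symm x)) ∘ e := by
    filter_upwards [e.open_source.mem_nhds hq] with x hx
    simp [e.left_inv hx]
  rw [h4.mfderiv_eq, h3, mfderiv_eq_fderiv]
  rfl

theorem mfderiv_chart_bijective :
    Function.Bijective (mfderiv 𝓘(ℝ, Fin n → ℝ) 𝓘(ℝ, Fin n → ℝ) e q) := by
  have h2 : MDifferentiableAt 𝓘(ℝ, Fin n → ℝ) 𝓘(ℝ, Fin n → ℝ) e q :=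
    (contMDiffAt_of_mem_maximalAtlas he hq).mdifferentiableAt (by simp)
  have h1 : MDifferentiableAt 𝓘(ℝ, Fin n → ℝ) 𝓘(ℝ, Fin n → ℝ) e.symm (e q) :=
    (contMDiffAt_symm_of_mem_maximalAtlas he (e.map_source hq)).mdifferentiableAt (by simp)
  have h2' : MDifferentiableAt 𝓘(ℝ, Fin n → ℝ) 𝓘(ℝ, Fin n → ℝ) e (e.symm (e q)) := by
    rwa [e.left_inv hq]
  have c1 := mfderiv_comp q h1 h2
  have c2 := mfderiv_comp (e q) h2' h1
  have i1 : e.symm ∘ e =ᶠ[𝓝 q] id := by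
    filter_upwards [e.open_source.mem_nhds hq] with x hx
    simp [e.left_inv hx]
  have i2 : e ∘ e.symm =ᶠ[𝓝 (e q)] id := by
    filter_upwards [e.open_target.mem_nhds (e.map_source hq)] with x hx
    simp [e.right_inv hx]
  rw [i1.mfderiv_eq, mfderiv_id] at c1
  rw [i2.mfderiv_eq, mfderiv_id, e.left_inv hq] at c2
  refine ⟨Function.LeftInverse.injective (g := mfderiv 𝓘(ℝ, Fin n → ℝ) 𝓘(ℝ, Fin n → ℝ) e.symm (e q))
    fun v => ?_, Function.RightInverse.surjective
      (g := mfderiv 𝓘(ℝ, Fin n → ℝ) 𝓘(ℝ, Fin n → ℝ) e.symm (e q)) fun v => ?_⟩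
  · exact (DFunLike.congr_fun c1 v).symm
  · exact (DFunLike.congr_fun c2 v).symm

theorem contMDiffAt_coordinate (i : Fin n) :
    ContMDiffAt 𝓘(ℝ, Fin n → ℝ) 𝓘(ℝ, ℝ) ω (fun x => e x i) q := by
  have h := contMDiffAt_of_mem_maximalAtlas he hq
  have hp : ContMDiffAt 𝓘(ℝ, Fin n → ℝ) 𝓘(ℝ, ℝ) ω (fun y : Fin n → ℝ => y i) (e q) :=
    (ContinuousLinearMap.proj (R := ℝ) (φ := fun _ : Fin n => ℝ) i).contDiff.contDiffAt.contMDiffAt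
  exact hp.comp q h

theorem mfderiv_coordinate (i : Fin n) (v : TangentSpace 𝓘(ℝ, Fin n → ℝ) q) :
    mfderiv 𝓘(ℝ, Fin n → ℝ) 𝓘(ℝ, ℝ) (fun x => e x i) q v =
      (mfderiv 𝓘(ℝ, Fin n → ℝ) 𝓘(ℝ, Fin n → ℝ) e q v : Fin n → ℝ) i := by
  rw [mfderiv_eq_fderiv_comp he hq (contMDiffAt_coordinate he hq i)]
  have h : (fun x => e (e.symm x) i) =ᶠ[𝓝 (e q)]
      (ContinuousLinearMap.proj (R := ℝ) (φ := fun _ : Fin n => ℝ) i) := by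
    filter_upwards [e.open_target.mem_nhds (e.map_source hq)] with x hx
    simp [e.right_inv hx]
  rw [h.fderiv_eq, ContinuousLinearMap.fderiv]
  rfl

/-- The tangent space of a coordinate subspace. -/
theorem mem_tangentTo_iff {A : Set X} (hqA : q ∈ A) {K : Finset (Fin n)}
    (hA : ∀ᶠ x in 𝓝 q, x ∈ A ↔ ∀ i ∈ K, e x i = 0) (v : TangentSpace 𝓘(ℝ, Fin n → ℝ) q) :
    v ∈ tangentTo (n := n) A q ↔
      ∀ i ∈ K, (mfderiv 𝓘(ℝ, Fin n → ℝ) 𝓘(ℝ, Fin n → ℝ) e q v : Fin n → ℝ) i = 0 := by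
  constructor
  · intro hv i hi
    rw [← mfderiv_coordinate he hq i v]
    refine hv _ (contMDiffAt_coordinate he hq i) ?_
    filter_upwards [nhdsWithin_le_nhds hA, self_mem_nhdsWithin] with x hx hxA
    exact hx.1 hxA i hi
  · intro hv g hg hgA
    rw [mfderiv_eq_fderiv_comp he hq hg]
    set u : Fin n → ℝ := mfderiv 𝓘(ℝ, Fin n → ℝ) 𝓘(ℝ, Fin n → ℝ) e q v with hu
    have hd := (analyticAt_comp_chart_symm he hq hg).differentiableAt.hasFDerivAt
    -- The line through `e q` in the direction `u` stays in the coordinate subspace, so `g` vanishes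
    -- along it and so does its derivative.
    have hline : HasDerivAt (fun s : ℝ => e q + s • u) u 0 := by
      simpa using ((hasDerivAt_id (0 : ℝ)).smul_const u).const_add (e q)
    have hd' : HasFDerivAt (fun x => g (e.symm x)) (fderiv ℝ (fun x => g (e.symm x)) (e q))
        (e q + (0 : ℝ) • u) := by simpa using hd
    have hcomp := hd'.comp_hasDerivAt (0 : ℝ) hline
    have t1 : Tendsto (fun s : ℝ => e q + s • u) (𝓝 0) (𝓝 (e q)) := by
      simpa using hline.continuousAt.tendsto
    have t2 : Tendsto (fun s : ℝ => e.symm (e q + s • u)) (𝓝 0) (𝓝 q) := by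
      have := (e.continuousAt_symm (e.map_source hq)).tendsto.comp t1
      rwa [e.left_inv hq] at this
    have hz : (fun s : ℝ => g (e.symm (e q + s • u))) =ᶠ[𝓝 0] fun _ => 0 := by
      filter_upwards [t2.eventually hA, t2.eventually (eventually_nhdsWithin_iff.1 hgA),
        t1.eventually (e.open_target.mem_nhds (e.map_source hq))] with s h1 h2 h3
      refine h2 (h1.2 fun i hi => ?_)
      rw [e.right_inv h3]
      have := hA.self_of_nhds.1 hqA i hi
      rw [Pi.add_apply, Pi.smul_apply, this, hv i hi, smul_zero, add_zero]
    have := hcomp.congr_of_eventuallyEq (f₁ := fun _ => (0 : ℝ)) (by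
      filter_upwards [hz] with s hs; simpa using hs.symm)
    exact this.unique (hasDerivAt_const _ _)

end

end Charts

/-! ### Analytic continuation along submanifolds -/

section Continuation

variable {n : ℕ} {X : Type*} [TopologicalSpace X] [ChartedSpace (Fin n → ℝ) X]

/-- The projection to the coordinate subspace `{x_i = 0, i ∈ I}`. -/
noncomputable def killCoords (I : Finset (Fin n)) : (Fin n → ℝ) →L[ℝ] (Fin n → ℝ) :=
  ContinuousLinearMap.pi fun i => if i ∈ I then 0 else ContinuousLinearMap.proj i

theorem killCoords_apply (I : Finset (Fin n)) (x : Fin n → ℝ) (i : Fin n) :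
    killCoords I x i = if i ∈ I then 0 else x i := by
  simp only [killCoords, ContinuousLinearMap.coe_pi']
  split_ifs <;> simp

/-- Identity theorem: in a chart flattening `A`, the equations of `B` restricted to `A` are analytic
on a ball around `p` and vanish near one of its points, hence on the whole ball. -/
theorem eventually_mem_of_frequently {A B : Set X} (hA : IsClosedSubmanifold (n := n) A)
    (hB : IsClosedSubmanifold (n := n) B) {p : X} (hpA : p ∈ A) (hpB : p ∈ B)
    (h : ∃ᶠ s in 𝓝 p, s ∈ A ∧ ∀ᶠ x in 𝓝 s, x ∈ A → x ∈ B) : ∀ᶠ x in 𝓝 p, x ∈ A → x ∈ B := by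
  obtain ⟨e, he, hpe, I, hI⟩ := hA.2 p hpA
  obtain ⟨e', he', hpe', I', hI'⟩ := hB.2 p hpB
  have hep : killCoords I (e p) = e p := by
    ext i
    rw [killCoords_apply]
    split_ifs with hi
    · exact ((hI p hpe).1 hpA i hi).symm
    · rfl
  -- a ball on which everything is defined
  have hnhds : e.target ∩ e.symm ⁻¹' e'.source ∈ 𝓝 (e p) := by
    refine inter_mem (e.open_target.mem_nhds (e.map_source hpe)) ?_
    refine (e.continuousAt_symm (e.map_source hpe)).preimage_mem_nhds ?_
    rw [e.left_inv hpe]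
    exact e'.open_source.mem_nhds hpe'
  obtain ⟨r, hr, hball⟩ := Metric.mem_nhds_iff.1 hnhds
  -- `e p` has zero coordinates in `I` and the metric is the sup metric, so killing these
  -- coordinates does not leave the ball.
  have hproj : ∀ y ∈ Metric.ball (e p) r, killCoords I y ∈ Metric.ball (e p) r := by
    intro y hy
    rw [Metric.mem_ball, dist_pi_lt_iff hr] at hy ⊢
    intro i
    rw [← congrFun hep i, killCoords_apply, killCoords_apply]
    split_ifs with hi
    · simpa using hr
    · exact hy i
  have hsymmA : ∀ y ∈ Metric.ball (e p) r, e.symm (killCoords I y) ∈ A := by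
    intro y hy
    have h1 := (hball (hproj y hy)).1
    refine (hI _ (e.map_target h1)).2 fun i hi => ?_
    rw [e.right_inv h1, killCoords_apply, if_pos hi]
  have hzero : ∀ i ∈ I', ∀ y ∈ Metric.ball (e p) r, e' (e.symm (killCoords I y)) i = 0 := by
    intro i hi
    have han : AnalyticOnNhd ℝ (fun y => e' (e.symm (killCoords I y)) i)
        (Metric.ball (e p) r) := by
      intro y hy
      have h1 := hball (hproj y hy)
      have h2 := analyticAt_comp_chart_symm he (e.map_target h1.1)
        (contMDiffAt_coordinate he' h1.2 i)
      rw [e.right_inv h1.1] at h2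
      exact h2.comp_of_eq ((killCoords I).analyticAt y) rfl
    -- a point near which the function vanishes
    have hs : ∀ᶠ s in 𝓝 p, s ∈ e.source ∧ e s ∈ Metric.ball (e p) r :=
      Filter.Eventually.and (e.open_source.mem_nhds hpe)
        ((e.continuousAt hpe).tendsto.eventually (Metric.ball_mem_nhds _ hr))
    obtain ⟨s, ⟨hsA, hsB⟩, hse, hsb⟩ := (h.and_eventually hs).exists
    have hes : killCoords I (e s) = e s := by
      ext i
      rw [killCoords_apply]
      split_ifs with hi
      · exact ((hI s hse).1 hsA i hi).symm
      · rfl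
    have hev : (fun y => e' (e.symm (killCoords I y)) i) =ᶠ[𝓝 (e s)] 0 := by
      have t : Tendsto (fun y => e.symm (killCoords I y)) (𝓝 (e s)) (𝓝 s) := by
        have h1 : Tendsto (killCoords I) (𝓝 (e s)) (𝓝 (e s)) := by
          simpa [hes] using (killCoords I).continuous.tendsto (e s)
        have h2 := (e.continuousAt_symm (e.map_source hse)).tendsto.comp h1
        rwa [e.left_inv hse] at h2
      filter_upwards [t.eventually hsB, Metric.isOpen_ball.mem_nhds hsb] with y h1 h2
      exact (hI' _ (hball (hproj y h2)).2).1 (h1 (hsymmA y h2)) i hi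
    exact han.eqOn_zero_of_preconnected_of_eventuallyEq_zero
      (convex_ball _ _).isPreconnected hsb hev
  filter_upwards [e.open_source.mem_nhds hpe,
    (e.continuousAt hpe).tendsto.eventually (Metric.ball_mem_nhds _ hr)] with x hx hxb hxA
  have hex : killCoords I (e x) = e x := by
    ext i
    rw [killCoords_apply]
    split_ifs with hi
    · exact ((hI x hx).1 hxA i hi).symm
    · rfl
  have h1 := (hball hxb).2
  simp only [mem_preimage, e.left_inv hx] at h1
  refine (hI' x h1).2 fun i hi => ?_
  have := hzero i hi _ hxb
  rwa [hex, e.left_inv hx] at this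

/-- A connected closed submanifold which is contained in another one near some point is contained in
it. -/
theorem subset_of_eventually_mem {A B : Set X} (hA : IsClosedSubmanifold (n := n) A)
    (hB : IsClosedSubmanifold (n := n) B) (hAc : IsPreconnected A) {p : X} (hp : p ∈ A)
    (h : ∀ᶠ x in 𝓝 p, x ∈ A → x ∈ B) : A ⊆ B := by
  set u : Set X := {s | ∀ᶠ x in 𝓝 s, x ∈ A → x ∈ B} with hu
  have huo : IsOpen u := isOpen_iff_mem_nhds.2 fun s hs => eventually_eventually_nhds.2 hs
  have huB : A ∩ u ⊆ B := fun s hs => hs.2.self_of_nhds hs.1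
  set v : Set X := (closure (A ∩ u))ᶜ with hv
  have hvo : IsOpen v := isClosed_closure.isOpen_compl
  -- The trace of `u` on `A` is open by definition and closed by `eventually_mem_of_frequently`;
  -- connectedness then makes it all of `A`.
  have hcov : A ⊆ u ∪ v := by
    intro s hs
    by_cases hsc : s ∈ closure (A ∩ u)
    · refine Or.inl (eventually_mem_of_frequently hA hB hs ?_ (mem_closure_iff_frequently.1 hsc))
      exact closure_minimal huB hB.1 hsc
    · exact Or.inr hsc
  rcases isPreconnected_iff_subset_of_disjoint.1 hAc u v huo hvo hcov (by
    ext s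
    simp only [mem_inter_iff, mem_empty_iff_false, iff_false, not_and]
    intro hs hsu hsv
    exact hsv (subset_closure (mem_inter hs hsu))) with h' | h'
  · exact fun s hs => huB ⟨hs, h' hs⟩
  · exact absurd (subset_closure (mem_inter hp h)) (h' hp)

end Continuation

/-! ### Adapted charts around a common point of the submanifolds -/

section Adapted

variable {n l : ℕ} {X : Type*} [TopologicalSpace X] [ChartedSpace (Fin n → ℝ) X] {M : Fin l → Set X}

theorem IsAdmissible.injective (hM : IsAdmissible (n := n) M) : Function.Injective M :=
  fun j k h => by_contra fun hjk => hM.distinct j k hjk h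

namespace AdaptedChart

variable (φ : AdaptedChart n M)

theorem mem_iff_of_mem {q : X} (hq : q ∈ φ.chart.source) {j : Fin l} (hqj : q ∈ M j) {x : X}
    (hx : x ∈ φ.chart.source) : x ∈ M j ↔ ∀ i ∈ φ.I j, φ.chart x i = 0 :=
  φ.mem_iff j ⟨q, hqj, hq⟩ x hx

theorem eventually_mem_iff {q : X} (hq : q ∈ φ.chart.source) {j : Fin l} (hqj : q ∈ M j) :
    ∀ᶠ x in 𝓝 q, x ∈ M j ↔ ∀ i ∈ φ.I j, φ.chart x i = 0 := by
  filter_upwards [φ.chart.open_source.mem_nhds hq] with x hx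
  exact φ.mem_iff_of_mem hq hqj hx

variable {φ}

/-- Near a common point `q` the submanifolds are coordinate subspaces, whose inclusions reverse
those of the index sets. Passing from an inclusion near `q` to a global one uses connectedness (H1)
and analytic continuation. -/
theorem reflectsOrder (hM : IsAdmissible (n := n) M) {q : X} (hq : q ∈ φ.chart.source)
    (hqM : ∀ j, q ∈ M j) : φ.ReflectsOrder := by
  intro j k
  constructor
  · intro hjk i hi
    by_contra hij
    -- move in the direction of the coordinate `i`
    have t1 : Tendsto (fun s : ℝ => φ.chart q + s • Pi.single i (1 : ℝ)) (𝓝[≠] 0)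
        (𝓝 (φ.chart q)) := by
      have c : Continuous fun s : ℝ => φ.chart q + s • Pi.single i (1 : ℝ) := by fun_prop
      have := c.tendsto 0
      simp only [zero_smul, add_zero] at this
      exact this.mono_left nhdsWithin_le_nhds
    obtain ⟨s, hs, hs0⟩ := ((t1.eventually
      (φ.chart.open_target.mem_nhds (φ.chart.map_source hq))).and
        (self_mem_nhdsWithin : ∀ᶠ s : ℝ in 𝓝[≠] 0, s ∈ ({0}ᶜ : Set ℝ))).exists
    have h0 : ∀ j, ∀ i ∈ φ.I j, φ.chart q i = 0 := fun j =>
      (φ.mem_iff_of_mem hq (hqM j) hq).1 (hqM j)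
    have hj : φ.chart.symm (φ.chart q + s • Pi.single i (1 : ℝ)) ∈ M j := by
      refine (φ.mem_iff_of_mem hq (hqM j) (φ.chart.map_target hs)).2 fun i' hi' => ?_
      rw [φ.chart.right_inv hs]
      have : i' ≠ i := fun h => hij (h ▸ hi')
      simp [h0 j i' hi', Pi.single_eq_of_ne this]
    have hk := (φ.mem_iff_of_mem hq (hqM k) (φ.chart.map_target hs)).1 (hjk hj) i hi
    rw [φ.chart.right_inv hs] at hk
    simp only [Pi.add_apply, h0 k i hi, Pi.smul_apply, Pi.single_eq_same, smul_eq_mul, mul_one,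
      zero_add] at hk
    exact hs0 hk
  · intro hkj
    refine subset_of_eventually_mem (hM.submanifold j) (hM.submanifold k)
      (hM.connected j).isPreconnected (hqM j) ?_
    filter_upwards [φ.eventually_mem_iff hq (hqM j), φ.eventually_mem_iff hq (hqM k)]
      with x h1 h2 hx
    exact h2.2 fun i hi => h1.1 hx i (hkj hi)

theorem J_eq_lowerIdx_of_mem_Ihat (hM : IsAdmissible (n := n) M)
    (h : ((⋂ j, M j) ∩ φ.chart.source).Nonempty) {j : Fin l} {k : Fin n} (hk : k ∈ φ.Ihat j) :
    φ.J k = lowerIdx M j := by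
  obtain ⟨q, hqM, hq⟩ := h
  exact J_eq_lowerIdx (reflectsOrder hM hq (mem_iInter.1 hqM)) hk

open Classical in
/-- The coordinates which vanish on `ι(M_j)`. -/
noncomputable def iotaIdx (φ : AdaptedChart n M) (j : Fin l) : Finset (Fin n) :=
  Finset.univ.filter fun i => ∃ k, M j ⊂ M k ∧ i ∈ φ.I k

theorem mem_iotaIdx {i : Fin n} {j : Fin l} :
    i ∈ φ.iotaIdx j ↔ ∃ k, M j ⊂ M k ∧ i ∈ φ.I k := by simp [iotaIdx]

theorem eventually_mem_iota_iff {q : X} (hq : q ∈ φ.chart.source) (hqM : ∀ j, q ∈ M j)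
    (j : Fin l) : ∀ᶠ x in 𝓝 q, x ∈ iota M j ↔ ∀ i ∈ φ.iotaIdx j, φ.chart x i = 0 := by
  filter_upwards [φ.chart.open_source.mem_nhds hq] with x hx
  simp only [iota, mem_iInter, mem_ofPred_eq, mem_iotaIdx]
  constructor
  · rintro h i ⟨k, hk, hik⟩
    exact (φ.mem_iff_of_mem hq (hqM k) hx).1 (h k hk) i hik
  · intro h k hk
    exact (φ.mem_iff_of_mem hq (hqM k) hx).2 fun i hi => h i ⟨k, hk, hi⟩

/-- The coordinates in `Î_j` are the equations of `M_j` that are not already equations of `ι(M_j)`;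
hence they are coordinates on the normal fibre. -/
theorem mem_Ihat_iff (hφ : φ.ReflectsOrder) {i : Fin n} {j : Fin l} :
    i ∈ φ.Ihat j ↔ i ∈ φ.I j ∧ i ∉ φ.iotaIdx j := by
  rw [mem_Ihat, mem_iotaIdx]
  have : ∀ k, M j ⊂ M k ↔ φ.I k ⊂ φ.I j := fun k => by
    rw [ssubset_def, Finset.ssubset_def, hφ, hφ]
  simp [this]

theorem mem_tangentTo_iff {q : X} (hq : q ∈ φ.chart.source) {j : Fin l} (hqj : q ∈ M j)
    (v : TangentSpace 𝓘(ℝ, Fin n → ℝ) q) : v ∈ tangentTo (n := n) (M j) q ↔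
      ∀ i ∈ φ.I j,
        (mfderiv 𝓘(ℝ, Fin n → ℝ) 𝓘(ℝ, Fin n → ℝ) φ.chart q v : Fin n → ℝ) i = 0 :=
  MultiNormal.mem_tangentTo_iff φ.mem_atlas hq hqj (φ.eventually_mem_iff hq hqj) v

theorem mem_tangentTo_iota_iff {q : X} (hq : q ∈ φ.chart.source) (hqM : ∀ j, q ∈ M j) (j : Fin l)
    (v : TangentSpace 𝓘(ℝ, Fin n → ℝ) q) : v ∈ tangentTo (n := n) (iota M j) q ↔
      ∀ i ∈ φ.iotaIdx j,
        (mfderiv 𝓘(ℝ, Fin n → ℝ) 𝓘(ℝ, Fin n → ℝ) φ.chart q v : Fin n → ℝ) i = 0 :=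
  MultiNormal.mem_tangentTo_iff φ.mem_atlas hq
    (mem_iInter₂.2 fun k _ => hqM k) (eventually_mem_iota_iff hq hqM j) v

end AdaptedChart

end Adapted

/-! ### Simultaneous coordinates -/

section LinearAlgebra

variable {V ι : Type*} [AddCommGroup V] [Module ℝ V] [PartialOrder ι] [Fintype ι]

/-- `C j` is a complement in `A j` of the sum of the `A k` with `k > j`. For independence, take a
minimal index `j` with nonzero term in a vanishing sum: the terms at or above `j` add up to an
element of `A j`, the others have incomparable indices, so both parts vanish by `hd`, and then `v j`
vanishes by the choice of `C j`. -/
theorem exists_relative_complements (A : ι → Submodule ℝ V) (hA : ∀ j k, j ≤ k → A k ≤ A j)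
    (hd : ∀ j, Disjoint (A j) (⨆ k ∈ {k | ¬ j ≤ k ∧ ¬ k ≤ j}, A k)) :
    ∃ C : ι → Submodule ℝ V, iSupIndep C ∧ ∀ j, A j = ⨆ k ∈ Set.Ici j, C k := by
  classical
  have hex : ∀ j, ∃ C ≤ A j, Disjoint C (⨆ k ∈ Set.Ioi j, A k) ∧ C ⊔ (⨆ k ∈ Set.Ioi j, A k) = A j := by
    intro j
    have hW : (⨆ k ∈ Set.Ioi j, A k) ≤ A j := iSup₂_le fun k hk => hA j k (le_of_lt hk)
    obtain ⟨C₀, hC₀⟩ := Submodule.exists_isCompl (⨆ k ∈ Set.Ioi j, A k)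
    refine ⟨C₀ ⊓ A j, inf_le_right, hC₀.disjoint.symm.mono_left inf_le_left, ?_⟩
    rw [sup_comm, ← sup_inf_assoc_of_le C₀ hW, hC₀.sup_eq_top, top_inf_eq]
  choose C hCA hCd hCs using hex
  refine ⟨C, ?_, ?_⟩
  · rw [iSupIndep_iff_finsetSum_eq_zero_imp_eq_zero]
    intro s v hv hsum
    by_contra! hne
    obtain ⟨i₀, hi₀, hvi₀⟩ := hne
    obtain ⟨j, hj⟩ := (s.filter fun i => v i ≠ 0).exists_minimal
      ⟨i₀, Finset.mem_filter.2 ⟨hi₀, hvi₀⟩⟩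
    have hjs := (Finset.mem_filter.1 hj.prop).1
    have hj0 := (Finset.mem_filter.1 hj.prop).2
    -- split the sum according to the position of the index with respect to `j`
    set a : V := ∑ k ∈ s with j < k, v k with ha
    set b : V := ∑ k ∈ s with ¬ j ≤ k, v k with hb
    have hsplit : v j + a + b = 0 := by
      have h1 : ∑ k ∈ s with j ≤ k, v k = v j + a := by
        have : s.filter (fun k => j ≤ k) = insert j (s.filter fun k => j < k) := by
          ext k
          simp only [Finset.mem_filter, Finset.mem_insert]
          constructor
          · rintro ⟨h1, h2⟩
            rcases h2.eq_or_lt with h | h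
            · exact Or.inl h.symm
            · exact Or.inr ⟨h1, h⟩
          · rintro (rfl | ⟨h1, h2⟩)
            · exact ⟨hjs, le_rfl⟩
            · exact ⟨h1, h2.le⟩
        rw [this, Finset.sum_insert (by simp)]
      rw [← h1, hb, Finset.sum_filter_add_sum_filter_not, hsum]
    have haW : a ∈ ⨆ k ∈ Set.Ioi j, A k := by
      refine Submodule.sum_mem _ fun k hk => ?_
      exact (le_iSup₂_of_le (f := fun k (_ : k ∈ Set.Ioi j) => A k) k (Finset.mem_filter.1 hk).2
        le_rfl) (hCA k (hv k (Finset.mem_filter.1 hk).1))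
    have hbW : b ∈ ⨆ k ∈ {k | ¬ j ≤ k ∧ ¬ k ≤ j}, A k := by
      refine Submodule.sum_mem _ fun k hk => ?_
      by_cases hk0 : v k = 0
      · rw [hk0]; exact zero_mem _
      obtain ⟨hks, hjk⟩ := Finset.mem_filter.1 hk
      have hkj : ¬ k ≤ j := fun h => hjk (hj.le_of_le (Finset.mem_filter.2 ⟨hks, hk0⟩) h)
      exact (le_iSup₂_of_le (f := fun k (_ : k ∈ {k | ¬ j ≤ k ∧ ¬ k ≤ j}) => A k) k ⟨hjk, hkj⟩
        le_rfl) (hCA k (hv k hks))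
    have haA : v j + a ∈ A j := add_mem (hCA j (hv j hjs))
      ((iSup₂_le fun k hk => hA j k (le_of_lt hk) : (⨆ k ∈ Set.Ioi j, A k) ≤ A j) haW)
    have hb' : v j + a = -b := eq_neg_of_add_eq_zero_left hsplit
    have hz : v j + a = 0 :=
      Submodule.disjoint_def.1 (hd j) _ haA (hb' ▸ neg_mem hbW)
    exact hj0 (Submodule.disjoint_def.1 (hCd j) _ (hv j hjs)
      ((eq_neg_of_add_eq_zero_left hz) ▸ neg_mem haW))
  · intro j
    induction j using WellFoundedGT.induction with
    | _ j ih =>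
    rw [← hCs j]
    apply le_antisymm
    · refine sup_le (le_iSup₂_of_le (f := fun k (_ : k ∈ Set.Ici j) => C k) j self_mem_Ici le_rfl)
        (iSup₂_le fun k hk => ?_)
      rw [ih k hk]
      exact iSup₂_le fun i hi => le_iSup₂_of_le (f := fun k (_ : k ∈ Set.Ici j) => C k) i
        (le_trans (le_of_lt hk) hi) le_rfl
    · refine iSup₂_le fun k hk => ?_
      rcases (show j ≤ k from hk).eq_or_lt with rfl | h
      · exact le_sup_left
      · exact le_sup_of_le_right (le_iSup₂_of_le (f := fun k (_ : k ∈ Set.Ioi j) => A k) k h (hCA k))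

/-- A basis of `V` adapted to a family of subspaces, under a condition dual to H2. -/
theorem exists_adapted_basis [FiniteDimensional ℝ V] {n : ℕ} (hn : Module.finrank ℝ V = n)
    (A : ι → Submodule ℝ V) (hA : ∀ j k, j ≤ k → A k ≤ A j)
    (hd : ∀ j, Disjoint (A j) (⨆ k ∈ {k | ¬ j ≤ k ∧ ¬ k ≤ j}, A k)) :
    ∃ (b : Module.Basis (Fin n) ℝ V) (I : ι → Finset (Fin n)),
      (∀ j, Submodule.span ℝ (b '' I j) = A j) ∧ (∀ j k, j ≤ k → I k ⊆ I j) ∧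
      (∀ j k, ¬ j ≤ k → ¬ k ≤ j → Disjoint (I j) (I k)) ∧
      ∀ i, (∃ j, i ∈ I j) → ∃ k, i ∈ I k ∧ ∀ j, i ∈ I j → j ≤ k := by
  classical
  obtain ⟨C, hC, hAC⟩ := exists_relative_complements A hA hd
  choose s hsC hsspan hsind using fun j => exists_linearIndependent ℝ (C j : Set V)
  have hspan : ∀ j, Submodule.span ℝ (s j) = C j := fun j => by
    rw [hsspan, Submodule.span_eq]
  -- Bases of the independent subspaces `C j` have an independent union, which is then extended to a
  -- basis of `V`.
  have hli : LinearIndepOn ℝ id (⋃ j, s j) := by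
    refine linearIndepOn_id_iUnion_finite hsind fun i t _ hit => ?_
    simp only [hspan]
    exact hC.disjoint_biSup hit
  set B := Module.Basis.extend hli with hB
  have hfin : Finite (hli.extend (subset_univ _)) := Module.Finite.finite_basis B
  have : Fintype (hli.extend (subset_univ _)) := Fintype.ofFinite _
  have hcard : Fintype.card (hli.extend (subset_univ _)) = n := by
    rw [← Module.finrank_eq_card_basis B, hn]
  let eqv := Fintype.equivFinOfCardEq hcard
  set b := B.reindex eqv with hb
  have hbv : ∀ x (hx : x ∈ hli.extend (subset_univ _)), b (eqv ⟨x, hx⟩) = x := by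
    intro x hx
    simp [hb, hB]
  have hsub : ∀ j, s j ⊆ hli.extend (subset_univ _) := fun j =>
    (subset_iUnion s j).trans (hli.subset_extend _)
  have hsd : ∀ j k, ∀ x, x ∈ s j → x ∈ s k → j = k := by
    intro j k x hj hk
    by_contra hjk
    have h0 : x = 0 := Submodule.disjoint_def.1 (hC.pairwiseDisjoint hjk) x (hsC j hj) (hsC k hk)
    have := (hsind j).ne_zero ⟨x, hj⟩
    exact this h0
  let I : ι → Finset (Fin n) := fun j => Finset.univ.filter fun i => ∃ k, j ≤ k ∧ b i ∈ s k
  have hI : ∀ i j, i ∈ I j ↔ ∃ k, j ≤ k ∧ b i ∈ s k := fun i j => by simp [I]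
  refine ⟨b, I, fun j => ?_, fun j k hjk i hi => ?_, fun j k hjk hkj => ?_, ?_⟩
  · have : b '' I j = ⋃ k ∈ Set.Ici j, s k := by
      ext x
      simp only [mem_image, Finset.mem_coe, hI, mem_iUnion, mem_Ici, exists_prop]
      constructor
      · rintro ⟨i, ⟨k, hk, hik⟩, rfl⟩
        exact ⟨k, hk, hik⟩
      · rintro ⟨k, hk, hx⟩
        exact ⟨eqv ⟨x, hsub k hx⟩, ⟨k, hk, by rwa [hbv]⟩, hbv _ _⟩
    rw [this, hAC j, Submodule.span_iUnion₂]
    simp only [hspan]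
  · obtain ⟨m, hm, hi⟩ := (hI _ _).1 hi
    exact (hI _ _).2 ⟨m, hjk.trans hm, hi⟩
  · refine Finset.disjoint_left.2 fun i hij hik => ?_
    obtain ⟨m, hm, hi⟩ := (hI _ _).1 hij
    obtain ⟨m', hm', hi'⟩ := (hI _ _).1 hik
    have hmm := hsd _ _ _ hi hi'
    subst hmm
    have h1 : b i ∈ A j := hA _ _ hm (by
      rw [hAC m]
      exact (le_iSup₂_of_le (f := fun k (_ : k ∈ Set.Ici m) => C k) m self_mem_Ici le_rfl)
        (hsC m hi))
    have h2 : b i ∈ A k := hA _ _ hm' (by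
      rw [hAC m]
      exact (le_iSup₂_of_le (f := fun k (_ : k ∈ Set.Ici m) => C k) m self_mem_Ici le_rfl)
        (hsC m hi))
    exact b.ne_zero i (Submodule.disjoint_def.1 (hd j) _ h1
      ((le_iSup₂_of_le (f := fun k (_ : k ∈ {k | ¬ j ≤ k ∧ ¬ k ≤ j}) => A k) k ⟨hjk, hkj⟩
        le_rfl) h2))
  -- A basis vector lies in at most one `s k`, and this `k` is the greatest index whose `I` contains
  -- it.
  · rintro i ⟨j, hj⟩
    obtain ⟨k, hk, hi⟩ := (hI _ _).1 hj
    refine ⟨k, (hI _ _).2 ⟨k, le_rfl, hi⟩, fun j' hj' => ?_⟩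
    obtain ⟨k', hk', hi'⟩ := (hI _ _).1 hj'
    rwa [hsd _ _ _ hi hi']

end LinearAlgebra

/-! ### Charts from the analytic inverse function theorem -/

section InverseFunction

variable {n : ℕ} {X : Type*} [TopologicalSpace X] [ChartedSpace (Fin n → ℝ) X]
  {e : OpenPartialHomeomorph X (Fin n → ℝ)}

theorem trans_mem_maximalAtlas (he : e ∈ IsManifold.maximalAtlas 𝓘(ℝ, Fin n → ℝ) ω X)
    {θ : OpenPartialHomeomorph (Fin n → ℝ) (Fin n → ℝ)}
    (hθ : ∀ x ∈ θ.source, AnalyticAt ℝ θ x) (hθ' : ∀ y ∈ θ.target, AnalyticAt ℝ θ.symm y) :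
    e ≫ₕ θ ∈ IsManifold.maximalAtlas 𝓘(ℝ, Fin n → ℝ) ω X := by
  have h : θ ∈ contDiffGroupoid ω 𝓘(ℝ, Fin n → ℝ) := by
    rw [contDiffGroupoid, mem_groupoid_of_pregroupoid]
    constructor
    · refine ContDiffOn.congr (f := θ) (fun x hx => ?_) fun _ _ => rfl
      exact (hθ x hx.1).contDiffAt.contDiffWithinAt
    · refine ContDiffOn.congr (f := θ.symm) (fun x hx => ?_) fun _ _ => rfl
      exact (hθ' x hx.1).contDiffAt.contDiffWithinAt
  intro e' he'
  constructor
  · rw [OpenPartialHomeomorph.trans_symm_eq_symm_trans_symm, OpenPartialHomeomorph.trans_assoc]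
    exact StructureGroupoid.trans _ (StructureGroupoid.symm _ h) (he e' he').1
  · rw [← OpenPartialHomeomorph.trans_assoc]
    exact StructureGroupoid.trans _ (he e' he').2 h

/-- Functions with independent differentials are the coordinates of a chart. -/
theorem exists_chart_of_injective (he : e ∈ IsManifold.maximalAtlas 𝓘(ℝ, Fin n → ℝ) ω X) {q : X}
    (hq : q ∈ e.source) {g : X → (Fin n → ℝ)}
    (hg : AnalyticAt ℝ (fun x => g (e.symm x)) (e q))
    (hinj : Function.Injective (fderiv ℝ (fun x => g (e.symm x)) (e q))) {U : Set X}
    (hU : U ∈ 𝓝 q) :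
    ∃ e' ∈ IsManifold.maximalAtlas 𝓘(ℝ, Fin n → ℝ) ω X, q ∈ e'.source ∧ e'.source ⊆ U ∧
      ∀ x ∈ e'.source, e' x = g x := by
  set Φ := fun x => g (e.symm x) with hΦ
  let D : (Fin n → ℝ) ≃L[ℝ] (Fin n → ℝ) :=
    (LinearEquiv.ofInjectiveEndo (fderiv ℝ Φ (e q) : (Fin n → ℝ) →ₗ[ℝ] (Fin n → ℝ))
      hinj).toContinuousLinearEquiv
  have hD : HasFDerivAt Φ (D : (Fin n → ℝ) →L[ℝ] (Fin n → ℝ)) (e q) := by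
    have : (D : (Fin n → ℝ) →L[ℝ] (Fin n → ℝ)) = fderiv ℝ Φ (e q) := by
      ext v; rfl
    rw [this]
    exact hg.differentiableAt.hasFDerivAt
  have hcd : ContDiffAt ℝ ω Φ (e q) := hg.contDiffAt
  set θ := hcd.toOpenPartialHomeomorph Φ hD (by simp) with hθ
  have hθΦ : (θ : (Fin n → ℝ) → (Fin n → ℝ)) = Φ := rfl
  have hqθ : e q ∈ θ.source := hcd.mem_toOpenPartialHomeomorph_source hD (by simp)
  have hsymm : AnalyticAt ℝ θ.symm (θ (e q)) := by
    have := hcd.to_localInverse hD (by simp)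
    exact this.analyticAt
  -- The domain is shrunk so that the map and its inverse are analytic at every point, not only at
  -- the centre, and so that the chart lies in `U`.
  have hW : {x | AnalyticAt ℝ Φ x} ∩ θ ⁻¹' {y | AnalyticAt ℝ θ.symm y} ∩ e.symm ⁻¹' U ∈ 𝓝 (e q) := by
    refine inter_mem (inter_mem ((isOpen_analyticAt ℝ Φ).mem_nhds hg) ?_) ?_
    · exact (θ.continuousAt hqθ).preimage_mem_nhds ((isOpen_analyticAt ℝ θ.symm).mem_nhds hsymm)
    · refine (e.continuousAt_symm (e.map_source hq)).preimage_mem_nhds ?_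
      rwa [e.left_inv hq]
  obtain ⟨W, hWs, hWo, hqW⟩ := mem_nhds_iff.1 hW
  set θ' := θ.restrOpen W hWo with hθ'
  have hsrc : θ'.source = θ.source ∩ W := θ.restrOpen_source W hWo
  have hA1 : ∀ x ∈ θ'.source, AnalyticAt ℝ θ' x := by
    intro x hx
    rw [hsrc] at hx
    exact (hWs hx.2).1.1
  have hA2 : ∀ y ∈ θ'.target, AnalyticAt ℝ θ'.symm y := by
    intro y hy
    have h1 := θ'.map_target hy
    rw [hsrc] at h1
    have h2 := (hWs h1.2).1.2
    have h3 : θ (θ'.symm y) = y := θ'.right_inv hy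
    rw [mem_preimage, h3] at h2
    exact h2
  refine ⟨e ≫ₕ θ', trans_mem_maximalAtlas he hA1 hA2, ?_, ?_, ?_⟩
  · rw [OpenPartialHomeomorph.trans_source, hsrc]
    exact ⟨hq, hqθ, hqW⟩
  · intro x hx
    rw [OpenPartialHomeomorph.trans_source, hsrc] at hx
    have := (hWs hx.2.2).2
    rwa [mem_preimage, e.left_inv hx.1] at this
  · intro x hx
    rw [OpenPartialHomeomorph.trans_source, hsrc] at hx
    change Φ (e x) = g x
    simp only [hΦ, e.left_inv hx.1]

/-- A linear left inverse of the differential reduces the statement to the inverse function theorem.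
-/
theorem exists_locally_injective (he : e ∈ IsManifold.maximalAtlas 𝓘(ℝ, Fin n → ℝ) ω X) {q : X}
    (hq : q ∈ e.source) {F : Type*} [NormedAddCommGroup F] [NormedSpace ℝ F]
    [FiniteDimensional ℝ F] {g : X → F} (hg : AnalyticAt ℝ (fun x => g (e.symm x)) (e q))
    (hinj : Function.Injective (fderiv ℝ (fun x => g (e.symm x)) (e q))) :
    ∃ U ∈ 𝓝 q, ∀ x ∈ U, ∀ y ∈ U, g x = g y → x = y := by
  obtain ⟨L, hL⟩ := LinearMap.exists_leftInverse_of_injective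
    (fderiv ℝ (fun x => g (e.symm x)) (e q) : (Fin n → ℝ) →ₗ[ℝ] F) (LinearMap.ker_eq_bot.2 hinj)
  set L' : F →L[ℝ] (Fin n → ℝ) := LinearMap.toContinuousLinearMap L with hL'
  have hLg : HasFDerivAt (fun x => L' (g (e.symm x)))
      (L'.comp (fderiv ℝ (fun x => g (e.symm x)) (e q))) (e q) :=
    L'.hasFDerivAt.comp (e q) hg.differentiableAt.hasFDerivAt
  obtain ⟨e', -, hq', -, he'⟩ := exists_chart_of_injective he hq (g := fun x => L' (g x))
    ((L'.analyticAt _).comp hg) (by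
      rw [hLg.fderiv]
      intro v w hvw
      have h1 : ∀ u, L' (fderiv ℝ (fun x => g (e.symm x)) (e q) u) = u := fun u =>
        LinearMap.congr_fun hL u
      have h2 : L' (fderiv ℝ (fun x => g (e.symm x)) (e q) v) =
        L' (fderiv ℝ (fun x => g (e.symm x)) (e q) w) := hvw
      rwa [h1, h1] at h2) univ_mem
  refine ⟨e'.source, e'.open_source.mem_nhds hq', fun x hx y hy hxy => ?_⟩
  refine e'.injOn hx hy ?_
  rw [he' x hx, he' y hy, hxy]

end InverseFunction

/-! ### Existence of adapted charts -/

section Existence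

variable {n : ℕ} {X : Type*} [TopologicalSpace X] [ChartedSpace (Fin n → ℝ) X]
  {e : OpenPartialHomeomorph X (Fin n → ℝ)}

/-- The differentials at `q`, in the chart `e`, of the analytic functions vanishing on `A`. -/
def conormal (he : e ∈ IsManifold.maximalAtlas 𝓘(ℝ, Fin n → ℝ) ω X) {q : X} (hq : q ∈ e.source)
    (A : Set X) : Submodule ℝ ((Fin n → ℝ) →L[ℝ] ℝ) where
  carrier := {ξ | ∃ g : X → ℝ, ContMDiffAt 𝓘(ℝ, Fin n → ℝ) 𝓘(ℝ, ℝ) ω g q ∧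
    (∀ᶠ x in 𝓝[A] q, g x = 0) ∧ fderiv ℝ (fun x => g (e.symm x)) (e q) = ξ}
  zero_mem' := ⟨fun _ => 0, contMDiffAt_const, by simp, by simp⟩
  add_mem' := by
    rintro ξ η ⟨g, hg, hgA, rfl⟩ ⟨h, hh, hhA, rfl⟩
    refine ⟨fun x => g x + h x, hg.add hh, ?_, ?_⟩
    · filter_upwards [hgA, hhA] with x h1 h2
      rw [h1, h2, add_zero]
    · exact fderiv_fun_add (analyticAt_comp_chart_symm he hq hg).differentiableAt
        (analyticAt_comp_chart_symm he hq hh).differentiableAt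
  smul_mem' := by
    rintro c ξ ⟨g, hg, hgA, rfl⟩
    have hc : ContMDiffAt 𝓘(ℝ, Fin n → ℝ) 𝓘(ℝ, ℝ) ω (fun _ : X => c) q := contMDiffAt_const
    refine ⟨fun x => c • g x, hc.smul hg, ?_, ?_⟩
    · filter_upwards [hgA] with x h1
      rw [h1, smul_zero]
    · exact fderiv_fun_const_smul (analyticAt_comp_chart_symm he hq hg).differentiableAt c

theorem conormal_anti (he : e ∈ IsManifold.maximalAtlas 𝓘(ℝ, Fin n → ℝ) ω X) {q : X}
    (hq : q ∈ e.source) {A B : Set X} (h : A ⊆ B) : conormal he hq B ≤ conormal he hq A := by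
  rintro ξ ⟨g, hg, hgB, rfl⟩
  exact ⟨g, hg, hgB.filter_mono (nhdsWithin_mono q h), rfl⟩

theorem conormal_apply_eq_zero (he : e ∈ IsManifold.maximalAtlas 𝓘(ℝ, Fin n → ℝ) ω X) {q : X}
    (hq : q ∈ e.source) {A : Set X} {ξ : (Fin n → ℝ) →L[ℝ] ℝ} (hξ : ξ ∈ conormal he hq A)
    {v : TangentSpace 𝓘(ℝ, Fin n → ℝ) q} (hv : v ∈ tangentTo (n := n) A q) :
    ξ (mfderiv 𝓘(ℝ, Fin n → ℝ) 𝓘(ℝ, Fin n → ℝ) e q v) = 0 := by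
  obtain ⟨g, hg, hgA, rfl⟩ := hξ
  rw [← mfderiv_eq_fderiv_comp he hq hg]
  exact hv g hg hgA

/-- Functions which vanish on a submanifold and whose differentials span its conormal space are
local equations of it. -/
theorem eventually_mem_of_equations (he : e ∈ IsManifold.maximalAtlas 𝓘(ℝ, Fin n → ℝ) ω X) {q : X}
    (hq : q ∈ e.source) {A : Set X} (hA : IsClosedSubmanifold (n := n) A) (hqA : q ∈ A)
    {S : Type*} [Fintype S] (y : S → X → ℝ)
    (hy : ∀ i, ContMDiffAt 𝓘(ℝ, Fin n → ℝ) 𝓘(ℝ, ℝ) ω (y i) q)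
    (hyA : ∀ i, ∀ᶠ x in 𝓝[A] q, y i x = 0)
    (hspan : ∀ v, (∀ i, fderiv ℝ (fun x => y i (e.symm x)) (e q) v = 0) →
      ∀ ξ ∈ conormal he hq A, ξ v = 0) :
    ∀ᶠ x in 𝓝 q, (∀ i, y i x = 0) → x ∈ A := by
  obtain ⟨e', he', hq', I, hI⟩ := hA.2 q hqA
  have hkill : ∀ x ∈ e'.source, x ∈ A → killCoords I (e' x) = e' x := by
    intro x hx hxA
    ext i
    rw [killCoords_apply]
    split_ifs with hi
    · exact ((hI x hx).1 hxA i hi).symm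
    · rfl
  have hkk : ∀ u, killCoords I (killCoords I u) = killCoords I u := by
    intro u; ext i; simp only [killCoords_apply]; split_ifs <;> rfl
  -- `G` joins the given equations to coordinates along `A`. Its differential is injective because
  -- the `y i` control all conormal directions. A point where the `y i` vanish has the same image as
  -- its projection to `A`, so it equals that projection.
  set G : X → (S → ℝ) × (Fin n → ℝ) := fun x => (fun i => y i x, killCoords I (e' x)) with hG
  have hya : ∀ i, AnalyticAt ℝ (fun x => y i (e.symm x)) (e q) := fun i =>
    analyticAt_comp_chart_symm he hq (hy i)
  have hea : AnalyticAt ℝ (fun x => e' (e.symm x)) (e q) :=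
    analyticAt_comp_chart_symm he hq (contMDiffAt_of_mem_maximalAtlas he' hq')
  have hka : AnalyticAt ℝ (fun x => killCoords I (e' (e.symm x))) (e q) :=
    ((killCoords I).analyticAt _).comp hea
  have hGa : AnalyticAt ℝ (fun x => G (e.symm x)) (e q) := (AnalyticAt.pi hya).prod hka
  obtain ⟨U, hU, hUinj⟩ := exists_locally_injective he hq hGa (by
    rw [injective_iff_map_eq_zero]
    intro v hv
    have h1 : HasFDerivAt (fun x => G (e.symm x))
        ((ContinuousLinearMap.pi fun i => fderiv ℝ (fun x => y i (e.symm x)) (e q)).prod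
          ((killCoords I).comp (fderiv ℝ (fun x => e' (e.symm x)) (e q)))) (e q) :=
      (hasFDerivAt_pi.2 fun i => (hya i).differentiableAt.hasFDerivAt).prodMk
        ((killCoords I).hasFDerivAt.comp (e q) hea.differentiableAt.hasFDerivAt)
    rw [h1.fderiv] at hv
    have hv1 : ∀ i, fderiv ℝ (fun x => y i (e.symm x)) (e q) v = 0 := fun i =>
      congrFun (congrArg Prod.fst hv) i
    have hv2 : killCoords I (fderiv ℝ (fun x => e' (e.symm x)) (e q) v) = 0 := congrArg Prod.snd hv
    have hv3 : fderiv ℝ (fun x => e' (e.symm x)) (e q) v = 0 := by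
      ext i
      by_cases hi : i ∈ I
      · have hc : fderiv ℝ (fun x => e' (e.symm x) i) (e q) ∈ conormal he hq A :=
          ⟨fun x => e' x i, contMDiffAt_coordinate he' hq' i, by
            filter_upwards [nhdsWithin_le_nhds (e'.open_source.mem_nhds hq'), self_mem_nhdsWithin]
              with x hx hxA
            exact (hI x hx).1 hxA i hi, rfl⟩
        have := hspan v hv1 _ hc
        have h2 := ((ContinuousLinearMap.proj (R := ℝ) (φ := fun _ : Fin n => ℝ) i).hasFDerivAt.comp
          (e q) hea.differentiableAt.hasFDerivAt).fderiv
        have h3 : fderiv ℝ (fun x => e' (e.symm x) i) (e q) =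
          (ContinuousLinearMap.proj (R := ℝ) (φ := fun _ : Fin n => ℝ) i).comp
            (fderiv ℝ (fun x => e' (e.symm x)) (e q)) := h2
        rw [h3] at this
        exact this
      · have := congrFun hv2 i
        rwa [killCoords_apply, if_neg hi] at this
    -- the change of charts is invertible
    obtain ⟨w, rfl⟩ := (mfderiv_chart_bijective he hq).2 v
    rw [← mfderiv_eq_fderiv_comp he hq (contMDiffAt_of_mem_maximalAtlas he' hq')] at hv3
    have : w = 0 := (mfderiv_chart_bijective he' hq').1 (by rw [hv3, map_zero]; rfl)
    rw [this, map_zero]; rfl)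
  have t1 : Tendsto (fun x => killCoords I (e' x)) (𝓝 q) (𝓝 (e' q)) := by
    have := ((killCoords I).continuous.tendsto (e' q)).comp (e'.continuousAt hq').tendsto
    rwa [hkill q hq' hqA] at this
  have t2 : Tendsto (fun x => e'.symm (killCoords I (e' x))) (𝓝 q) (𝓝 q) := by
    have := (e'.continuousAt_symm (e'.map_source hq')).tendsto.comp t1
    rwa [e'.left_inv hq'] at this
  have hyA' : ∀ᶠ x in 𝓝 q, ∀ i, x ∈ A → y i x = 0 :=
    eventually_all.2 fun i => eventually_nhdsWithin_iff.1 (hyA i)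
  filter_upwards [hU, t2 hU, e'.open_source.mem_nhds hq',
    t1.eventually (e'.open_target.mem_nhds (e'.map_source hq')), t2.eventually hyA']
    with x h1 h2 h3 h4 h5 h6
  have hx'A : e'.symm (killCoords I (e' x)) ∈ A := by
    refine (hI _ (e'.map_target h4)).2 fun i hi => ?_
    rw [e'.right_inv h4, killCoords_apply, if_pos hi]
  have : x = e'.symm (killCoords I (e' x)) := by
    refine hUinj x h1 _ h2 ?_
    simp only [hG]
    refine Prod.ext (funext fun i => ?_) ?_
    · dsimp only
      rw [h6 i, h5 i hx'A]
    · dsimp only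
      rw [e'.right_inv h4, hkk]
  rw [this]
  exact hx'A

variable {l : ℕ} {M : Fin l → Set X}

/-- The dual form of H2: a covector in both spaces kills both summands of `T_q X`. If `NR M q j` is
empty the supremum is zero. -/
theorem disjoint_conormal (hM : IsAdmissible (n := n) M)
    (he : e ∈ IsManifold.maximalAtlas 𝓘(ℝ, Fin n → ℝ) ω X) {q : X} (hq : q ∈ e.source) {j : Fin l}
    (hj : q ∈ M j) : Disjoint (conormal he hq (M j)) (⨆ k ∈ NR M q j, conormal he hq (M k)) := by
  rw [Submodule.disjoint_def]
  intro ξ hξ hξ'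
  by_cases hne : (NR M q j).Nonempty
  swap
  · rw [not_nonempty_iff_eq_empty] at hne
    simpa [hne] using hξ'
  have hker : ∀ v ∈ ⨅ k ∈ NR M q j, tangentTo (n := n) (M k) q,
      ξ (mfderiv 𝓘(ℝ, Fin n → ℝ) 𝓘(ℝ, Fin n → ℝ) e q v) = 0 := by
    intro v hv
    have hle : (⨆ k ∈ NR M q j, conormal he hq (M k)) ≤ LinearMap.ker
        (LinearMap.applyₗ (R := ℝ) (M := Fin n → ℝ) (M₂ := ℝ)
            (mfderiv 𝓘(ℝ, Fin n → ℝ) 𝓘(ℝ, Fin n → ℝ) e q v) ∘ₗ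
          (ContinuousLinearMap.coeLM ℝ : ((Fin n → ℝ) →L[ℝ] ℝ) →ₗ[ℝ] _)) := by
      refine iSup₂_le fun k hk η hη => ?_
      rw [LinearMap.mem_ker]
      refine conormal_apply_eq_zero he hq hη ?_
      simp only [Submodule.mem_iInf] at hv
      exact hv k hk
    exact hle hξ'
  refine ContinuousLinearMap.ext fun u => ?_
  obtain ⟨v, rfl⟩ := (mfderiv_chart_bijective he hq).2 u
  have hvt : v ∈ (⨅ k ∈ NR M q j, tangentTo (n := n) (M k) q) ⊔ tangentTo (n := n) (M j) q := by
    rw [hM.transversal j q hj hne]; trivial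
  obtain ⟨v₁, hv₁, v₂, hv₂, rfl⟩ := Submodule.mem_sup.1 hvt
  rw [map_add]
  refine (map_add ξ _ _).trans ?_
  rw [hker v₁ hv₁, conormal_apply_eq_zero he hq hξ hv₂, add_zero]
  rfl

/-- A basis of covectors adapted to the conormal spaces of the `M j` through `q` is realised by
functions vanishing on the corresponding submanifolds; these functions form a chart, and near `q`
they are local equations. -/
theorem exists_adaptedChart [IsManifold 𝓘(ℝ, Fin n → ℝ) ω X] (hM : IsAdmissible (n := n) M)
    (q : X) : ∃ φ : AdaptedChart n M, q ∈ φ.chart.source := by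
  classical
  set e := chartAt (Fin n → ℝ) q with he_def
  have he : e ∈ IsManifold.maximalAtlas 𝓘(ℝ, Fin n → ℝ) ω X := IsManifold.chart_mem_maximalAtlas q
  have hq : q ∈ e.source := mem_chart_source _ q
  let ι := {j : Fin l // q ∈ M j}
  let _ : PartialOrder ι := PartialOrder.lift (fun j : ι => M j)
    fun j k h => Subtype.ext (hM.injective h)
  obtain ⟨b, I, hspan, hmono, hdisj, hleast⟩ := exists_adapted_basis (ι := ι)
    (V := (Fin n → ℝ) →L[ℝ] ℝ) (n := n)
    (by
      rw [← LinearEquiv.finrank_eq (LinearMap.toContinuousLinearMap (𝕜 := ℝ) (E := Fin n → ℝ)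
        (F' := ℝ)), Module.finrank_linearMap]
      simp)
    (fun j => conormal he hq (M j)) (fun j k hjk => conormal_anti he hq hjk)
    (fun j => (disjoint_conormal hM he hq j.2).mono_right
      (iSup₂_le fun k hk => le_iSup₂_of_le (f := fun k (_ : k ∈ NR M q j) => conormal he hq (M k))
        (k : Fin l) ⟨k.2, hk.1, hk.2⟩ le_rfl))
  -- functions with the prescribed differentials
  have hfun : ∀ i, ∃ g : X → ℝ, ContMDiffAt 𝓘(ℝ, Fin n → ℝ) 𝓘(ℝ, ℝ) ω g q ∧
      fderiv ℝ (fun x => g (e.symm x)) (e q) = b i ∧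
      ∀ j, i ∈ I j → ∀ᶠ x in 𝓝[M j] q, g x = 0 := by
    intro i
    by_cases hi : ∃ j, i ∈ I j
    -- The function is taken to vanish on the largest submanifold whose conormal space uses this
    -- covector, so it vanishes on all the others at once.
    · obtain ⟨k, hk, hkj⟩ := hleast i hi
      have : b i ∈ conormal he hq (M k) := by
        rw [← hspan k]
        exact Submodule.subset_span ⟨i, hk, rfl⟩
      obtain ⟨g, hg, hgM, hgb⟩ := this
      exact ⟨g, hg, hgb, fun j hj => hgM.filter_mono (nhdsWithin_mono q (hkj j hj))⟩
    · refine ⟨fun x => b i (e x), ?_, ?_, fun j hj => absurd ⟨j, hj⟩ hi⟩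
      · have h1 : ContMDiffAt 𝓘(ℝ, Fin n → ℝ) 𝓘(ℝ, ℝ) ω (b i) (e q) :=
          (b i).contDiff.contDiffAt.contMDiffAt
        exact h1.comp q (contMDiffAt_of_mem_maximalAtlas he hq)
      · have : (fun x => b i (e (e.symm x))) =ᶠ[𝓝 (e q)] b i := by
          filter_upwards [e.open_target.mem_nhds (e.map_source hq)] with x hx
          rw [e.right_inv hx]
        rw [this.fderiv_eq, ContinuousLinearMap.fderiv]
  choose g hg hgb hgM using hfun
  have hloc : ∀ j : ι, ∀ᶠ x in 𝓝 q, x ∈ M j ↔ ∀ i ∈ I j, g i x = 0 := by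
    intro j
    have h1 := eventually_mem_of_equations he hq (hM.submanifold j) j.2 (S := I j)
      (fun i => g i) (fun i => hg i) (fun i => hgM i j i.2) (by
        intro v hv ξ hξ
        rw [← hspan j] at hξ
        have : Submodule.span ℝ (b '' I j) ≤ LinearMap.ker
          (LinearMap.applyₗ v ∘ₗ (ContinuousLinearMap.coeLM ℝ : ((Fin n → ℝ) →L[ℝ] ℝ) →ₗ[ℝ] _)) := by
          rw [Submodule.span_le]
          rintro _ ⟨i, hi, rfl⟩
          have := hv ⟨i, hi⟩
          rw [hgb] at this
          exact this
        exact this hξ)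
    have h2 : ∀ᶠ x in 𝓝 q, ∀ i ∈ I j, x ∈ M j → g i x = 0 :=
      (Finset.eventually_all _).2 fun i hi => eventually_nhdsWithin_iff.1 (hgM i j hi)
    filter_upwards [h1, h2] with x h1 h2
    exact ⟨fun hx i hi => h2 i hi hx, fun h => h1 fun i => h i i.2⟩
  have havoid : ∀ᶠ x in 𝓝 q, ∀ j, q ∉ M j → x ∉ M j := by
    refine eventually_all.2 fun j => ?_
    by_cases hj : q ∈ M j
    · exact Eventually.of_forall fun x h => absurd hj h
    · filter_upwards [(hM.submanifold j).1.isOpen_compl.mem_nhds hj] with x hx _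
      exact hx
  have hga : ∀ i, AnalyticAt ℝ (fun x => g i (e.symm x)) (e q) := fun i =>
    analyticAt_comp_chart_symm he hq (hg i)
  obtain ⟨e', he', hq', hsub, hval⟩ := exists_chart_of_injective he hq (g := fun x i => g i x)
    (AnalyticAt.pi hga) (by
      rw [injective_iff_map_eq_zero]
      intro v hv
      have h1 : HasFDerivAt (fun x => (fun i => g i (e.symm x) : Fin n → ℝ))
          (ContinuousLinearMap.pi fun i => fderiv ℝ (fun x => g i (e.symm x)) (e q)) (e q) :=
        hasFDerivAt_pi.2 fun i => (hga i).differentiableAt.hasFDerivAt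
      rw [h1.fderiv] at hv
      have hbv : ∀ i, b i v = 0 := fun i => by
        rw [← hgb]
        exact congrFun hv i
      ext i
      have hall : ∀ ξ : (Fin n → ℝ) →L[ℝ] ℝ, ξ v = 0 := by
        intro ξ
        rw [← b.sum_repr ξ, sum_apply]
        exact Finset.sum_eq_zero fun i _ => by simp [hbv]
      exact hall (ContinuousLinearMap.proj i))
    (U := {x | (∀ j : ι, x ∈ M j ↔ ∀ i ∈ I j, g i x = 0) ∧ ∀ j, q ∉ M j → x ∉ M j})
    ((eventually_all.2 hloc).and havoid)
  have hmeet : ∀ j, (M j ∩ e'.source).Nonempty ↔ q ∈ M j := fun j =>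
    ⟨fun ⟨x, hx, hxs⟩ => by_contra fun hj => (hsub hxs).2 j hj hx, fun hj => ⟨q, hj, hq'⟩⟩
  refine ⟨⟨e', he', fun j => if h : q ∈ M j then I ⟨j, h⟩ else ∅, ?_, ?_, ?_⟩, hq'⟩
  · intro j hj x hx
    have hj' := (hmeet j).1 hj
    rw [dif_pos hj', (hsub hx).1 ⟨j, hj'⟩]
    simp only [hval x hx]
  · intro j hj
    rw [dif_neg fun h => hj ((hmeet j).2 h)]
  · intro j k
    by_cases hj : q ∈ M j
    swap
    · simp [dif_neg hj]
    by_cases hk : q ∈ M k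
    swap
    · simp [dif_neg hk]
    rw [dif_pos hj, dif_pos hk]
    by_cases hjk : M j ⊆ M k
    · exact Or.inr (Or.inl (hmono ⟨j, hj⟩ ⟨k, hk⟩ hjk))
    by_cases hkj : M k ⊆ M j
    · exact Or.inl (hmono ⟨k, hk⟩ ⟨j, hj⟩ hkj)
    exact Or.inr (Or.inr (hdisj ⟨j, hj⟩ ⟨k, hk⟩ hjk hkj))

end Existence

/-! ### Lifts of maps to the multi-normal deformations -/

section Models

variable {n l : ℕ} {X : Type*} [TopologicalSpace X] [ChartedSpace (Fin n → ℝ) X]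
  {M : Fin l → Set X}

namespace AdaptedChart

variable (φ : AdaptedChart n M)

theorem weight_ne_zero {t : Fin l → ℝ} (ht : ∀ j, t j ≠ 0) (i : Fin n) : φ.weight t i ≠ 0 :=
  Finset.prod_ne_zero_iff.2 fun j _ => ht j

theorem continuous_weight (i : Fin n) : Continuous fun t => φ.weight t i := by
  unfold weight; fun_prop

theorem analyticAt_scale (z : (Fin n → ℝ) × (Fin l → ℝ)) : AnalyticAt ℝ φ.scale z := by
  refine AnalyticAt.pi fun i => AnalyticAt.mul ?_ ?_
  · refine Finset.analyticAt_fun_prod _ fun j _ => ?_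
    exact ((ContinuousLinearMap.proj (R := ℝ) (φ := fun _ : Fin l => ℝ) j).comp
      (ContinuousLinearMap.snd ℝ (Fin n → ℝ) (Fin l → ℝ))).analyticAt z
  · exact ((ContinuousLinearMap.proj (R := ℝ) (φ := fun _ : Fin n => ℝ) i).comp
      (ContinuousLinearMap.fst ℝ (Fin n → ℝ) (Fin l → ℝ))).analyticAt z

theorem continuous_scale : Continuous φ.scale :=
  continuous_iff_continuousAt.2 fun z => (φ.analyticAt_scale z).continuousAt

theorem isOpen_model : IsOpen φ.model := by
  refine (φ.chart.open_target.preimage φ.continuous_scale).inter ?_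
  have : {z : (Fin n → ℝ) × (Fin l → ℝ) |
      ∀ j, ¬ (M j ∩ φ.chart.source).Nonempty → z.2 j ≠ 0} =
      ⋂ j, ⋂ (_ : ¬ (M j ∩ φ.chart.source).Nonempty), {z | z.2 j ≠ 0} := by
    ext z; simp
  change IsOpen {z : (Fin n → ℝ) × (Fin l → ℝ) |
      ∀ j, ¬ (M j ∩ φ.chart.source).Nonempty → z.2 j ≠ 0}
  rw [this]
  refine isOpen_iInter_of_finite fun j => isOpen_iInter_of_finite fun _ => ?_
  exact isOpen_ne_fun (by fun_prop) continuous_const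

variable {φ} {z : (Fin n → ℝ) × (Fin l → ℝ)}

theorem toBase_mem_source (hz : z ∈ φ.model) : φ.toBase z ∈ φ.chart.source :=
  φ.chart.map_target hz.1

theorem chart_toBase (hz : z ∈ φ.model) : φ.chart (φ.toBase z) = φ.scale z :=
  φ.chart.right_inv hz.1

theorem continuousAt_toBase (hz : z ∈ φ.model) : ContinuousAt φ.toBase z :=
  ContinuousAt.comp (f := φ.scale) (φ.chart.continuousAt_symm hz.1) φ.continuous_scale.continuousAt

/-- Scaling by `t_j = 0` kills the coordinates in `I_j`. The nonvanishing condition in the model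
ensures that `M_j` meets the domain, so that these coordinates are its equations. -/
theorem toBase_mem_of_param_eq_zero (hz : z ∈ φ.model) {j : Fin l} (hj : z.2 j = 0) :
    φ.toBase z ∈ M j := by
  have hmeet : (M j ∩ φ.chart.source).Nonempty := by
    by_contra h
    exact hz.2 j h hj
  refine (φ.mem_iff j hmeet _ (toBase_mem_source hz)).2 fun i hi => ?_
  rw [chart_toBase hz, scale, weight, Finset.prod_eq_zero (φ.mem_J.2 hi) hj, zero_mul]

end AdaptedChart

end Models

/-! ### Lifts of maps to the local models -/

section Lifts

variable {n m r l : ℕ} {X Y Z : Type*} [TopologicalSpace X] [ChartedSpace (Fin n → ℝ) X]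
  [TopologicalSpace Y] [ChartedSpace (Fin m → ℝ) Y] [TopologicalSpace Z]
  [ChartedSpace (Fin r → ℝ) Z] {M : Fin l → Set X} {N : Fin l → Set Y} {R : Fin l → Set Z}

/-- `y` is the value at `z` of the extension by continuity of the map `f` in the local models. -/
def IsLift (f : X → Y) (φ : AdaptedChart n M) (ψ : AdaptedChart m N)
    (z : (Fin n → ℝ) × (Fin l → ℝ)) (y : Fin m → ℝ) : Prop :=
  Tendsto (fun (w : (Fin n → ℝ) × (Fin l → ℝ)) (k : Fin m) =>
    ψ.chart (f (φ.toBase w)) k / ψ.weight w.2 k) (𝓝[{w | ∀ j, w.2 j ≠ 0}] z) (𝓝 y)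

variable {f : X → Y} {φ : AdaptedChart n M} {ψ : AdaptedChart m N} {χ : AdaptedChart r R}
  {z : (Fin n → ℝ) × (Fin l → ℝ)} {y : Fin m → ℝ}

/-- For `j ∈ J_k`, the `k`-th coordinate of `f` vanishes where `t_j = 0`, since `f` sends `M_j` into
`N_j`; division by the product of these `t_j` gives `G`. -/
theorem exists_analytic_lift (hf : ContMDiff 𝓘(ℝ, Fin n → ℝ) 𝓘(ℝ, Fin m → ℝ) ω f)
    (hMN : ∀ j, MapsTo f (M j) (N j)) (hz : z ∈ φ.model) (hψ : f (φ.toBase z) ∈ ψ.chart.source) :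
    ∃ G : (Fin n → ℝ) × (Fin l → ℝ) → (Fin m → ℝ), AnalyticAt ℝ G z ∧
      ∀ᶠ w in 𝓝 z, ∀ k, ψ.chart (f (φ.toBase w)) k = ψ.weight w.2 k * G w k := by
  have hcont : ContinuousAt (fun w => f (φ.toBase w)) z :=
    (hf.continuous.continuousAt).comp (φ.continuousAt_toBase hz)
  have hnear : ∀ᶠ w in 𝓝 z, w ∈ φ.model ∧ f (φ.toBase w) ∈ ψ.chart.source :=
    Filter.Eventually.and (φ.isOpen_model.mem_nhds hz)
      (hcont.preimage_mem_nhds (ψ.chart.open_source.mem_nhds hψ))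
  have han : AnalyticAt ℝ (fun w => ψ.chart (f (φ.toBase w))) z := by
    have h1 := analyticAt_coordinate_change φ.mem_atlas (φ.toBase_mem_source hz) ψ.mem_atlas
      hf.contMDiffAt hψ
    rw [φ.chart_toBase hz] at h1
    exact h1.comp (φ.analyticAt_scale z)
  have hk : ∀ k, ∃ G : (Fin n → ℝ) × (Fin l → ℝ) → ℝ, AnalyticAt ℝ G z ∧
      ∀ᶠ w in 𝓝 z, ψ.chart (f (φ.toBase w)) k = (∏ j ∈ ψ.J k, w.2 j) * G w := by
    intro k
    refine exists_analyticAt_prod_mul (ψ.J k) (analyticAt_pi_iff.1 han k) fun j hj => ?_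
    filter_upwards [hnear] with w hw hwj
    have h1 := hMN j (φ.toBase_mem_of_param_eq_zero hw.1 hwj)
    exact (ψ.mem_iff_of_mem hw.2 h1 hw.2).1 h1 k (ψ.mem_J.1 hj)
  choose G hG hGe using hk
  exact ⟨fun w k => G k w, AnalyticAt.pi hG, eventually_all.2 hGe⟩

theorem isLift_of_eventually {G : (Fin n → ℝ) × (Fin l → ℝ) → (Fin m → ℝ)}
    (hG : ContinuousAt G z)
    (h : ∀ᶠ w in 𝓝 z, ∀ k, ψ.chart (f (φ.toBase w)) k = ψ.weight w.2 k * G w k) :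
    IsLift f φ ψ z (G z) := by
  refine (hG.tendsto.mono_left nhdsWithin_le_nhds).congr' ?_
  filter_upwards [nhdsWithin_le_nhds h, self_mem_nhdsWithin] with w hw hw0
  ext k
  rw [hw k, mul_div_cancel_left₀ _ (ψ.weight_ne_zero hw0 k)]

theorem IsLift.unique {y' : Fin m → ℝ} (h : IsLift f φ ψ z y) (h' : IsLift f φ ψ z y') : y = y' :=
  tendsto_nhds_unique h h'

theorem IsLift.scale_eq (h : IsLift f φ ψ z y) (hf : Continuous f) (hz : z ∈ φ.model)
    (hψ : f (φ.toBase z) ∈ ψ.chart.source) : ψ.scale (y, z.2) = ψ.chart (f (φ.toBase z)) := by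
  have hcont : ContinuousAt (fun w => ψ.chart (f (φ.toBase w))) z :=
    ContinuousAt.comp (f := fun w => f (φ.toBase w)) (ψ.chart.continuousAt hψ)
      (hf.continuousAt.comp (φ.continuousAt_toBase hz))
  ext k
  have h1 : Tendsto (fun w : (Fin n → ℝ) × (Fin l → ℝ) =>
      ψ.weight w.2 k * (ψ.chart (f (φ.toBase w)) k / ψ.weight w.2 k))
      (𝓝[{w | ∀ j, w.2 j ≠ 0}] z) (𝓝 (ψ.weight z.2 k * y k)) :=
    ((((ψ.continuous_weight k).comp continuous_snd).tendsto z).mono_left nhdsWithin_le_nhds).mul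
      (tendsto_pi_nhds.1 h k)
  have h2 : Tendsto (fun w => ψ.chart (f (φ.toBase w)) k) (𝓝[{w | ∀ j, w.2 j ≠ 0}] z)
      (𝓝 (ψ.chart (f (φ.toBase z)) k)) :=
    (tendsto_pi_nhds.1 hcont.tendsto k).mono_left nhdsWithin_le_nhds
  refine tendsto_nhds_unique h1 (h2.congr' ?_)
  filter_upwards [self_mem_nhdsWithin] with w hw
  rw [mul_div_cancel₀ _ (ψ.weight_ne_zero hw k)]

theorem IsLift.comp {g : Y → Z} {u : Fin r → ℝ} (h : IsLift f φ ψ z y)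
    (h' : IsLift g ψ χ (y, z.2) u) (hf : Continuous f) (hz : z ∈ φ.model)
    (hψ : f (φ.toBase z) ∈ ψ.chart.source) : IsLift (g ∘ f) φ χ z u := by
  have hcont : ContinuousAt (fun w => f (φ.toBase w)) z :=
    (hf.continuousAt).comp (φ.continuousAt_toBase hz)
  have t : Tendsto (fun w : (Fin n → ℝ) × (Fin l → ℝ) =>
      ((fun k => ψ.chart (f (φ.toBase w)) k / ψ.weight w.2 k, w.2) : (Fin m → ℝ) × (Fin l → ℝ)))
      (𝓝[{w | ∀ j, w.2 j ≠ 0}] z) (𝓝[{w | ∀ j, w.2 j ≠ 0}] (y, z.2)) := by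
    refine tendsto_nhdsWithin_iff.2 ⟨h.prodMk_nhds
      ((continuous_snd.tendsto z).mono_left nhdsWithin_le_nhds), ?_⟩
    filter_upwards [self_mem_nhdsWithin] with w hw
    exact hw
  refine (Tendsto.comp h' t).congr' ?_
  filter_upwards [self_mem_nhdsWithin, nhdsWithin_le_nhds
    (hcont.preimage_mem_nhds (ψ.chart.open_source.mem_nhds hψ))] with w hw hws
  have : ψ.toBase (fun k => ψ.chart (f (φ.toBase w)) k / ψ.weight w.2 k, w.2) =
      f (φ.toBase w) := by
    have hs : ψ.scale (fun k => ψ.chart (f (φ.toBase w)) k / ψ.weight w.2 k, w.2) =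
        ψ.chart (f (φ.toBase w)) := by
      ext k
      exact mul_div_cancel₀ _ (ψ.weight_ne_zero hw k)
    rw [AdaptedChart.toBase, hs, ψ.chart.left_inv hws]
  ext k
  simp only [Function.comp_apply, this]

/-- The point `b` of a local model of `Ỹ` is the image of the point `a` of a local model of `X̃`
under the extension of `f`. -/
structure LiftsTo (f : X → Y) (a : Σ φ : AdaptedChart n M, φ.model)
    (b : Σ ψ : AdaptedChart m N, ψ.model) : Prop where
  param_eq : b.2.1.2 = a.2.1.2
  toBase_eq : b.1.toBase b.2.1 = f (a.1.toBase a.2.1)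
  isLift : IsLift f a.1 b.1 a.2.1 b.2.1.1

variable {a : Σ φ : AdaptedChart n M, φ.model} {b : Σ ψ : AdaptedChart m N, ψ.model}
  {c : Σ χ : AdaptedChart r R, χ.model}

theorem LiftsTo.mem_source (h : LiftsTo f a b) : f (a.1.toBase a.2.1) ∈ b.1.chart.source :=
  h.toBase_eq ▸ b.1.toBase_mem_source b.2.2

theorem IsLift.mem_model (h : IsLift f φ ψ z y) (hf : Continuous f)
    (hMN : ∀ j, MapsTo f (M j) (N j)) (hz : z ∈ φ.model)
    (hψ : f (φ.toBase z) ∈ ψ.chart.source) : (y, z.2) ∈ ψ.model := by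
  -- If `t_j = 0`, the image of the base point lies in `N_j` and in the domain of `ψ`, so `N_j`
  -- meets that domain.
  refine ⟨?_, fun j hj h0 => hj ⟨_, hMN j (φ.toBase_mem_of_param_eq_zero hz h0), hψ⟩⟩
  rw [h.scale_eq hf hz hψ]
  exact ψ.chart.map_source hψ

theorem IsLift.liftsTo (h : IsLift f φ ψ z y) (hf : Continuous f)
    (hz : z ∈ φ.model) (hψ : f (φ.toBase z) ∈ ψ.chart.source) (hy : (y, z.2) ∈ ψ.model) :
    LiftsTo f ⟨φ, z, hz⟩ ⟨ψ, (y, z.2), hy⟩ := by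
  refine ⟨rfl, ?_, h⟩
  change ψ.chart.symm (ψ.scale (y, z.2)) = _
  rw [h.scale_eq hf hz hψ, ψ.chart.left_inv hψ]

theorem LiftsTo.exists (hf : ContMDiff 𝓘(ℝ, Fin n → ℝ) 𝓘(ℝ, Fin m → ℝ) ω f)
    (hMN : ∀ j, MapsTo f (M j) (N j)) (hψ : f (a.1.toBase a.2.1) ∈ ψ.chart.source) :
    ∃ y : ψ.model, LiftsTo f a ⟨ψ, y⟩ := by
  obtain ⟨G, hG, hGe⟩ := exists_analytic_lift hf hMN a.2.2 hψ
  have h := isLift_of_eventually hG.continuousAt hGe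
  exact ⟨⟨_, h.mem_model hf.continuous hMN a.2.2 hψ⟩, h.liftsTo hf.continuous a.2.2 hψ _⟩

theorem LiftsTo.unique {y y' : ψ.model} (h : LiftsTo f a ⟨ψ, y⟩) (h' : LiftsTo f a ⟨ψ, y'⟩) :
    y = y' :=
  Subtype.ext (Prod.ext (h.isLift.unique h'.isLift) (h.param_eq.trans h'.param_eq.symm))

theorem LiftsTo.comp {g : Y → Z} (h : LiftsTo f a b) (h' : LiftsTo g b c) (hf : Continuous f) :
    LiftsTo (g ∘ f) a c := by
  refine ⟨h'.param_eq.trans h.param_eq, ?_, ?_⟩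
  · rw [h'.toBase_eq, h.toBase_eq]; rfl
  · refine h.isLift.comp ?_ hf a.2.2 h.mem_source
    have := h'.isLift
    rwa [show b.2.1 = (b.2.1.1, a.2.1.2) from Prod.ext rfl h.param_eq] at this

end Lifts

/-! ### Gluing as lifting of the identity -/

section Gluing

variable {n m l : ℕ} {X Y : Type*} [TopologicalSpace X] [ChartedSpace (Fin n → ℝ) X]
  [TopologicalSpace Y] [ChartedSpace (Fin m → ℝ) Y] {M : Fin l → Set X} {N : Fin l → Set Y}
  {a b : Σ φ : AdaptedChart n M, φ.model}

theorem glue_iff_liftsTo : Glue M a b ↔ LiftsTo id a b :=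
  ⟨fun h => ⟨h.1.symm, h.2.1.symm, h.2.2⟩, fun h => ⟨h.1.symm, h.2.symm, h.3⟩⟩

/-- Lifting the identity from `d` to the chart of `d'` and composing gives a second lift of `c` in
that chart; uniqueness of lifts identifies it with `d'`. -/
theorem LiftsTo.glue {f : X → Y} (hf : Continuous f)
    {c : Σ φ : AdaptedChart n M, φ.model} {d d' : Σ ψ : AdaptedChart m N, ψ.model}
    (h : LiftsTo f c d) (h' : LiftsTo f c d') : Glue N d d' := by
  obtain ⟨y, hy⟩ := LiftsTo.exists (f := (id : Y → Y)) (a := d) (ψ := d'.1) contMDiff_id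
    (fun j => mapsTo_id (N j)) (by
      rw [id, h.toBase_eq, ← h'.toBase_eq]; exact d'.1.toBase_mem_source d'.2.2)
  have : y = d'.2 := LiftsTo.unique (h.comp hy hf) h'
  rw [glue_iff_liftsTo]
  rw [this] at hy
  exact hy

theorem LiftsTo.refl (a : Σ φ : AdaptedChart n M, φ.model) : LiftsTo id a a := by
  refine ⟨rfl, rfl, ?_⟩
  refine isLift_of_eventually (G := Prod.fst) continuous_fst.continuousAt ?_
  filter_upwards [a.1.isOpen_model.mem_nhds a.2.2] with w hw k
  rw [id, a.1.chart_toBase hw]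
  rfl

theorem LiftsTo.symm (h : LiftsTo id a b) : LiftsTo id b a :=
  glue_iff_liftsTo.1 (h.glue continuous_id (LiftsTo.refl a))

theorem glue_equivalence : Equivalence (Glue (n := n) M) where
  refl a := glue_iff_liftsTo.2 (LiftsTo.refl a)
  symm h := glue_iff_liftsTo.2 (glue_iff_liftsTo.1 h).symm
  trans h h' := glue_iff_liftsTo.2
    ((glue_iff_liftsTo.1 h).comp (glue_iff_liftsTo.1 h') continuous_id)

/-- `Glue` is already an equivalence relation, so equality in the quotient requires no chain of
gluings. -/
theorem Deformation.mk_eq_iff {φ ψ : AdaptedChart n M} {z : φ.model} {w : ψ.model} :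
    Deformation.mk φ z = Deformation.mk ψ w ↔ LiftsTo id ⟨φ, z⟩ ⟨ψ, w⟩ := by
  rw [← glue_iff_liftsTo]
  exact Quot.eq.trans glue_equivalence.eqvGen_iff

end Gluing

/-! ### Existence and uniqueness of the extension -/

section Extension

variable {n m l : ℕ} {X Y : Type*} [TopologicalSpace X] [ChartedSpace (Fin n → ℝ) X]
  [TopologicalSpace Y] [ChartedSpace (Fin m → ℝ) Y] {M : Fin l → Set X} {N : Fin l → Set Y}
  {f : X → Y}

/-- Any choice of local lifts descends to the quotient, because lifts of glued points are glued. -/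
theorem exists_extension [IsManifold 𝓘(ℝ, Fin m → ℝ) ω Y] (hN : IsAdmissible (n := m) N)
    (hf : ContMDiff 𝓘(ℝ, Fin n → ℝ) 𝓘(ℝ, Fin m → ℝ) ω f) (hMN : ∀ j, MapsTo f (M j) (N j)) :
    ∃ F : Deformation n M → Deformation m N,
      ∀ a b, LiftsTo f a b → F (Deformation.mk a.1 a.2) = Deformation.mk b.1 b.2 := by
  have h1 : ∀ a : Σ φ : AdaptedChart n M, φ.model, ∃ b : Σ ψ : AdaptedChart m N, ψ.model,
      LiftsTo f a b := by
    intro a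
    obtain ⟨ψ, hψ⟩ := exists_adaptedChart hN (f (a.1.toBase a.2.1))
    obtain ⟨y, hy⟩ := LiftsTo.exists hf hMN hψ
    exact ⟨⟨ψ, y⟩, hy⟩
  choose B hB using h1
  refine ⟨Quot.lift (fun a => Deformation.mk (B a).1 (B a).2) fun a a' h => ?_, fun a b h => ?_⟩
  · exact Quot.sound ((hB a).glue hf.continuous
      ((glue_iff_liftsTo.1 h).comp (hB a') continuous_id))
  · exact Quot.sound ((hB a).glue hf.continuous h)

theorem isExtension_of_liftsTo [IsManifold 𝓘(ℝ, Fin m → ℝ) ω Y] (hN : IsAdmissible (n := m) N)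
    (hf : ContMDiff 𝓘(ℝ, Fin n → ℝ) 𝓘(ℝ, Fin m → ℝ) ω f) (hMN : ∀ j, MapsTo f (M j) (N j))
    {F : Deformation n M → Deformation m N}
    (hF : ∀ a b, LiftsTo f a b → F (Deformation.mk a.1 a.2) = Deformation.mk b.1 b.2) :
    IsExtension f F := by
  constructor
  · intro φ z
    obtain ⟨ψ, hψ⟩ := exists_adaptedChart hN (f (φ.toBase z.1))
    obtain ⟨G, hG, hGe⟩ := exists_analytic_lift hf hMN z.2 hψ
    refine ⟨ψ, fun w => (G w, w.2), hG.prod analyticAt_snd, ?_⟩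
    have hcont : ContinuousAt (fun w => f (φ.toBase w)) z.1 :=
      (hf.continuous.continuousAt).comp (φ.continuousAt_toBase z.2)
    have t : Tendsto (Subtype.val : φ.model → _) (𝓝 z) (𝓝 z.1) := continuous_subtype_val.tendsto z
    filter_upwards [t.eventually (eventually_eventually_nhds.2 hGe),
      t.eventually hG.eventually_continuousAt,
      t.eventually (hcont.preimage_mem_nhds (ψ.chart.open_source.mem_nhds hψ))] with w h1 h2 h3
    have h := isLift_of_eventually h2 h1
    have hy := h.mem_model hf.continuous hMN w.2 h3
    exact ⟨hy, hF _ _ (h.liftsTo hf.continuous w.2 h3 hy)⟩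
  · intro z _
    induction z using Quot.ind with
    | mk a =>
    obtain ⟨ψ, hψ⟩ := exists_adaptedChart hN (f (a.1.toBase a.2.1))
    obtain ⟨y, hy⟩ := LiftsTo.exists hf hMN hψ
    have h : F (Quot.mk _ a) = Deformation.mk ψ y := hF _ _ hy
    rw [h]
    exact ⟨hy.toBase_eq, hy.param_eq⟩

/-- In local models an extension is analytic, and where no `t_j` vanishes it is forced to be the
quotient formula; continuity then makes its value at every point the lift. -/
theorem IsExtension.eq_mk [T2Space Y] (hf : ContMDiff 𝓘(ℝ, Fin n → ℝ) 𝓘(ℝ, Fin m → ℝ) ω f)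
    {F : Deformation n M → Deformation m N} (hF : IsExtension f F)
    (a : Σ φ : AdaptedChart n M, φ.model) :
    ∃ b, LiftsTo f a b ∧ F (Deformation.mk a.1 a.2) = Deformation.mk b.1 b.2 := by
  obtain ⟨φ, z⟩ := a
  obtain ⟨ψ, G, hG, hGe⟩ := hF.1 φ z
  obtain ⟨hzm, hFz⟩ := hGe.self_of_nhds
  -- the eventual equalities in the ambient space of the model
  have hev : ∀ᶠ w in 𝓝 z.1, ∀ hw : w ∈ φ.model, ∃ h : G w ∈ ψ.model,
      F (Deformation.mk φ ⟨w, hw⟩) = Deformation.mk ψ ⟨G w, h⟩ := by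
    rw [nhds_subtype_eq_comap, eventually_comap] at hGe
    filter_upwards [hGe] with w hw hwm
    exact hw ⟨w, hwm⟩ rfl
  have hmod : ∀ᶠ w in 𝓝 z.1, w ∈ φ.model := φ.isOpen_model.mem_nhds z.2
  have hpt : ∀ᶠ w in 𝓝[{w | ∀ j, w.2 j ≠ 0}] z.1,
      G w ∈ ψ.model ∧ ψ.toBase (G w) = f (φ.toBase w) ∧ (G w).2 = w.2 := by
    filter_upwards [nhdsWithin_le_nhds hev, nhdsWithin_le_nhds hmod, self_mem_nhdsWithin]
      with w h1 h2 h3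
    obtain ⟨h4, h5⟩ := h1 h2
    have h6 := hF.2 (Deformation.mk φ ⟨w, h2⟩) h3
    rw [h5] at h6
    exact ⟨h4, h6.1, h6.2⟩
  have hbase : ψ.toBase (G z.1) = f (φ.toBase z.1) := by
    have t1 : Tendsto (fun w => ψ.toBase (G w)) (𝓝[{w | ∀ j, w.2 j ≠ 0}] z.1)
        (𝓝 (ψ.toBase (G z.1))) :=
      ((ψ.continuousAt_toBase hzm).comp hG.continuousAt).tendsto.mono_left nhdsWithin_le_nhds
    have t2 : Tendsto (fun w => f (φ.toBase w)) (𝓝[{w | ∀ j, w.2 j ≠ 0}] z.1)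
        (𝓝 (f (φ.toBase z.1))) :=
      ((hf.continuous.continuousAt).comp (φ.continuousAt_toBase z.2)).tendsto.mono_left
        nhdsWithin_le_nhds
    exact tendsto_nhds_unique t1 (t2.congr' (hpt.mono fun w hw => hw.2.1.symm))
  have hparam : (G z.1).2 = z.1.2 := by
    have t1 : Tendsto (fun w => (G w).2) (𝓝[{w | ∀ j, w.2 j ≠ 0}] z.1) (𝓝 (G z.1).2) :=
      (continuous_snd.continuousAt.comp hG.continuousAt).tendsto.mono_left nhdsWithin_le_nhds
    have t2 : Tendsto (fun w : (Fin n → ℝ) × (Fin l → ℝ) => w.2)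
        (𝓝[{w | ∀ j, w.2 j ≠ 0}] z.1) (𝓝 z.1.2) :=
      (continuous_snd.tendsto _).mono_left nhdsWithin_le_nhds
    exact tendsto_nhds_unique t1 (t2.congr' (hpt.mono fun w hw => hw.2.2.symm))
  refine ⟨⟨ψ, G z.1, hzm⟩, ⟨hparam, hbase, ?_⟩, hFz⟩
  have t1 : Tendsto (fun w => (G w).1) (𝓝[{w | ∀ j, w.2 j ≠ 0}] z.1) (𝓝 (G z.1).1) :=
    (continuous_fst.continuousAt.comp hG.continuousAt).tendsto.mono_left nhdsWithin_le_nhds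
  refine t1.congr' ?_
  filter_upwards [hpt, self_mem_nhdsWithin] with w hw hw0
  ext k
  rw [← hw.2.1, ψ.chart_toBase hw.1, AdaptedChart.scale, hw.2.2,
    mul_div_cancel_left₀ _ (ψ.weight_ne_zero hw0 k)]

end Extension

/-! ### Lifts on the zero section -/

section ZeroSectionLifts

variable {n m l : ℕ} {X Y : Type*} [TopologicalSpace X] [ChartedSpace (Fin n → ℝ) X]
  [TopologicalSpace Y] [ChartedSpace (Fin m → ℝ) Y] {M : Fin l → Set X} {N : Fin l → Set Y}
  {f : X → Y} {φ : AdaptedChart n M} {ψ : AdaptedChart m N}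

theorem AdaptedChart.scale_of_param_eq_zero {z : (Fin n → ℝ) × (Fin l → ℝ)} (hz : z.2 = 0)
    (i : Fin n) : φ.scale z i = if φ.J i = ∅ then z.1 i else 0 := by
  rw [scale, weight, hz]
  split_ifs with h
  · simp [h]
  · obtain ⟨j, hj⟩ := Finset.nonempty_iff_ne_empty.2 h
    rw [Finset.prod_eq_zero hj rfl, zero_mul]

open Classical in
-- Fixing `x` and letting `t` tend to zero, the lift is the factor left after division by `∏ j ∈ ψ.J
-- k, t_j`, which `value_eq_sum_taylor` evaluates.
theorem exists_series_lift_eq (hf : ContMDiff 𝓘(ℝ, Fin n → ℝ) 𝓘(ℝ, Fin m → ℝ) ω f)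
    (hMN : ∀ j, MapsTo f (M j) (N j)) {z : φ.model} {y : ψ.model}
    (h : LiftsTo f ⟨φ, z⟩ ⟨ψ, y⟩) (hz : z.1.2 = 0) (k : Fin m) :
    ∃ p : FormalMultilinearSeries ℝ (Fin n → ℝ) ℝ,
      HasFPowerSeriesAt (fun x => ψ.chart (f (φ.chart.symm x)) k) p (φ.chart (φ.toBase z.1)) ∧
      y.1.1 k = ∑ r ∈ Finset.range ((ψ.J k).card + 1),
        ∑ i : Fin r → Fin n with IsPartition φ.J (ψ.J k) i,
          p r (fun a => Pi.single (i a) 1) * ∏ a, z.1.1 (i a) := by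
  have han := analyticAt_pi_iff.1 (analyticAt_coordinate_change φ.mem_atlas
    (φ.toBase_mem_source z.2) ψ.mem_atlas hf.contMDiffAt h.mem_source) k
  obtain ⟨p, hp⟩ := han
  refine ⟨p, hp, ?_⟩
  obtain ⟨G, hG, hGe⟩ := exists_analytic_lift hf hMN z.2 h.mem_source
  have hy : y.1.1 = G z.1 := h.isLift.unique (isLift_of_eventually hG.continuousAt hGe)
  have hz' : z.1 = (z.1.1, 0) := Prod.ext rfl hz
  have t : Continuous fun t : Fin l → ℝ => ((z.1.1, t) : (Fin n → ℝ) × (Fin l → ℝ)) := by fun_prop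
  have t0 : Tendsto (fun t : Fin l → ℝ => ((z.1.1, t) : (Fin n → ℝ) × (Fin l → ℝ))) (𝓝 0)
      (𝓝 z.1) := by
    have := t.tendsto 0
    rwa [← hz'] at this
  have key := value_eq_sum_taylor hp φ.J (ψ.J k) z.1.1 (fun i => by
      rw [φ.chart_toBase z.2, φ.scale_of_param_eq_zero hz]) (G := fun t => G (z.1.1, t) k) (by
      have h1 : ContinuousAt (fun w => G w k) z.1 := (continuous_apply k).continuousAt.comp
        hG.continuousAt
      exact ContinuousAt.comp_of_eq h1 t.continuousAt hz'.symm) (by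
      filter_upwards [t0.eventually hGe] with t ht
      exact ht k)
  rw [hy, ← key, ← hz']

theorem lift_eq_sum_mixedPartial (hf : ContMDiff 𝓘(ℝ, Fin n → ℝ) 𝓘(ℝ, Fin m → ℝ) ω f)
    (hMN : ∀ j, MapsTo f (M j) (N j)) {z : φ.model} {y : ψ.model}
    (h : LiftsTo f ⟨φ, z⟩ ⟨ψ, y⟩) (hz : z.1.2 = 0) (k : Fin m) {P : ℕ} (S : Fin P → Finset (Fin n))
    (h1 : ∀ r (i : Fin r → Fin n), IsPartition φ.J (ψ.J k) i →
      ∃ e : Fin P ≃ Fin r, ∀ b, i (e b) ∈ S b)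
    (h2 : ∀ i ∈ Fintype.piFinset S, IsPartition φ.J (ψ.J k) i)
    (h3 : ∀ b c, b ≠ c → Disjoint (S b) (S c)) :
    y.1.1 k = ∑ i ∈ Fintype.piFinset S,
      mixedPartial (fun x => ψ.chart (f (φ.chart.symm x)) k) i (φ.chart (φ.toBase z.1)) *
        ∏ b, z.1.1 (i b) := by
  obtain ⟨p, hp, hy⟩ := exists_series_lift_eq hf hMN h hz k
  rw [hy]
  exact sum_partition_eq_sum_mixedPartial hp z.1.1 S h1 h2 h3

theorem lift_eq_zero (hf : ContMDiff 𝓘(ℝ, Fin n → ℝ) 𝓘(ℝ, Fin m → ℝ) ω f)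
    (hMN : ∀ j, MapsTo f (M j) (N j)) {z : φ.model} {y : ψ.model}
    (h : LiftsTo f ⟨φ, z⟩ ⟨ψ, y⟩) (hz : z.1.2 = 0) (k : Fin m)
    (h1 : ∀ r (i : Fin r → Fin n), ¬ IsPartition φ.J (ψ.J k) i) : y.1.1 k = 0 := by
  obtain ⟨p, hp, hy⟩ := exists_series_lift_eq hf hMN h hz k
  rw [hy]
  classical
  refine Finset.sum_eq_zero fun r _ => Finset.sum_eq_zero fun i hi => ?_
  exact absurd (Finset.mem_filter.1 hi).2 (h1 r i)

theorem AdaptedChart.toBase_mem_of_param {z : (Fin n → ℝ) × (Fin l → ℝ)} (hz : z ∈ φ.model)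
    (hz0 : z.2 = 0) (j : Fin l) : φ.toBase z ∈ M j :=
  φ.toBase_mem_of_param_eq_zero hz (by rw [hz0]; rfl)

theorem AdaptedChart.reflectsOrder_of_param (hM : IsAdmissible (n := n) M)
    {z : (Fin n → ℝ) × (Fin l → ℝ)} (hz : z ∈ φ.model) (hz0 : z.2 = 0) : φ.ReflectsOrder :=
  AdaptedChart.reflectsOrder hM (φ.toBase_mem_source hz) (φ.toBase_mem_of_param hz hz0)

theorem lift_eq_of_dagger (hM : IsAdmissible (n := n) M) (hN : IsAdmissible (n := m) N)
    (hf : ContMDiff 𝓘(ℝ, Fin n → ℝ) 𝓘(ℝ, Fin m → ℝ) ω f)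
    (hMN : ∀ j, MapsTo f (M j) (N j)) {z : φ.model} {y : ψ.model}
    (h : LiftsTo f ⟨φ, z⟩ ⟨ψ, y⟩) (hz : z.1.2 = 0) {j : Fin l} (hj : Dagger M N j) {k : Fin m}
    (hk : k ∈ ψ.Ihat j) :
    y.1.1 k = ∑ i ∈ Fintype.piFinset
        (fun a : Fin (Jbar M N j).card => φ.Ihat ((Jbar M N j).orderIsoOfFin rfl a)),
      mixedPartial (fun x => ψ.chart (f (φ.chart.symm x)) k) i (φ.chart (φ.toBase z.1)) *
        ∏ b, z.1.1 (i b) := by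
  have hφ : φ.ReflectsOrder := AdaptedChart.reflectsOrder_of_param hM z.2 hz
  have hψ : ψ.ReflectsOrder := AdaptedChart.reflectsOrder_of_param hN y.2 (h.param_eq.trans hz)
  have hJ : ψ.J k = lowerIdx N j := AdaptedChart.J_eq_lowerIdx hψ hk
  refine lift_eq_sum_mixedPartial hf hMN h hz k _ ?_ ?_ ?_
  · intro r i hi
    rw [hJ] at hi
    exact AdaptedChart.exists_equiv_of_isPartition hφ hM.injective hi
      ((Jbar M N j).orderIsoOfFin rfl).toEquiv
  · intro i hi
    rw [hJ]
    exact AdaptedChart.isPartition_of_mem_Ihat hφ hM.injective hj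
      ((Jbar M N j).orderIsoOfFin rfl).toEquiv (Fintype.mem_piFinset.1 hi)
  · intro b c hbc
    refine Finset.disjoint_left.2 fun i hib hic => hbc ?_
    exact ((Jbar M N j).orderIsoOfFin rfl).injective
      (Subtype.ext (AdaptedChart.eq_of_mem_Ihat hφ hM.injective hib hic))

theorem lift_eq_zero_of_not_dagger (hM : IsAdmissible (n := n) M) (hN : IsAdmissible (n := m) N)
    (hf : ContMDiff 𝓘(ℝ, Fin n → ℝ) 𝓘(ℝ, Fin m → ℝ) ω f)
    (hMN : ∀ j, MapsTo f (M j) (N j)) {z : φ.model} {y : ψ.model}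
    (h : LiftsTo f ⟨φ, z⟩ ⟨ψ, y⟩) (hz : z.1.2 = 0) {j : Fin l} (hj : ¬ Dagger M N j) {k : Fin m}
    (hk : k ∈ ψ.Ihat j) : y.1.1 k = 0 := by
  have hφ : φ.ReflectsOrder := AdaptedChart.reflectsOrder_of_param hM z.2 hz
  have hψ : ψ.ReflectsOrder := AdaptedChart.reflectsOrder_of_param hN y.2 (h.param_eq.trans hz)
  have hJ : ψ.J k = lowerIdx N j := AdaptedChart.J_eq_lowerIdx hψ hk
  refine lift_eq_zero hf hMN h hz k fun r i hi => hj ?_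
  rw [hJ] at hi
  exact AdaptedChart.isDisjointlyGenerated_of_isPartition hφ hM.injective hi

end ZeroSectionLifts

/-! ### Coordinate changes on the zero section -/

section CoordinateChange

variable {n l : ℕ} {X : Type*} [TopologicalSpace X] [ChartedSpace (Fin n → ℝ) X]
  {M : Fin l → Set X} {φ ψ : AdaptedChart n M}

/-- For the identity the only partitions have one block, so only first derivatives in the directions
of `Î_j` remain: the transition functions of `T_{M_j} ι(M_j)`. -/
theorem coordinate_change_zeroSection (hM : IsAdmissible (n := n) M) {z : φ.model} {y : ψ.model}
    (h : LiftsTo id ⟨φ, z⟩ ⟨ψ, y⟩) (hz : z.1.2 = 0) {j : Fin l} {k : Fin n} (hk : k ∈ ψ.Ihat j) :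
    y.1.1 k = fderiv ℝ (fun x => ψ.chart (φ.chart.symm x)) (φ.chart (φ.toBase z.1))
      (fun i => if i ∈ φ.Ihat j then z.1.1 i else 0) k := by
  have hφ : φ.ReflectsOrder := AdaptedChart.reflectsOrder_of_param hM z.2 hz
  have hψ : ψ.ReflectsOrder := AdaptedChart.reflectsOrder_of_param hM y.2 (h.param_eq.trans hz)
  have hJ : ψ.J k = lowerIdx M j := AdaptedChart.J_eq_lowerIdx hψ hk
  rw [lift_eq_sum_mixedPartial contMDiff_id (fun j => mapsTo_id (M j)) h hz k
    (fun _ : Fin 1 => φ.Ihat j)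
    (fun r i hi => by
      rw [hJ] at hi
      exact AdaptedChart.eq_one_of_isPartition_lowerIdx hφ hM.injective hi)
    (fun i hi => by
      rw [hJ]
      exact AdaptedChart.isPartition_lowerIdx hφ (Fintype.mem_piFinset.1 hi))
    (fun b c hbc => absurd (Subsingleton.elim b c) hbc)]
  have hd : DifferentiableAt ℝ (fun x => ψ.chart (φ.chart.symm x)) (φ.chart (φ.toBase z.1)) :=
    (analyticAt_coordinate_change φ.mem_atlas (φ.toBase_mem_source z.2) ψ.mem_atlas
      contMDiffAt_id h.mem_source).differentiableAt
  have hd' : fderiv ℝ (fun x => ψ.chart (φ.chart.symm x) k) (φ.chart (φ.toBase z.1)) =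
      (ContinuousLinearMap.proj (R := ℝ) (φ := fun _ : Fin n => ℝ) k).comp
        (fderiv ℝ (fun x => ψ.chart (φ.chart.symm x)) (φ.chart (φ.toBase z.1))) :=
    ((ContinuousLinearMap.proj (R := ℝ) (φ := fun _ : Fin n => ℝ) k).hasFDerivAt.comp
      _ hd.hasFDerivAt).fderiv
  have hmix : ∀ i : Fin 1 → Fin n,
      mixedPartial (fun x => ψ.chart (id (φ.chart.symm x)) k) i (φ.chart (φ.toBase z.1)) =
      fderiv ℝ (fun x => ψ.chart (φ.chart.symm x)) (φ.chart (φ.toBase z.1))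
        (Pi.single (i 0) 1) k := by
    intro i
    rw [mixedPartial, iteratedFDeriv_one_apply]
    exact DFunLike.congr_fun hd' _
  have hvec : (fun i => if i ∈ φ.Ihat j then z.1.1 i else 0) =
      ∑ i ∈ φ.Ihat j, z.1.1 i • (Pi.single i (1 : ℝ) : Fin n → ℝ) := by
    ext i
    simp [Finset.sum_apply, Pi.single_apply]
  rw [hvec, map_sum, Finset.sum_apply]
  refine Finset.sum_bij' (fun i _ => i 0) (fun i _ => fun _ => i) ?_ ?_ ?_ ?_ ?_
  · exact fun i hi => Fintype.mem_piFinset.1 hi 0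
  · exact fun i hi => Fintype.mem_piFinset.2 fun _ => hi
  · intro i _
    ext a
    rw [Subsingleton.elim a 0]
  · exact fun i _ => rfl
  · intro i _
    rw [hmix, map_smul]
    simp [mul_comm]

end CoordinateChange

/-! ### The identification of the zero section -/

section FibreCoordinates

variable {n l : ℕ} {X : Type*} [TopologicalSpace X] [ChartedSpace (Fin n → ℝ) X]
  {M : Fin l → Set X}

namespace AdaptedChart

variable (φ : AdaptedChart n M)

/-- The coordinates of a tangent vector in an adapted chart. -/
noncomputable def vec (q : X) : TangentSpace 𝓘(ℝ, Fin n → ℝ) q →ₗ[ℝ] (Fin n → ℝ) :=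
  (mfderiv 𝓘(ℝ, Fin n → ℝ) 𝓘(ℝ, Fin n → ℝ) φ.chart q).toLinearMap

variable {φ} {q : X} (hq : q ∈ φ.chart.source)
include hq

theorem vec_bijective : Function.Bijective (φ.vec q) := mfderiv_chart_bijective φ.mem_atlas hq

theorem mem_tangentTo_iff_vec {j : Fin l} (hqj : q ∈ M j) (v : TangentSpace 𝓘(ℝ, Fin n → ℝ) q) :
    v ∈ tangentTo (n := n) (M j) q ↔ ∀ i ∈ φ.I j, φ.vec q v i = 0 :=
  mem_tangentTo_iff hq hqj v

variable (hqM : ∀ j, q ∈ M j)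
include hqM

theorem mem_tangentTo_iota_iff_vec (j : Fin l) (v : TangentSpace 𝓘(ℝ, Fin n → ℝ) q) :
    v ∈ tangentTo (n := n) (iota M j) q ↔ ∀ i ∈ φ.iotaIdx j, φ.vec q v i = 0 :=
  mem_tangentTo_iota_iff hq hqM j v

theorem vec_eq_of_normalClass_eq {j : Fin l} {w w' : tangentTo (n := n) (iota M j) q}
    (h : normalClass M w = normalClass M w') {i : Fin n} (hi : i ∈ φ.I j) :
    φ.vec q w i = φ.vec q w' i := by
  have h1 := (Submodule.Quotient.eq _).1 h
  have h2 : ((w - w' : tangentTo (n := n) (iota M j) q) : TangentSpace 𝓘(ℝ, Fin n → ℝ) q) ∈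
    tangentTo (n := n) (M j) q := h1
  have h3 := (mem_tangentTo_iff_vec hq (hqM j) _).1 h2 i hi
  rw [Submodule.coe_sub, map_sub, Pi.sub_apply, sub_eq_zero] at h3
  exact h3

/-- The coordinates in `I_j` outside `Î_j` vanish on vectors tangent to `ι(M_j)`, so those in `Î_j`
decide whether a difference is tangent to `M_j`. -/
theorem normalClass_eq_of_vec_eq (hφ : φ.ReflectsOrder) {j : Fin l}
    {w w' : tangentTo (n := n) (iota M j) q}
    (h : ∀ i ∈ φ.Ihat j, φ.vec q w i = φ.vec q w' i) : normalClass M w = normalClass M w' := by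
  refine (Submodule.Quotient.eq _).2 ?_
  change ((w - w' : tangentTo (n := n) (iota M j) q) : TangentSpace 𝓘(ℝ, Fin n → ℝ) q) ∈
    tangentTo (n := n) (M j) q
  refine (mem_tangentTo_iff_vec hq (hqM j) _).2 fun i hi => ?_
  by_cases hi' : i ∈ φ.iotaIdx j
  · exact (mem_tangentTo_iota_iff_vec hq hqM j _).1 (w - w').2 i hi'
  · rw [Submodule.coe_sub, map_sub, Pi.sub_apply, h i ((mem_Ihat_iff hφ).2 ⟨hi, hi'⟩), sub_self]

theorem exists_vec_eq (hφ : φ.ReflectsOrder) (j : Fin l) (c : Fin n → ℝ) :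
    ∃ w : tangentTo (n := n) (iota M j) q,
      φ.vec q w = fun i => if i ∈ φ.Ihat j then c i else 0 := by
  obtain ⟨v, hv⟩ := (vec_bijective hq).2 fun i => if i ∈ φ.Ihat j then c i else 0
  refine ⟨⟨v, (mem_tangentTo_iota_iff_vec hq hqM j v).2 fun i hi => ?_⟩, hv⟩
  exact (congrFun hv i).trans (if_neg fun h => ((mem_Ihat_iff hφ).1 h).2 hi)

/-- The fibre coordinates of `T_{M_j} ι(M_j)` at `q`, extended by zero. -/
noncomputable def fibreCoord (j : Fin l) : NormalSpace (n := n) M q j →ₗ[ℝ] (Fin n → ℝ) :=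
  Submodule.liftQ _
    ((LinearMap.pi fun i => if i ∈ φ.Ihat j then LinearMap.proj i else 0) ∘ₗ φ.vec q ∘ₗ
      (tangentTo (n := n) (iota M j) q).subtype) (by
    intro w hw
    rw [LinearMap.mem_ker]
    ext i
    have h2 : ((w : tangentTo (n := n) (iota M j) q) : TangentSpace 𝓘(ℝ, Fin n → ℝ) q) ∈
      tangentTo (n := n) (M j) q := hw
    rw [LinearMap.comp_apply, LinearMap.pi_apply]
    split_ifs with hi
    · exact (mem_tangentTo_iff_vec hq (hqM j) _).1 h2 i (φ.mem_Ihat.1 hi).1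
    · rfl)

theorem fibreCoord_normalClass {j : Fin l} (w : tangentTo (n := n) (iota M j) q) (i : Fin n) :
    fibreCoord hq hqM j (normalClass M w) i = if i ∈ φ.Ihat j then φ.vec q w i else 0 := by
  change ((LinearMap.pi fun i => if i ∈ φ.Ihat j then LinearMap.proj i else 0) (φ.vec q w) :
    Fin n → ℝ) i = _
  rw [LinearMap.pi_apply]
  split_ifs <;> rfl

theorem fibreCoord_injective (hφ : φ.ReflectsOrder) {j : Fin l} {v v' : NormalSpace (n := n) M q j}
    (h : ∀ i ∈ φ.Ihat j, fibreCoord hq hqM j v i = fibreCoord hq hqM j v' i) : v = v' := by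
  obtain ⟨w, rfl⟩ := Submodule.Quotient.mk_surjective _ v
  obtain ⟨w', rfl⟩ := Submodule.Quotient.mk_surjective _ v'
  refine normalClass_eq_of_vec_eq hq hqM hφ fun i hi => ?_
  have := h i hi
  have e := fibreCoord_normalClass hq hqM w i
  have e' := fibreCoord_normalClass hq hqM w' i
  rw [if_pos hi] at e e'
  exact e.symm.trans (this.trans e')

/-- Turns coordinate formulas into linear maps with values in the normal fibre. -/
theorem exists_fibreCoord_section (hφ : φ.ReflectsOrder) (j : Fin l) :
    ∃ B : (Fin n → ℝ) →ₗ[ℝ] NormalSpace (n := n) M q j,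
      ∀ c, ∀ i ∈ φ.Ihat j, fibreCoord hq hqM j (B c) i = c i := by
  let restr : (Fin n → ℝ) →ₗ[ℝ] (φ.Ihat j → ℝ) := LinearMap.funLeft ℝ ℝ Subtype.val
  obtain ⟨g, hg⟩ := LinearMap.exists_rightInverse_of_surjective (restr ∘ₗ fibreCoord hq hqM j) (by
    rw [LinearMap.range_eq_top]
    intro c
    obtain ⟨w, hw⟩ := exists_vec_eq hq hqM hφ j (fun i => if h : i ∈ φ.Ihat j then c ⟨i, h⟩ else 0)
    refine ⟨normalClass M w, ?_⟩
    ext i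
    change fibreCoord hq hqM j (normalClass M w) i = c i
    rw [fibreCoord_normalClass, hw]
    simp)
  refine ⟨g ∘ₗ restr, fun c i hi => ?_⟩
  exact congrFun (LinearMap.congr_fun hg (restr c)) ⟨i, hi⟩

end AdaptedChart

end FibreCoordinates

/-! ### Points of the zero section as families of normal vectors -/

section Representation

variable {n l : ℕ} {X : Type*} [TopologicalSpace X] [ChartedSpace (Fin n → ℝ) X]
  {M : Fin l → Set X} {φ ψ : AdaptedChart n M}

/-- The point `z` of the local model of `φ` over `t = 0` corresponds to the point `v` of the fibre
product of the normal bundles. -/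
structure Represents (φ : AdaptedChart n M) (z : φ.model) (v : NormalProduct n M) : Prop where
  param : z.1.2 = 0
  base : φ.toBase z.1 = v.1
  coord : ∀ j (w : tangentTo (n := n) (iota M j) (v.1 : X)), normalClass M w = v.2 j →
    ∀ i ∈ φ.Ihat j, φ.vec v.1 w i = z.1.1 i

theorem NormalProduct.mem (v : NormalProduct n M) (j : Fin l) : (v.1 : X) ∈ M j :=
  mem_iInter.1 v.1.2 j

namespace Represents

theorem mem_source {z : φ.model} {v : NormalProduct n M} (h : Represents φ z v) :
    (v.1 : X) ∈ φ.chart.source := h.base ▸ φ.toBase_mem_source z.2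

theorem reflectsOrder (hM : IsAdmissible (n := n) M) {z : φ.model} {v : NormalProduct n M}
    (h : Represents φ z v) : φ.ReflectsOrder :=
  AdaptedChart.reflectsOrder_of_param hM z.2 h.param

/-- It suffices to check the coordinates on representatives. -/
theorem of_representatives {z : φ.model} {v : NormalProduct n M} (hp : z.1.2 = 0)
    (hb : φ.toBase z.1 = v.1)
    (h : ∀ j, ∃ w : tangentTo (n := n) (iota M j) (v.1 : X), normalClass M w = v.2 j ∧
      ∀ i ∈ φ.Ihat j, φ.vec v.1 w i = z.1.1 i) : Represents φ z v := by
  refine ⟨hp, hb, fun j w hw i hi => ?_⟩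
  obtain ⟨w', hw', h'⟩ := h j
  have hs : (v.1 : X) ∈ φ.chart.source := hb ▸ φ.toBase_mem_source z.2
  rw [← h' i hi]
  exact AdaptedChart.vec_eq_of_normalClass_eq hs v.mem (hw.trans hw'.symm)
    (φ.mem_Ihat.1 hi).1

theorem canonical (hM : IsAdmissible (n := n) M) {z : φ.model} {v : NormalProduct n M}
    (h : Represents φ z v) (j : Fin l) : ∃ w : tangentTo (n := n) (iota M j) (v.1 : X),
      normalClass M w = v.2 j ∧ φ.vec v.1 w = fun i => if i ∈ φ.Ihat j then z.1.1 i else 0 := by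
  obtain ⟨w, hw⟩ := AdaptedChart.exists_vec_eq h.mem_source v.mem (h.reflectsOrder hM) j z.1.1
  obtain ⟨w', hw'⟩ := Submodule.Quotient.mk_surjective _ (v.2 j)
  refine ⟨w, ?_, hw⟩
  refine Eq.trans ?_ hw'
  refine AdaptedChart.normalClass_eq_of_vec_eq h.mem_source v.mem (h.reflectsOrder hM)
    fun i hi => ?_
  exact ((congrFun hw i).trans (if_pos hi)).trans (h.coord j w' hw' i hi).symm

theorem unique_right (hM : IsAdmissible (n := n) M) {z : φ.model} {v v' : NormalProduct n M}
    (h : Represents φ z v) (h' : Represents φ z v') : v = v' := by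
  obtain ⟨q, v⟩ := v
  obtain ⟨q', v'⟩ := v'
  obtain rfl : q = q' := Subtype.ext (h.base.symm.trans h'.base)
  congr 1
  ext j
  obtain ⟨w, hw, hwz⟩ := h.canonical hM j
  obtain ⟨w', hw', hwz'⟩ := h'.canonical hM j
  refine hw.symm.trans (Eq.trans ?_ hw')
  refine AdaptedChart.normalClass_eq_of_vec_eq h.mem_source (NormalProduct.mem ⟨q, v⟩)
    (h.reflectsOrder hM) fun i _ => ?_
  rw [hwz, hwz']

/-- Coordinates with `J_i = ∅` are read off the base point, and each other one is a fibre
coordinate, lying in some `Î_j`. -/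
theorem unique_left {z z' : φ.model} {v : NormalProduct n M}
    (h : Represents φ z v) (h' : Represents φ z' v) : z = z' := by
  refine Subtype.ext (Prod.ext ?_ (h.param.trans h'.param.symm))
  ext i
  by_cases hi : φ.J i = ∅
  · have h1 := congrFun (φ.chart_toBase z.2) i
    have h2 := congrFun (φ.chart_toBase z'.2) i
    rw [φ.scale_of_param_eq_zero h.param, if_pos hi] at h1
    rw [φ.scale_of_param_eq_zero h'.param, if_pos hi] at h2
    rw [← h1, ← h2, h.base, h'.base]
  · obtain ⟨j, hj⟩ := φ.exists_mem_Ihat hi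
    obtain ⟨w, hw⟩ := Submodule.Quotient.mk_surjective _ (v.2 j)
    rw [← h.coord j w hw i hj, ← h'.coord j w hw i hj]

theorem exists_right (hM : IsAdmissible (n := n) M) (z : φ.model) (hz : z.1.2 = 0) {q : X}
    (hqz : φ.toBase z.1 = q) (hqM : q ∈ ⋂ j, M j) :
    ∃ v : ∀ j, NormalSpace (n := n) M q j, Represents φ z ⟨⟨q, hqM⟩, v⟩ := by
  have hq : q ∈ φ.chart.source := hqz ▸ φ.toBase_mem_source z.2
  choose w hw using AdaptedChart.exists_vec_eq hq (mem_iInter.1 hqM)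
    (AdaptedChart.reflectsOrder_of_param hM z.2 hz)
  refine ⟨fun j => normalClass M (w j z.1.1), of_representatives hz hqz fun j =>
    ⟨w j z.1.1, rfl, fun i hi => ?_⟩⟩
  exact (congrFun (hw j z.1.1) i).trans (if_pos hi)

theorem exists_of_param (hM : IsAdmissible (n := n) M) (z : φ.model) (hz : z.1.2 = 0) :
    ∃ v : NormalProduct n M, Represents φ z v := by
  obtain ⟨v, hv⟩ := exists_right hM z hz (q := φ.toBase z.1) rfl
    (mem_iInter.2 (φ.toBase_mem_of_param z.2 hz))
  exact ⟨_, hv⟩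

theorem exists_left (hM : IsAdmissible (n := n) M) {v : NormalProduct n M}
    (hv : (v.1 : X) ∈ φ.chart.source) : ∃ z : φ.model, Represents φ z v := by
  classical
  have hφ : φ.ReflectsOrder := AdaptedChart.reflectsOrder hM hv v.mem
  choose w hw using fun j => Submodule.Quotient.mk_surjective _ (v.2 j)
  have hex : ∀ i, ∃ x : ℝ, (φ.J i = ∅ → x = φ.chart v.1 i) ∧
      ∀ j, i ∈ φ.Ihat j → φ.vec v.1 (w j) i = x := by
    intro i
    by_cases hi : φ.J i = ∅
    · refine ⟨φ.chart v.1 i, fun _ => rfl, fun j hj => ?_⟩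
      have := φ.mem_J.2 (φ.mem_Ihat.1 hj).1
      simp [hi] at this
    · obtain ⟨j, hj⟩ := φ.exists_mem_Ihat hi
      refine ⟨φ.vec v.1 (w j) i, fun h => absurd h hi, fun k hk => ?_⟩
      rw [AdaptedChart.eq_of_mem_Ihat hφ hM.injective hk hj]
  choose x hx hx' using hex
  have hs : φ.scale (x, 0) = φ.chart v.1 := by
    ext i
    rw [φ.scale_of_param_eq_zero rfl]
    split_ifs with hi
    · exact hx i hi
    · obtain ⟨j, hj⟩ := Finset.nonempty_iff_ne_empty.2 hi
      exact ((φ.mem_iff_of_mem hv (v.mem j) hv).1 (v.mem j) i (φ.mem_J.1 hj)).symm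
  refine ⟨⟨(x, 0), ?_, fun j hj => absurd ⟨v.1, v.mem j, hv⟩ hj⟩, of_representatives rfl ?_ ?_⟩
  · rw [hs]
    exact φ.chart.map_source hv
  · rw [AdaptedChart.toBase, hs, φ.chart.left_inv hv]
  · exact fun j => ⟨w j, hw j, fun i hi => hx' i j hi⟩

/-- Gluing and change of fibre coordinates are the same Jacobian on the coordinates in `Î_j`, so
representation does not depend on the chart. -/
theorem of_liftsTo (hM : IsAdmissible (n := n) M) {z : φ.model} {y : ψ.model}
    {v : NormalProduct n M} (h : Represents φ z v) (hzy : LiftsTo id ⟨φ, z⟩ ⟨ψ, y⟩) :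
    Represents ψ y v := by
  refine of_representatives (hzy.param_eq.trans h.param) (hzy.toBase_eq.trans h.base) fun j => ?_
  obtain ⟨w, hw, hwz⟩ := h.canonical hM j
  refine ⟨w, hw, fun i hi => ?_⟩
  rw [coordinate_change_zeroSection hM hzy h.param hi, ← hwz, h.base]
  have hs : (v.1 : X) ∈ ψ.chart.source := by
    have := hzy.mem_source
    rwa [id, h.base] at this
  exact congrFun (mfderiv_eq_fderiv_comp φ.mem_atlas h.mem_source
    (contMDiffAt_of_mem_maximalAtlas ψ.mem_atlas hs) w) i

theorem liftsTo (hM : IsAdmissible (n := n) M) {z : φ.model} {y : ψ.model}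
    {v : NormalProduct n M} (h : Represents φ z v) (h' : Represents ψ y v) :
    LiftsTo id ⟨φ, z⟩ ⟨ψ, y⟩ := by
  obtain ⟨y', hy'⟩ := LiftsTo.exists (f := (id : X → X)) (a := ⟨φ, z⟩) (ψ := ψ) contMDiff_id
    (fun j => mapsTo_id (M j)) (by
      change φ.toBase z.1 ∈ _
      rw [h.base]; exact h'.mem_source)
  rwa [(h.of_liftsTo hM hy').unique_left h'] at hy'

end Represents

theorem exists_identification [IsManifold 𝓘(ℝ, Fin n → ℝ) ω X] (hM : IsAdmissible (n := n) M) :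
    ∃ σ : ZeroSection n M ≃ NormalProduct n M,
      ∀ (φ : AdaptedChart n M) (z : φ.model) (v : NormalProduct n M), Represents φ z v →
        (σ.symm v : Deformation n M) = Deformation.mk φ z := by
  have hex : ∀ v : NormalProduct n M, ∃ s : ZeroSection n M, ∃ (φ : AdaptedChart n M)
      (z : φ.model), Represents φ z v ∧ (s : Deformation n M) = Deformation.mk φ z := by
    intro v
    obtain ⟨φ, hφ⟩ := exists_adaptedChart hM (v.1 : X)
    obtain ⟨z, hz⟩ := Represents.exists_left hM hφ
    exact ⟨⟨Deformation.mk φ z, hz.param⟩, φ, z, hz, rfl⟩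
  choose S φ z hrep hS using hex
  have hS' : ∀ (ψ : AdaptedChart n M) (y : ψ.model) (v : NormalProduct n M), Represents ψ y v →
      (S v : Deformation n M) = Deformation.mk ψ y := fun ψ y v h =>
    (hS v).trans (Deformation.mk_eq_iff.2 ((hrep v).liftsTo hM h))
  have hinj : Function.Injective S := by
    intro v v' h
    have h1 : Deformation.mk (φ v) (z v) = Deformation.mk (φ v') (z v') :=
      (hS v).symm.trans ((congrArg Subtype.val h).trans (hS v'))
    exact ((hrep v).of_liftsTo hM (Deformation.mk_eq_iff.1 h1)).unique_right hM (hrep v')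
  have hsurj : Function.Surjective S := by
    rintro ⟨s, hs⟩
    obtain ⟨⟨ψ, y⟩, rfl⟩ := Quot.exists_rep s
    obtain ⟨v, hv⟩ := Represents.exists_of_param hM y hs
    exact ⟨v, Subtype.ext (hS' ψ y v hv)⟩
  exact ⟨(Equiv.ofBijective S ⟨hinj, hsurj⟩).symm, hS'⟩

/-- A point of the zero section given in a local model is represented by its image under the
canonical identification. -/
theorem represents_identification (hM : IsAdmissible (n := n) M)
    {σ : ZeroSection n M ≃ NormalProduct n M}
    (hσ : ∀ (φ : AdaptedChart n M) (z : φ.model) (v : NormalProduct n M), Represents φ z v →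
        (σ.symm v : Deformation n M) = Deformation.mk φ z)
    (φ : AdaptedChart n M) (z : φ.model) (hz : Deformation.mk φ z ∈ ZeroSection n M) :
    Represents φ z (σ ⟨Deformation.mk φ z, hz⟩) := by
  obtain ⟨v, hv⟩ := Represents.exists_of_param hM z hz
  have h : σ.symm v = ⟨Deformation.mk φ z, hz⟩ := Subtype.ext (hσ φ z v hv)
  have h' : σ ⟨Deformation.mk φ z, hz⟩ = v := (Equiv.symm_apply_eq σ).1 h |>.symm
  exact h'.symm ▸ hv

theorem isCanonical_identification (hM : IsAdmissible (n := n) M)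
    {σ : ZeroSection n M ≃ NormalProduct n M}
    (hσ : ∀ (φ : AdaptedChart n M) (z : φ.model) (v : NormalProduct n M), Represents φ z v →
        (σ.symm v : Deformation n M) = Deformation.mk φ z) : IsCanonical M σ := by
  intro φ z hz
  have h := represents_identification hM hσ φ z hz
  exact ⟨h.base.symm, h.canonical hM⟩

end Representation

/-! ### The multi-linear maps between the fibres -/

section FibreMaps

theorem map_mem_iInter {ι X Y : Type*} {M : ι → Set X} {N : ι → Set Y} {f : X → Y}
    (hMN : ∀ j, MapsTo f (M j) (N j)) (q : (⋂ j, M j : Set X)) : f q ∈ ⋂ j, N j :=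
  mem_iInter.2 fun j => hMN j (mem_iInter.1 q.2 j)

variable {n m l : ℕ} {X Y : Type*} [TopologicalSpace X] [ChartedSpace (Fin n → ℝ) X]
  [TopologicalSpace Y] [ChartedSpace (Fin m → ℝ) Y] {M : Fin l → Set X} {N : Fin l → Set Y}
  {f : X → Y}

theorem Represents.fibreCoord_eq {φ : AdaptedChart n M} {z : φ.model} {v : NormalProduct n M}
    (h : Represents φ z v) (j : Fin l) {i : Fin n} (hi : i ∈ φ.Ihat j) :
    AdaptedChart.fibreCoord h.mem_source v.mem j (v.2 j) i = z.1.1 i := by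
  obtain ⟨w, hw⟩ := Submodule.Quotient.mk_surjective _ (v.2 j)
  have h1 := AdaptedChart.fibreCoord_normalClass h.mem_source v.mem w i
  rw [if_pos hi] at h1
  exact (congrArg (fun u => AdaptedChart.fibreCoord h.mem_source v.mem j u i) hw.symm).trans
    (h1.trans (h.coord j w hw i hi))

theorem exists_multilinearMap_of_sum {q : X} {J : Finset (Fin l)} {p : ℕ}
    (o : Fin p ≃ J) {φ : AdaptedChart n M} (hq : q ∈ φ.chart.source) (hqM : ∀ j, q ∈ M j)
    (S : Finset (Fin p → Fin n)) (c : (Fin p → Fin n) → ℝ) :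
    ∃ B : MultilinearMap ℝ (fun β : J => NormalSpace (n := n) M q β) ℝ, ∀ v,
      B v = ∑ i ∈ S, c i * ∏ a, AdaptedChart.fibreCoord hq hqM (o a) (v (o a)) (i a) := by
  refine ⟨∑ i ∈ S, c i • (MultilinearMap.mkPiAlgebra ℝ J ℝ).compLinearMap fun β =>
    LinearMap.proj (i (o.symm β)) ∘ₗ AdaptedChart.fibreCoord hq hqM β, fun v => ?_⟩
  rw [sum_apply]
  refine Finset.sum_congr rfl fun i _ => ?_
  rw [smul_apply, MultilinearMap.compLinearMap_apply,
    MultilinearMap.mkPiAlgebra_apply, smul_eq_mul, ← Equiv.prod_comp o]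
  congr 1
  refine Finset.prod_congr rfl fun a _ => ?_
  rw [LinearMap.comp_apply, Equiv.symm_apply_apply]
  rfl

/-- In a fixed pair of charts the sum of mixed partials is visibly multi-linear in the fibre
coordinates, and by `lift_eq_of_dagger` it computes the lift. -/
theorem exists_multilinearMap_of_charts (hM : IsAdmissible (n := n) M)
    (hN : IsAdmissible (n := m) N) (hf : ContMDiff 𝓘(ℝ, Fin n → ℝ) 𝓘(ℝ, Fin m → ℝ) ω f)
    (hMN : ∀ j, MapsTo f (M j) (N j)) {j : Fin l} (hj : Dagger M N j) (q : (⋂ β, M β : Set X))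
    {φ : AdaptedChart n M} {ψ : AdaptedChart m N} (hφ : (q : X) ∈ φ.chart.source)
    (hψ : f q ∈ ψ.chart.source) :
    ∃ A : MultilinearMap ℝ (fun β : Jbar M N j => NormalSpace (n := n) M (q : X) β)
        (NormalSpace (n := m) N (f q) j),
      ∀ (z : φ.model) (y : ψ.model) (v : ∀ β, NormalSpace (n := n) M (q : X) β)
        (v' : ∀ β, NormalSpace (n := m) N (f q) β),
        Represents φ z ⟨q, v⟩ → LiftsTo f ⟨φ, z⟩ ⟨ψ, y⟩ →
        Represents ψ y ⟨⟨f q, map_mem_iInter hMN q⟩, v'⟩ → v' j = A fun β => v β := by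
  have hqM : ∀ j, (q : X) ∈ M j := mem_iInter.1 q.2
  have hqN : ∀ j, f q ∈ N j := mem_iInter.1 (map_mem_iInter hMN q)
  have hψN : ψ.ReflectsOrder := AdaptedChart.reflectsOrder hN hψ hqN
  choose B hB using fun k : Fin m => exists_multilinearMap_of_sum
    ((Jbar M N j).orderIsoOfFin rfl).toEquiv hφ hqM
    (Fintype.piFinset
      (fun a : Fin (Jbar M N j).card => φ.Ihat ((Jbar M N j).orderIsoOfFin rfl a)))
    (fun i => mixedPartial (fun x => ψ.chart (f (φ.chart.symm x)) k) i (φ.chart q))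
  obtain ⟨C, hC⟩ := AdaptedChart.exists_fibreCoord_section hψ hqN hψN j
  refine ⟨C.compMultilinearMap (MultilinearMap.pi B), fun z y v v' hz hzy hy => ?_⟩
  refine AdaptedChart.fibreCoord_injective hψ hqN hψN fun k hk => ?_
  rw [LinearMap.compMultilinearMap_apply, hC _ k hk, MultilinearMap.pi_apply, hB]
  refine (hy.fibreCoord_eq j hk).trans ?_
  rw [lift_eq_of_dagger hM hN hf hMN hzy hz.param hj hk, hz.base]
  refine Finset.sum_congr rfl fun i hi => ?_
  congr 1
  refine Finset.prod_congr rfl fun a _ => ?_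
  exact (hz.fibreCoord_eq _ (Fintype.mem_piFinset.1 hi a)).symm

/-- Independence of the charts comes from transporting points to fixed charts by gluing, with no
need for the transformation law of the mixed partials. -/
theorem exists_multilinearMap [IsManifold 𝓘(ℝ, Fin n → ℝ) ω X] [IsManifold 𝓘(ℝ, Fin m → ℝ) ω Y]
    (hM : IsAdmissible (n := n) M)
    (hN : IsAdmissible (n := m) N) (hf : ContMDiff 𝓘(ℝ, Fin n → ℝ) 𝓘(ℝ, Fin m → ℝ) ω f)
    (hMN : ∀ j, MapsTo f (M j) (N j)) {j : Fin l} (hj : Dagger M N j)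
    (q : (⋂ β, M β : Set X)) :
    ∃ A : MultilinearMap ℝ (fun β : Jbar M N j => NormalSpace (n := n) M (q : X) β)
        (NormalSpace (n := m) N (f q) j),
      ∀ (φ : AdaptedChart n M) (ψ : AdaptedChart m N) (z : φ.model) (y : ψ.model)
        (v : ∀ β, NormalSpace (n := n) M (q : X) β) (v' : ∀ β, NormalSpace (n := m) N (f q) β),
        Represents φ z ⟨q, v⟩ → LiftsTo f ⟨φ, z⟩ ⟨ψ, y⟩ →
        Represents ψ y ⟨⟨f q, map_mem_iInter hMN q⟩, v'⟩ → v' j = A fun β => v β := by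
  obtain ⟨φ₀, hφ₀⟩ := exists_adaptedChart hM (q : X)
  obtain ⟨ψ₀, hψ₀⟩ := exists_adaptedChart hN (f q)
  obtain ⟨A, hA⟩ := exists_multilinearMap_of_charts hM hN hf hMN hj q hφ₀ hψ₀
  refine ⟨A, fun φ ψ z y v v' hz hzy hy => ?_⟩
  obtain ⟨z₀, hz₀⟩ := Represents.exists_left hM (φ := φ₀) (v := ⟨q, v⟩) hφ₀
  obtain ⟨y₀, hy₀⟩ := Represents.exists_left hN (φ := ψ₀)
    (v := ⟨⟨f q, map_mem_iInter hMN q⟩, v'⟩) hψ₀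
  exact hA z₀ y₀ v v' hz₀
    (((hz₀.liftsTo hM hz).comp hzy continuous_id).comp (hy.liftsTo hN hy₀) hf.continuous) hy₀

theorem exists_represents_lift (hM : IsAdmissible (n := n) M) (hN : IsAdmissible (n := m) N)
    (hf : ContMDiff 𝓘(ℝ, Fin n → ℝ) 𝓘(ℝ, Fin m → ℝ) ω f)
    (hMN : ∀ j, MapsTo f (M j) (N j)) {q : (⋂ β, M β : Set X)}
    (v : ∀ β, NormalSpace (n := n) M (q : X) β) {φ : AdaptedChart n M} {ψ : AdaptedChart m N}
    (hφ : (q : X) ∈ φ.chart.source) (hψ : f q ∈ ψ.chart.source) :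
    ∃ (z : φ.model) (y : ψ.model) (v' : ∀ β, NormalSpace (n := m) N (f q) β),
      Represents φ z ⟨q, v⟩ ∧ LiftsTo f ⟨φ, z⟩ ⟨ψ, y⟩ ∧
      Represents ψ y ⟨⟨f q, map_mem_iInter hMN q⟩, v'⟩ := by
  obtain ⟨z, hz⟩ := Represents.exists_left hM (φ := φ) (v := ⟨q, v⟩) hφ
  have hb : φ.toBase z.1 = q := hz.base
  obtain ⟨y, hy⟩ := LiftsTo.exists (a := ⟨φ, z⟩) (ψ := ψ) hf hMN
    (by change f (φ.toBase z.1) ∈ _; rwa [hb])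
  obtain ⟨v', hv'⟩ := Represents.exists_right hN y (hy.param_eq.trans hz.param)
    (q := f q) (by rw [← hb]; exact hy.toBase_eq) (map_mem_iInter hMN q)
  exact ⟨z, y, v', hz, hy, hv'⟩

theorem exists_fibreMaps [IsManifold 𝓘(ℝ, Fin n → ℝ) ω X] [IsManifold 𝓘(ℝ, Fin m → ℝ) ω Y]
    (hM : IsAdmissible (n := n) M)
    (hN : IsAdmissible (n := m) N) (hf : ContMDiff 𝓘(ℝ, Fin n → ℝ) 𝓘(ℝ, Fin m → ℝ) ω f)
    (hMN : ∀ j, MapsTo f (M j) (N j)) :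
    ∃ A : FibreMaps n m f M N, ∀ (φ : AdaptedChart n M) (ψ : AdaptedChart m N) (z : φ.model)
      (y : ψ.model) (q : (⋂ β, M β : Set X)) (v : ∀ β, NormalSpace (n := n) M (q : X) β)
      (v' : ∀ β, NormalSpace (n := m) N (f q) β),
      Represents φ z ⟨q, v⟩ → LiftsTo f ⟨φ, z⟩ ⟨ψ, y⟩ →
      Represents ψ y ⟨⟨f q, map_mem_iInter hMN q⟩, v'⟩ →
      ∀ j (hj : Dagger M N j), v' j = A j hj q fun β => v β := by
  choose A hA using fun j (hj : Dagger M N j) q => exists_multilinearMap hM hN hf hMN hj q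
  exact ⟨A, fun φ ψ z y q v v' hz hzy hy j hj => hA j hj q φ ψ z y v v' hz hzy hy⟩

variable {A : FibreMaps n m f M N} (hMN : ∀ j, MapsTo f (M j) (N j))
  (hA : ∀ (φ : AdaptedChart n M) (ψ : AdaptedChart m N) (z : φ.model)
    (y : ψ.model) (q : (⋂ β, M β : Set X)) (v : ∀ β, NormalSpace (n := n) M (q : X) β)
    (v' : ∀ β, NormalSpace (n := m) N (f q) β),
    Represents φ z ⟨q, v⟩ → LiftsTo f ⟨φ, z⟩ ⟨ψ, y⟩ →
    Represents ψ y ⟨⟨f q, map_mem_iInter hMN q⟩, v'⟩ →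
    ∀ j (hj : Dagger M N j), v' j = A j hj q fun β => v β)

include hA

theorem isPhiHat_of_represents (hM : IsAdmissible (n := n) M) (hN : IsAdmissible (n := m) N)
    (hf : ContMDiff 𝓘(ℝ, Fin n → ℝ) 𝓘(ℝ, Fin m → ℝ) ω f) : IsPhiHat f A := by
  classical
  intro j hj q φ ψ hφ hψ w u hu k hk
  -- The family `w` is extended by zero outside `J̄(j)` to give a point of the zero section; the
  -- extra components do not enter `φ̂_j`.
  let v : ∀ β, NormalSpace (n := n) M (q : X) β := fun β =>
    if h : β ∈ Jbar M N j then normalClass M (w ⟨β, h⟩) else 0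
  have hv : ∀ β : Jbar M N j, normalClass M (w β) = v β := fun β =>
    (dif_pos β.2 : v β = normalClass M (w β)).symm
  obtain ⟨z, y, v', hz, hzy, hy⟩ := exists_represents_lift hM hN hf hMN v hφ hψ
  have hu' : normalClass N u = v' j := by
    rw [hu, hA φ ψ z y q v v' hz hzy hy j hj]
    exact congrArg _ (funext hv)
  refine (hy.coord j u hu' k hk).trans ?_
  rw [lift_eq_of_dagger hM hN hf hMN hzy hz.param hj hk, hz.base]
  refine Finset.sum_congr rfl fun i hi => ?_
  congr 1
  refine Finset.prod_congr rfl fun a _ => ?_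
  exact (hz.coord _ _ (hv _) _ (Fintype.mem_piFinset.1 hi a)).symm

theorem represents_phiProd (hM : IsAdmissible (n := n) M) (hN : IsAdmissible (n := m) N)
    (hf : ContMDiff 𝓘(ℝ, Fin n → ℝ) 𝓘(ℝ, Fin m → ℝ) ω f) {φ : AdaptedChart n M}
    {ψ : AdaptedChart m N} {z : φ.model} {y : ψ.model} {v : NormalProduct n M}
    (hz : Represents φ z v) (hzy : LiftsTo f ⟨φ, z⟩ ⟨ψ, y⟩) :
    Represents ψ y (phiProd f hMN A v) := by
  obtain ⟨q, v⟩ := v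
  have hb : φ.toBase z.1 = q := hz.base
  obtain ⟨v', hy⟩ := Represents.exists_right hN y (hzy.param_eq.trans hz.param)
    (q := f q) (by rw [← hb]; exact hzy.toBase_eq) (map_mem_iInter hMN q)
  have h : (fun j => phi f A j ⟨q, v⟩) = v' := by
    ext j
    by_cases hj : Dagger M N j
    · exact (dif_pos hj).trans (hA φ ψ z y q v v' hz hzy hy j hj).symm
    · refine (dif_neg hj).trans ?_
      refine AdaptedChart.fibreCoord_injective hy.mem_source
        (mem_iInter.1 (map_mem_iInter hMN q)) (hy.reflectsOrder hN) fun k hk => ?_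
      rw [map_zero]
      exact ((hy.fibreCoord_eq j hk).trans
        (lift_eq_zero_of_not_dagger hM hN hf hMN hzy hz.param hj hk)).symm
  subst h
  exact hy

end FibreMaps

/-! ### Multi-conicity -/

section Conic

variable {n m l : ℕ} {X Y : Type*} [TopologicalSpace X] [ChartedSpace (Fin n → ℝ) X]
  [TopologicalSpace Y] [ChartedSpace (Fin m → ℝ) Y] {M : Fin l → Set X} {N : Fin l → Set Y}
  {f : X → Y}

theorem phi_tau (A : FibreMaps n m f M N) (c : Fin l → ℝ) (v : NormalProduct n M) (j : Fin l) :
    phi f A j (tau M c v) = (∏ β ∈ Jbar M N j, c β) • phi f A j v := by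
  unfold phi
  split_ifs with hj
  · have := (A j hj v.1).map_smul_univ (fun β => c β) (fun β => v.2 β)
    refine this.trans ?_
    rw [Finset.prod_coe_sort (Jbar M N j) c]
  · exact (smul_zero _).symm

theorem phiProd_tau (hMN : ∀ j, MapsTo f (M j) (N j)) (A : FibreMaps n m f M N) (c : Fin l → ℝ)
    (v : NormalProduct n M) : phiProd f hMN A (tau M c v) =
      tau N (fun j => ∏ β ∈ Jbar M N j, c β) (phiProd f hMN A v) := by
  unfold phiProd
  exact congrArg (Sigma.mk _) (funext fun j => phi_tau A c v j)

/-- Under (†) the down-sets of the elements of `J̄(j)` partition `J(j)`, so the factors produced by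
`phiProd_tau` multiply to `∏_{N_k ⊆ N_j} c_k`. Without (†) both sides are zero. -/
theorem phiProd_mu [IsManifold 𝓘(ℝ, Fin n → ℝ) ω X] (hM : IsAdmissible (n := n) M)
    (hMN : ∀ j, MapsTo f (M j) (N j)) (A : FibreMaps n m f M N) (c : Fin l → ℝ)
    (v : NormalProduct n M) :
    phiProd f hMN A (mu M c v) = mu N c (phiProd f hMN A v) := by
  obtain ⟨φ, hφ⟩ := exists_adaptedChart hM (v.1 : X)
  have hr : φ.ReflectsOrder := AdaptedChart.reflectsOrder hM hφ v.mem
  refine (phiProd_tau hMN A _ v).trans ?_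
  refine congrArg (Sigma.mk _) (funext fun j => ?_)
  by_cases hj : Dagger M N j
  · exact congrArg (· • phi f A j v) (AdaptedChart.prod_supIdx_prod_lowerIdx hr hM.injective hj c)
  · have h0 : phi f A j v = 0 := dif_neg hj
    exact (congrArg _ h0).trans
      ((smul_zero _).trans ((congrArg _ h0).trans (smul_zero _)).symm)

end Conic

end MultiNormal

/-! ### The main theorem -/

theorem corollary5p5 {n m l : ℕ} {X Y : Type*}
    [TopologicalSpace X] [T2Space X] [SigmaCompactSpace X]
    [ChartedSpace (Fin n → ℝ) X] [IsManifold 𝓘(ℝ, Fin n → ℝ) ω X]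
    [TopologicalSpace Y] [T2Space Y] [SigmaCompactSpace Y]
    [ChartedSpace (Fin m → ℝ) Y] [IsManifold 𝓘(ℝ, Fin m → ℝ) ω Y]
    (M : Fin l → Set X) (N : Fin l → Set Y)
    (hM : IsAdmissible (n := n) M) (hN : IsAdmissible (n := m) N)
    (f : X → Y) (hf : ContMDiff 𝓘(ℝ, Fin n → ℝ) 𝓘(ℝ, Fin m → ℝ) ω f)
    (hMN : ∀ j, MapsTo f (M j) (N j)) :
    -- the index sets do not depend on coordinates: `J_k^N = J(j)` for all `k ∈ Î_j^N`
    (∀ ψ : AdaptedChart m N, ((⋂ j, N j) ∩ ψ.chart.source).Nonempty →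
      ∀ j, ∀ k ∈ ψ.Ihat j, ψ.J k = lowerIdx N j) ∧
    ∃ (σX : ZeroSection n M ≃ NormalProduct n M) (σY : ZeroSection m N ≃ NormalProduct m N)
      (F : Deformation n M → Deformation m N) (A : FibreMaps n m f M N),
      -- the canonical identifications of the zero sections
      IsCanonical M σX ∧ IsCanonical N σY ∧
      -- `F` is the unique extension of `f`
      IsExtension f F ∧ (∀ F', IsExtension f F' → F' = F) ∧
      -- `A` is the family of the multi-linear maps `φ̂_j`
      IsPhiHat f A ∧
      -- `F` restricts to `φ_1 ×_Y ⋯ ×_Y φ_l` on the zero sections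
      (∀ s : ZeroSection n M, F s = σY.symm (phiProd f hMN A (σX s))) ∧
      -- multi-conicity, for the action `τ` and for the action `μ`
      (∀ c : Fin l → ℝ, (∀ j, 0 < c j) → ∀ v : NormalProduct n M,
        phiProd f hMN A (tau M c v) =
          tau N (fun j => ∏ β ∈ Jbar M N j, c β) (phiProd f hMN A v) ∧
        phiProd f hMN A (mu M c v) = mu N c (phiProd f hMN A v))
 := by
  refine ⟨fun ψ h j k hk => AdaptedChart.J_eq_lowerIdx_of_mem_Ihat hN h hk, ?_⟩
  obtain ⟨σX, hσX⟩ := exists_identification hM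
  obtain ⟨σY, hσY⟩ := exists_identification hN
  obtain ⟨F, hF⟩ := exists_extension hN hf hMN
  obtain ⟨A, hA⟩ := exists_fibreMaps hM hN hf hMN
  refine ⟨σX, σY, F, A, isCanonical_identification hM hσX, isCanonical_identification hN hσY,
    isExtension_of_liftsTo hN hf hMN hF, fun F' hF' => ?_, isPhiHat_of_represents hMN hA hM hN hf,
    ?_, fun c _ v => ⟨phiProd_tau hMN A c v, phiProd_mu hM hMN A c v⟩⟩
  · ext s
    obtain ⟨a, rfl⟩ := Quot.exists_rep s
    obtain ⟨b, hab, hb⟩ := IsExtension.eq_mk hf hF' a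
    exact hb.trans (hF a b hab).symm
  · rintro ⟨s, hs⟩
    obtain ⟨⟨φ, z⟩, rfl⟩ := Quot.exists_rep s
    have hz := represents_identification hM hσX φ z hs
    obtain ⟨ψ, hψ⟩ := exists_adaptedChart hN (f (φ.toBase z.1))
    obtain ⟨y, hy⟩ := LiftsTo.exists (a := ⟨φ, z⟩) (ψ := ψ) hf hMN hψ
    exact (hF _ _ hy).trans (hσY ψ y _ (represents_phiProd hMN hA hM hN hf hz hy)).symm
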